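/- Let $\Phi$ be a unital commutative ring containing $\frac12$. A Lie algebra $L$ over $\Phi$ is 3-graded if $L=L_1\oplus L_0\oplus L_{-1}$ for $\Phi$-submodules $L_i$ with $[L_i,L_j]\subseteq L_{i+j}$ (where $L_k=0$ for $k\notin\{0,\pm1\}$); it is Jordan 3-graded if moreover $L_0=[L_1,L_{-1}]$ (the $\Phi$-span of the brackets) and the pair $(L_1,L_{-1})$ has a (quadratic) Jordan pair structure with triple products $\{x,y,z\}=[[x,y],z]$ for $x,z\in L_\sigma$, $y\in L_{-\sigma}$, $\sigma=\pm1$. A Lie algebra $L$ is nondegenerate if $z=0$ is the only $z\in L$ with $(\mathrm{ad}\,z)^2=0$; it is strongly prime if it is nonzero, nondegenerate, and prime, that is, $[I,J]\neq0$ for all nonzero ideals $I,J$ of $L$. The Kostrikin radical $K(L)$ is the smallest ideal of $L$ whose quotient is nondegenerate. Proposition. Let $L=L_1\oplus L_0\oplus L_{-1}$ be a Jordan 3-graded Lie algebra over $\Phi$. Then $L/K(L)$, with the components $(L_i+K(L))/K(L)$, is a Jordan 3-graded Lie algebra, and it is a subdirect product of strongly prime Jordan 3-graded Lie algebras: there are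 a (possibly empty) family $(S_\lambda)_{\lambda\in\Lambda}$ of strongly prime Jordan 3-graded Lie algebras over $\Phi$ and surjective homomorphisms of 3-graded Lie algebras $f_\lambda:L/K(L)\to S_\lambda$ such that the induced homomorphism $L/K(L)\to\prod_{\lambda\in\Lambda}S_\lambda$ is injective. -/

import Mathlib

universe u v w

/-! ### Jordan pairs -/

section JordanPair

variable {Φ : Type u} [CommRing Φ] {V : Type v} {W : Type w}
  [AddCommGroup V] [Module Φ V] [AddCommGroup W] [Module Φ W]

/-- The linearized (triple) product `{x, y, z} = Q_{x+z} y - Q_x y - Q_z y`. -/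
def jordanTriple (Q : QuadraticMap Φ V (W →ₗ[Φ] V)) (x : V) (y : W) (z : V) : V :=
  Q (x + z) y - Q x y - Q z y

/-- The defining identities of a Jordan pair `(V, W)` with quadratic products `Q x y ∈ V` and
`P y x ∈ W` (`x ∈ V`, `y ∈ W`), for one of the two signs. The identities have to hold in all
scalar extensions; since the components of degree `(2)` or `(1, 1)` of an identity, as well as the
`(2, 2)` component of one of degree four, are obtained by polarization over any base ring, this
means that `jp1`, `jp2`, `jp3` hold together with the components `jp1_lin` of degree `(2, 1)` of
`jp1` and `jp3_lin` of degree `(3, 1)` of `jp3` in the first variable. -/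
structure JordanPairIdentities (Q : QuadraticMap Φ V (W →ₗ[Φ] V))
    (P : QuadraticMap Φ W (V →ₗ[Φ] W)) : Prop where
  /-- `D(x, y) Q_x = Q_x D(y, x)`. -/
  jp1 : ∀ (x : V) (y w : W),
    jordanTriple Q x y (Q x w) = Q x (jordanTriple P y x w)
  jp1_lin : ∀ (x z : V) (y w : W),
    jordanTriple Q z y (Q x w) + jordanTriple Q x y (jordanTriple Q x w z) =
      Q x (jordanTriple P y z w) + jordanTriple Q x (jordanTriple P y x w) z
  /-- `D(Q_x y, y) = D(x, Q_y x)`. -/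
  jp2 : ∀ (x z : V) (y : W),
    jordanTriple Q (Q x y) y z = jordanTriple Q x (P y x) z
  /-- `Q_{Q_x y} = Q_x Q_y Q_x`. -/
  jp3 : ∀ (x : V) (y w : W), Q (Q x y) w = Q x (P y (Q x w))
  jp3_lin : ∀ (x z : V) (y w : W),
    jordanTriple Q (Q x y) w (jordanTriple Q x y z) =
      jordanTriple Q x (P y (Q x w)) z + Q x (P y (jordanTriple Q x w z))

end JordanPair

/-- A (quadratic) Jordan pair structure on a pair `(Vp, Vm)` of `Φ`-modules. -/
structure JordanPair (Φ : Type u) [CommRing Φ] (Vp : Type v) (Vm : Type w)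
    [AddCommGroup Vp] [Module Φ Vp] [AddCommGroup Vm] [Module Φ Vm] where
  /-- The product `Q_x y` for `x ∈ V⁺`, `y ∈ V⁻`. -/
  Qp : QuadraticMap Φ Vp (Vm →ₗ[Φ] Vp)
  /-- The product `Q_y x` for `y ∈ V⁻`, `x ∈ V⁺`. -/
  Qm : QuadraticMap Φ Vm (Vp →ₗ[Φ] Vm)
  identities_plus : JordanPairIdentities Qp Qm
  identities_minus : JordanPairIdentities Qm Qp

/-! ### Jordan 3-graded Lie algebras -/

section Graded

variable {Φ : Type u} [CommRing Φ] {L : Type v} [LieRing L] [LieAlgebra Φ L]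

/-- `L = L₁ ⊕ L₀ ⊕ L₋₁` is a 3-graded Lie algebra. -/
structure IsThreeGrading (𝓛 : ℤ → Submodule Φ L) : Prop where
  isInternal : DirectSum.IsInternal 𝓛
  lie_mem : ∀ (i j : ℤ) (x y : L), x ∈ 𝓛 i → y ∈ 𝓛 j → ⁅x, y⁆ ∈ 𝓛 (i + j)
  eq_bot : ∀ i : ℤ, i ≠ 1 → i ≠ 0 → i ≠ -1 → 𝓛 i = ⊥

/-- `L = L₁ ⊕ L₀ ⊕ L₋₁` is a Jordan 3-graded Lie algebra: `L₀ = [L₁, L₋₁]`, and `(L₁, L₋₁)` has a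
Jordan pair structure with triple products `{x, y, z} = [[x, y], z]`. -/
structure IsJordanThreeGrading (𝓛 : ℤ → Submodule Φ L) : Prop extends IsThreeGrading 𝓛 where
  zero_eq : 𝓛 0 = Submodule.span Φ {z : L | ∃ x ∈ 𝓛 1, ∃ y ∈ 𝓛 (-1), ⁅x, y⁆ = z}
  exists_jordanPair : ∃ J : JordanPair Φ (𝓛 1) (𝓛 (-1)),
    (∀ (x z : 𝓛 1) (y : 𝓛 (-1)),
      ((jordanTriple J.Qp x y z : 𝓛 1) : L) = ⁅⁅(x : L), (y : L)⁆, (z : L)⁆) ∧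
    (∀ (y w : 𝓛 (-1)) (x : 𝓛 1),
      ((jordanTriple J.Qm y x w : 𝓛 (-1)) : L) = ⁅⁅(y : L), (x : L)⁆, (w : L)⁆)

/-- The images in `L ⧸ I` of the components of a grading of `L`. -/
def quotientGrading (𝓛 : ℤ → Submodule Φ L) (I : LieIdeal Φ L) (n : ℤ) : Submodule Φ (L ⧸ I) :=
  (𝓛 n).map I.toSubmodule.mkQ

end Graded

/-! ### Nondegeneracy, strong primeness, the Kostrikin radical -/

/-- `L` is nondegenerate: `(ad z)² = 0` only for `z = 0`. -/
def IsNondegenerateLie (L : Type v) [LieRing L] : Prop :=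
  ∀ z : L, (∀ x : L, ⁅z, ⁅z, x⁆⁆ = 0) → z = 0

/-- `L` is strongly prime: it is nonzero, prime (the product of two nonzero ideals is nonzero) and
nondegenerate. -/
structure IsStronglyPrimeLie (Φ : Type u) [CommRing Φ] (L : Type v) [LieRing L]
    [LieAlgebra Φ L] : Prop where
  nontrivial : Nontrivial L
  prime : ∀ I J : LieIdeal Φ L, ⁅I, J⁆ = ⊥ → I = ⊥ ∨ J = ⊥
  nondegenerate : IsNondegenerateLie L

/-- The Kostrikin radical `K(L)`: the smallest ideal with nondegenerate quotient (see
`kostrikinRadical_isLeast`). -/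
def kostrikinRadical (Φ : Type u) [CommRing Φ] (L : Type v) [LieRing L] [LieAlgebra Φ L] :
    LieIdeal Φ L :=
  sInf {I : LieIdeal Φ L | IsNondegenerateLie (L ⧸ I)}

theorem isNondegenerateLie_quotient_iff {Φ : Type u} [CommRing Φ] {L : Type v} [LieRing L]
    [LieAlgebra Φ L] (I : LieIdeal Φ L) :
    IsNondegenerateLie (L ⧸ I) ↔ ∀ z : L, (∀ x : L, ⁅z, ⁅z, x⁆⁆ ∈ I) → z ∈ I := by
  constructor
  · intro h z hz
    rw [← LieSubmodule.Quotient.mk_eq_zero' (N := I)]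
    refine h _ fun x => ?_
    obtain ⟨x, rfl⟩ := LieSubmodule.Quotient.surjective_mk' I x
    exact (LieSubmodule.Quotient.mk_eq_zero' (N := I)).2 (hz x)
  · intro h z hz
    obtain ⟨z, rfl⟩ := LieSubmodule.Quotient.surjective_mk' I z
    refine (LieSubmodule.Quotient.mk_eq_zero' (N := I)).2 (h z fun x => ?_)
    exact (LieSubmodule.Quotient.mk_eq_zero' (N := I)).1 (hz (LieSubmodule.Quotient.mk x))

theorem kostrikinRadical_isLeast (Φ : Type u) [CommRing Φ] (L : Type v) [LieRing L]
    [LieAlgebra Φ L] :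
    IsLeast {I : LieIdeal Φ L | IsNondegenerateLie (L ⧸ I)} (kostrikinRadical Φ L) := by
  refine ⟨?_, fun I hI => sInf_le hI⟩
  refine (isNondegenerateLie_quotient_iff _).2 fun z hz => ?_
  have key : ∀ y : L, y ∈ kostrikinRadical Φ L ↔
      ∀ I : LieIdeal Φ L, IsNondegenerateLie (L ⧸ I) → y ∈ I := fun y => by
    rw [kostrikinRadical, ← SetLike.mem_coe, LieSubmodule.coe_sInf]
    simp
  exact (key z).2 fun I hI => (isNondegenerateLie_quotient_iff I).1 hI z fun x =>
    (key _).1 (hz x) I hI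

/-! ### Subdirect products -/

/-- The homomorphisms `f i : A → S i` present the 3-graded Lie algebra `A` as a subdirect product
of the 3-graded Lie algebras `S i`: together they embed `A` into the product of the `S i`, each
of them is onto, and they preserve the gradings. -/
structure IsGradedSubdirectProduct {Φ : Type u} [CommRing Φ] {A : Type v} [LieRing A]
    [LieAlgebra Φ A] (𝓐 : ℤ → Submodule Φ A) {ι : Type w} {S : ι → Type v}
    [∀ i, LieRing (S i)] [∀ i, LieAlgebra Φ (S i)] (𝓢 : ∀ i, ℤ → Submodule Φ (S i))
    (f : ∀ i, A →ₗ⁅Φ⁆ S i) : Prop where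
  injective : Function.Injective fun (x : A) (i : ι) => f i x
  surjective : ∀ i, Function.Surjective (f i)
  map_mem : ∀ (i : ι) (n : ℤ) (x : A), x ∈ 𝓐 n → f i x ∈ 𝓢 i n

/-! The radical `K(L)` is graded, so `L/K(L)` is a nondegenerate Jordan 3-graded algebra. It remains
to find, for each nonzero `x` in such an algebra, a graded ideal `P` that misses `x` and has
strongly prime quotient. Taking a homogeneous component, bracketing once with an outer element if
that component has degree zero, and using the symmetry of the grading, one may assume that `x` has
degree one.

The ideal comes from a Jordan version of the m-sequences of ring theory. Starting from `s 0 = x`,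
each `s (k + 1) = ⁅⁅u, b⁆, u⁆` is nonzero with `u` in the graded ideal generated by `s k`. Let `P`
be maximal among the graded ideals missing all `s k`. Then every nonzero graded ideal of the
quotient contains a term of the sequence, two such ideals contain a common `u`, and so their bracket
is nonzero.

Nondegeneracy of the quotient needs more. The absolute zero divisors of a Jordan pair span the outer
components of a graded ideal (`zideal`), and the degree-one elements of that ideal are nil of
bounded index in all homotopes, even over power series (`exists_pw_eq_zero`). The sequence is
therefore also required to satisfy: `s (k + 1)` lies in the graded ideal generated by a coefficient
of some `k`-th homotope power of each `s j`, `j ≤ k`. If `zideal` were nonzero in the quotient, it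
would contain some `s k`, whose high powers vanish, and a later term would be zero.

Such sequences exist because, without absolute zero divisors, a nonzero element is not nil of
bounded index in the homotopes over power series (`eq_zero_of_pw_series`). This is applied modulo
annihilators of graded ideals, which are semiprime in degree one (`mem_ann_of_sq`). The required
Jordan theory is derived from the bracket form of JP1 and the absence of 2-torsion alone. -/

/-! ### Jordan pairs inside Lie rings; power associativity of homotopes -/

/-- The Jordan pair identities for additive subgroups `P`, `N` of a Lie ring without 2-torsion, in
terms of the bracket. -/
structure IsJPair {M : Type*} [LieRing M] (P N : AddSubgroup M) : Prop where
  two : ∀ m : M, m + m = 0 → m = 0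
  comm_p : ∀ x ∈ P, ∀ z ∈ P, ⁅x, z⁆ = 0
  comm_m : ∀ y ∈ N, ∀ w ∈ N, ⁅y, w⁆ = 0
  mem_p : ∀ x ∈ P, ∀ y ∈ N, ∀ z ∈ P, ⁅⁅x, y⁆, z⁆ ∈ P
  mem_m : ∀ y ∈ N, ∀ x ∈ P, ∀ w ∈ N, ⁅⁅y, x⁆, w⁆ ∈ N
  jp1_p : ∀ x ∈ P, ∀ y ∈ N, ∀ w ∈ N, ⁅⁅x, y⁆, ⁅x, ⁅x, w⁆⁆⁆ + ⁅x, ⁅x, ⁅⁅x, y⁆, w⁆⁆⁆ = 0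
  jp1_m : ∀ y ∈ N, ∀ x ∈ P, ∀ z ∈ P, ⁅⁅y, x⁆, ⁅y, ⁅y, z⁆⁆⁆ + ⁅y, ⁅y, ⁅⁅y, x⁆, z⁆⁆⁆ = 0

/-- The powers of `x` in the homotope given by `b`, up to signs and powers of two. -/
def pw {M : Type*} [LieRing M] (x b : M) : ℕ → M
  | 0 => x
  | n + 1 => ⁅⁅x, b⁆, pw x b n⁆

namespace IsJPair
variable {M : Type*} [LieRing M] {P N : AddSubgroup M}

theorem symm (H : IsJPair P N) : IsJPair N P :=
  ⟨H.two, H.comm_m, H.comm_p, H.mem_m, H.mem_p, H.jp1_m, H.jp1_p⟩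

theorem swap (H : IsJPair P N) {x z : M} (hx : x ∈ P) (hz : z ∈ P) (m : M) :
    ⁅x, ⁅z, m⁆⁆ = ⁅z, ⁅x, m⁆⁆ := by
  rw [← sub_eq_zero, ← lie_lie, H.comm_p x hx z hz, zero_lie]

theorem mem2 (H : IsJPair P N) {x z y : M} (hx : x ∈ P) (hz : z ∈ P) (hy : y ∈ N) :
    ⁅x, ⁅z, y⁆⁆ ∈ P := by
  rw [← lie_skew]; exact P.neg_mem (H.mem_p _ hz _ hy _ hx)

theorem mem2' (H : IsJPair P N) {x z y : M} (hx : x ∈ P) (hz : z ∈ P) (hy : y ∈ N) :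
    ⁅x, ⁅y, z⁆⁆ ∈ P := by
  rw [← lie_skew y z, lie_neg]; exact P.neg_mem (H.mem2 hx hz hy)

theorem lie3 (H : IsJPair P N) {x z y v : M} (hx : x ∈ P) (hz : z ∈ P) (hy : y ∈ N) (hv : v ∈ P) :
    ⁅x, ⁅z, ⁅y, v⁆⁆⁆ = 0 := H.comm_p _ hx _ (H.mem2' hz hv hy)

theorem mem_h (H : IsJPair P N) {x y w : M} (hx : x ∈ P) (hy : y ∈ N) (hw : w ∈ N) :
    ⁅⁅x, y⁆, w⁆ ∈ N := by
  rw [← lie_skew x y, neg_lie]; exact N.neg_mem (H.mem_m _ hy _ hx _ hw)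

theorem anti_p (H : IsJPair P N) {x y w : M} (hx : x ∈ P) (hy : y ∈ N) (hw : w ∈ N) :
    ⁅⁅x, y⁆, ⁅x, ⁅x, w⁆⁆⁆ = -⁅x, ⁅x, ⁅⁅x, y⁆, w⁆⁆⁆ :=
  eq_neg_of_add_eq_zero_left (H.jp1_p x hx y hy w hw)

theorem anti_m (H : IsJPair P N) {x y z : M} (hx : x ∈ P) (hy : y ∈ N) (hz : z ∈ P) :
    ⁅⁅x, y⁆, ⁅y, ⁅y, z⁆⁆⁆ = -⁅y, ⁅y, ⁅⁅x, y⁆, z⁆⁆⁆ := by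
  have := H.jp1_m y hy x hx z hz
  simp only [← lie_skew x y, neg_lie, lie_neg]
  rw [eq_neg_of_add_eq_zero_left this]

/-- Degree `(2, 1)` of `jp1`. -/
theorem jp1_lin (H : IsJPair P N) {x z y w : M} (hx : x ∈ P) (hz : z ∈ P) (hy : y ∈ N)
    (hw : w ∈ N) :
    ⁅⁅z, y⁆, ⁅x, ⁅x, w⁆⁆⁆ + ⁅x, ⁅x, ⁅⁅z, y⁆, w⁆⁆⁆ +
      (2 : ℤ) • (⁅⁅x, y⁆, ⁅x, ⁅z, w⁆⁆⁆ + ⁅x, ⁅z, ⁅⁅x, y⁆, w⁆⁆⁆) = 0 := by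
  apply H.two
  have e1 := H.jp1_p _ (P.add_mem hx hz) y hy w hw
  have e2 := H.jp1_p _ (P.sub_mem hx hz) y hy w hw
  have e3 := H.jp1_p _ hz y hy w hw
  simp only [lie_add, add_lie, lie_sub, sub_lie, H.swap hz hx] at e1 e2 e3 ⊢
  linear_combination (norm := module) e1 - e2 - (2 : ℤ) • e3

theorem pw_mem (H : IsJPair P N) {x b : M} (hx : x ∈ P) (hb : b ∈ N) (n : ℕ) : pw x b n ∈ P := by
  induction n with
  | zero => exact hx
  | succ n ih => exact H.mem_p _ hx _ hb _ ih

/-- The elements acting trivially on both components. -/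
def killer (P N : AddSubgroup M) : AddSubgroup M where
  carrier := {k | (∀ v ∈ P, ⁅k, v⁆ = 0) ∧ ∀ v ∈ N, ⁅k, v⁆ = 0}
  zero_mem' := by simp
  add_mem' := fun {a c} ha hc => ⟨fun v hv => by rw [add_lie, ha.1 v hv, hc.1 v hv, add_zero],
    fun v hv => by rw [add_lie, ha.2 v hv, hc.2 v hv, add_zero]⟩
  neg_mem' := fun {a} ha => ⟨fun v hv => by rw [neg_lie, ha.1 v hv, neg_zero],
    fun v hv => by rw [neg_lie, ha.2 v hv, neg_zero]⟩

theorem lie_killer {k x b : M} (hk : k ∈ killer P N) (hx : x ∈ P) (hb : b ∈ N) :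
    ⁅⁅x, b⁆, k⁆ = 0 := by
  rw [lie_lie, ← lie_skew b k, hk.2 b hb, ← lie_skew x k, hk.1 x hx]; simp

/-- The Leibniz rule produces `⁅⁅x, y⁆, ⁅x, w⁆⁆` and its negative, which cancel; the other terms
agree because `y` and `w` commute. At `w = y` this is twice JP2, which therefore needs no separate
hypothesis. -/
theorem jp2_lin (H : IsJPair P N) {x y w : M} (hy : y ∈ N) (hw : w ∈ N) :
    ⁅⁅⁅x, y⁆, x⁆, w⁆ + ⁅⁅⁅x, w⁆, x⁆, y⁆ = (2 : ℤ) • ⁅x, ⁅⁅y, x⁆, w⁆⁆ := by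
  have e : ⁅y, ⁅w, x⁆⁆ = ⁅w, ⁅y, x⁆⁆ := H.symm.swap hy hw x
  have e1 := leibniz_lie ⁅x, y⁆ x w
  have e2 := leibniz_lie ⁅x, w⁆ x y
  have e4 : ⁅⁅y, x⁆, w⁆ = - ⁅⁅x, y⁆, w⁆ := by rw [← neg_lie, lie_skew]
  have e3 : ⁅⁅x, w⁆, y⁆ = ⁅⁅x, y⁆, w⁆ := by
    rw [← lie_skew ⁅x, w⁆ y, ← lie_skew ⁅x, y⁆ w, ← lie_skew x w, ← lie_skew x y, lie_neg, lie_neg,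
      e]
  rw [e3] at e2
  rw [e4, lie_neg]
  have e5 := lie_skew ⁅x, y⁆ ⁅x, w⁆
  linear_combination (norm := module) -e1 - e2 - e5

theorem lie_pw_pw (x b : M) (n m : ℕ) :
    ⁅⁅x, b⁆, ⁅pw x b n, pw b x m⁆⁆ = ⁅pw x b (n + 1), pw b x m⁆ - ⁅pw x b n, pw b x (m + 1)⁆ := by
  simp only [pw]
  rw [leibniz_lie, ← lie_skew b x, neg_lie, lie_neg, sub_neg_eq_add]

theorem pw_succ_eq (H : IsJPair P N) {x b : M} (hx : x ∈ P) (hb : b ∈ N) (n : ℕ) :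
    ⁅⁅pw x b n, b⁆, x⁆ = pw x b (n + 1) := by
  have hc := H.comm_p _ hx _ (H.pw_mem hx hb n)
  have e := leibniz_lie x (pw x b n) b
  rw [hc, zero_lie, zero_add] at e
  rw [pw, ← lie_skew ⁅pw x b n, b⁆ x, e, lie_skew]

theorem sub_mem_killer_succ (H : IsJPair P N) {x b : M} (hx : x ∈ P) (hb : b ∈ N) (n : ℕ)
    (he : ⁅pw x b n, b⁆ - ⁅x, pw b x n⁆ ∈ killer P N)
    (hA : ⁅⁅x, b⁆, ⁅pw x b n, b⁆⁆ ∈ killer P N) :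
    ⁅pw x b (n + 1), b⁆ - ⁅x, pw b x (n + 1)⁆ ∈ killer P N := by
  have hbn := H.symm.pw_mem hb hx n
  have h1 := lie_killer he hx hb
  rw [lie_sub, sub_eq_zero] at h1
  have h2 := lie_pw_pw x b 0 n
  have h3 := H.jp2_lin (x := x) hb hbn
  have h4 := he.1 x hx
  rw [sub_lie, H.pw_succ_eq hx hb, sub_eq_zero] at h4
  rw [← h4] at h3
  rw [h1] at hA
  change ⁅⁅x, b⁆, ⁅x, pw b x n⁆⁆ = ⁅⁅⁅x, b⁆, x⁆, pw b x n⁆ - ⁅x, pw b x (n + 1)⁆ at h2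
  change _ = (2 : ℤ) • ⁅x, pw b x (n + 1)⁆ at h3
  convert neg_mem hA using 1
  rw [h2]
  linear_combination (norm := module) h3

theorem anti_pw_p (H : IsJPair P N) {x b : M} (hx : x ∈ P) (hb : b ∈ N)
    {n : ℕ} (he : ⁅pw x b n, b⁆ - ⁅x, pw b x n⁆ ∈ killer P N) {w : M} (hw : w ∈ N) :
    ⁅⁅pw x b n, b⁆, ⁅x, ⁅x, w⁆⁆⁆ = -⁅x, ⁅x, ⁅⁅pw x b n, b⁆, w⁆⁆⁆ := by
  have h1 := he.1 _ (H.mem2 hx hx hw)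
  have h2 := he.2 _ hw
  rw [sub_lie, sub_eq_zero] at h1 h2
  rw [h1, h2, H.anti_p hx (H.symm.pw_mem hb hx n) hw]

/-- Put `k = ⁅pw x b n, b⁆`, so that `pw x b (n + 1) = ⁅k, x⁆`. Expanding the commutation of `x`
with `⁅k, x⁆` and using `anti_pw_p` gives `2⁅x, ⁅k, ⁅x, w⁆⁆⁆ = 0`, which leaves the asserted term.
-/
theorem lie_pw_succ (H : IsJPair P N) {x b : M} (hx : x ∈ P) (hb : b ∈ N)
    {n : ℕ} (he : ⁅pw x b n, b⁆ - ⁅x, pw b x n⁆ ∈ killer P N) {w : M}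
    (hw : w ∈ N) : ⁅x, ⁅pw x b (n + 1), w⁆⁆ = ⁅⁅pw x b n, b⁆, ⁅x, ⁅x, w⁆⁆⁆ := by
  have h1 := H.anti_pw_p hx hb he hw
  have h2 := H.pw_succ_eq hx hb n
  have hc := H.swap hx (H.pw_mem hx hb (n + 1)) w
  rw [← h2] at hc ⊢
  simp only [lie_lie (⁅pw x b n, b⁆) x, lie_sub] at hc ⊢
  apply sub_eq_zero.1
  apply H.two
  linear_combination (norm := module) hc - h1

theorem lie_pw_succ_p (H : IsJPair P N) {x b : M} (hx : x ∈ P) (hb : b ∈ N)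
    (n : ℕ) {v : M} (hv : v ∈ P) :
    ⁅⁅pw x b (n + 1), b⁆, v⁆ = ⁅⁅x, b⁆, ⁅⁅pw x b n, b⁆, v⁆⁆ + ⁅⁅pw x b n, b⁆, ⁅⁅x, b⁆, v⁆⁆
      - ⁅x, ⁅pw x b n, ⁅b, ⁅b, v⁆⁆⁆⁆ := by
  have hxn := H.pw_mem hx hb n
  simp only [pw, lie_lie, lie_sub, sub_lie, H.comm_p _ hx _ hv, H.comm_p _ hxn _ hv, H.lie3 hx hxn hb hv, lie_zero,
    H.swap hxn hx]
  abel

theorem lie_pw_succ_m (H : IsJPair P N) {x b : M} (hx : x ∈ P) (hb : b ∈ N)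
    (n : ℕ) {v : M} (hv : v ∈ N) :
    ⁅⁅pw x b (n + 1), b⁆, v⁆ = ⁅b, ⁅b, ⁅x, ⁅pw x b n, v⁆⁆⁆⁆ -
      (⁅⁅x, b⁆, ⁅⁅pw x b n, b⁆, v⁆⁆ + ⁅⁅pw x b n, b⁆, ⁅⁅x, b⁆, v⁆⁆) := by
  have hxn := H.pw_mem hx hb n
  simp only [pw, lie_lie, lie_sub, sub_lie, H.comm_m _ hb _ hv, lie_zero, H.symm.lie3 hb hb hxn hv,
    H.symm.lie3 hb hb hx hv]
  abel

/-- Power associativity of the homotope. It is stated modulo `killer` because an element acting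
trivially on both components need not vanish. The recursions `lie_pw_succ_p` and `lie_pw_succ_m`
build the action of `⁅pw x b (n + 1), b⁆` from operators that commute with `ad ⁅x, b⁆`. -/
theorem killer_induction (H : IsJPair P N) {x b : M} (hx : x ∈ P) (hb : b ∈ N)
    (n : ℕ) : ⁅pw x b n, b⁆ - ⁅x, pw b x n⁆ ∈ killer P N ∧
    ⁅⁅x, b⁆, ⁅pw x b n, b⁆⁆ ∈ killer P N := by
  induction n using Nat.strong_induction_on with
  | _ n ih =>
  rcases n with - | n
  · simp [pw]
  obtain ⟨he, hA⟩ := ih n (by omega)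
  refine ⟨H.sub_mem_killer_succ hx hb n he hA, ?_⟩
  have hxn := H.pw_mem hx hb n
  -- Passing `ad ⁅x, b⁆` through one quadratic operator changes the sign; `anti_m` supplies the
  -- second sign, so the product of the two operators commutes with it. For positive `n` this uses
  -- the case two steps below the goal, hence the strong induction.
  have key : ∀ w ∈ N, ⁅⁅x, b⁆, ⁅x, ⁅pw x b n, w⁆⁆⁆ = -⁅x, ⁅pw x b n, ⁅⁅x, b⁆, w⁆⁆⁆ := by
    intro w hw
    rcases n with - | n
    · exact H.anti_p hx hb hw
    obtain ⟨he', hA'⟩ := ih n (by omega)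
    rw [H.lie_pw_succ hx hb he' hw, H.lie_pw_succ hx hb he' (H.mem_h hx hb hw), leibniz_lie,
      hA'.1 _ (H.mem2 hx hx hw), H.anti_p hx hb hw, lie_neg, zero_add]
  constructor
  · intro v hv
    have hh := H.mem_p _ hx _ hb v hv
    have h1 := hA.1 v hv
    have h2 := hA.1 _ hh
    have h3 := key _ (H.symm.mem2 hb hb hv)
    have h4 := H.anti_m hx hb hv
    rw [lie_lie ⁅x, b⁆, sub_eq_zero] at h1 h2
    rw [lie_lie ⁅x, b⁆, H.lie_pw_succ_p hx hb n hv, H.lie_pw_succ_p hx hb n hh, lie_sub, lie_add,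
      h3, h4, lie_neg, lie_neg, h1]
    linear_combination (norm := abel) h2
  · intro v hv
    have hh := H.mem_h hx hb hv
    have h1 := hA.2 v hv
    have h2 := hA.2 _ hh
    have h3 := key _ hv
    have h4 := H.anti_m hx hb (H.mem2 hx hxn hv)
    rw [lie_lie ⁅x, b⁆, sub_eq_zero] at h1 h2
    rw [lie_lie ⁅x, b⁆, H.lie_pw_succ_m hx hb n hv, H.lie_pw_succ_m hx hb n hh, lie_sub, lie_add,
      h4, h3, lie_neg, lie_neg, h1]
    linear_combination (norm := abel) -h2
end IsJPair

/-! ### Operator calculus in a homotope and the fundamental formula -/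

/-- `v` for `n = 0`, and `[[xₙ₋₁, b], v]` for `n > 0`, with `xₙ = pw x b n`. -/
def kap {M : Type*} [LieRing M] (x b : M) : ℕ → M → M
  | 0, v => v
  | n + 1, v => ⁅⁅pw x b n, b⁆, v⁆

theorem kap_zero {M : Type*} [LieRing M] (x b v : M) : kap x b 0 v = v := rfl

theorem kap_zero_right {M : Type*} [LieRing M] (x b : M) (n : ℕ) : kap x b n 0 = 0 := by
  cases n <;> simp [kap]

theorem kap_add {M : Type*} [LieRing M] (x b : M) (n : ℕ) (v w : M) :
    kap x b n (v + w) = kap x b n v + kap x b n w := by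
  cases n <;> simp [kap]

theorem kap_neg {M : Type*} [LieRing M] (x b : M) (n : ℕ) (v : M) :
    kap x b n (-v) = -kap x b n v := by
  cases n <;> simp [kap]

theorem kap_sub {M : Type*} [LieRing M] (x b : M) (n : ℕ) (v w : M) :
    kap x b n (v - w) = kap x b n v - kap x b n w := by
  rw [sub_eq_add_neg, kap_add, kap_neg, sub_eq_add_neg]

theorem kap_zsmul {M : Type*} [LieRing M] (x b : M) (n : ℕ) (k : ℤ) (v : M) :
    kap x b n (k • v) = k • kap x b n v := by
  cases n <;> simp [kap]

/-- `2κᵢκⱼ - κᵢ₊ⱼ`. -/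
def kap2 {M : Type*} [LieRing M] (x b : M) (i j : ℕ) (v : M) : M :=
  (2 : ℤ) • kap x b i (kap x b j v) - kap x b (i + j) v

namespace IsJPair
variable {M : Type*} [LieRing M] {P N : AddSubgroup M}

theorem zsmul_cancel (H : IsJPair P N) {m m' : M} (h : (2 : ℤ) • m = (2 : ℤ) • m') : m = m' := by
  rw [← sub_eq_zero]
  apply H.two
  linear_combination (norm := module) h

theorem kap_mem (H : IsJPair P N) {x b : M} (hx : x ∈ P) (hb : b ∈ N) (n : ℕ) {v : M}
    (hv : v ∈ P) : kap x b n v ∈ P := by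
  cases n with
  | zero => exact hv
  | succ n => exact H.mem_p _ (H.pw_mem hx hb n) _ hb _ hv

theorem kap_mem_m (H : IsJPair P N) {x b : M} (hx : x ∈ P) (hb : b ∈ N) (n : ℕ) {v : M}
    (hv : v ∈ N) : kap x b n v ∈ N := by
  cases n with
  | zero => exact hv
  | succ n => exact H.mem_h (H.pw_mem hx hb n) hb hv

theorem kap2_mem (H : IsJPair P N) {x b : M} (hx : x ∈ P) (hb : b ∈ N) (i j : ℕ) {v : M}
    (hv : v ∈ P) : kap2 x b i j v ∈ P :=
  P.sub_mem (P.zsmul_mem (H.kap_mem hx hb i (H.kap_mem hx hb j hv)) _) (H.kap_mem hx hb _ hv)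

theorem lie_kap (H : IsJPair P N) {x b : M} (hx : x ∈ P) (hb : b ∈ N) (n : ℕ) {v : M}
    (hv : v ∈ P) : ⁅⁅x, b⁆, kap x b n v⁆ = kap x b n ⁅⁅x, b⁆, v⁆ := by
  cases n with
  | zero => rfl
  | succ n =>
    have := (H.killer_induction hx hb n).2.1 v hv
    rwa [lie_lie ⁅x, b⁆, sub_eq_zero] at this

theorem lie_pw_eq_kap (H : IsJPair P N) {x b c : M} (hx : x ∈ P) (hb : b ∈ N) (hc : c ∈ N)
    (n : ℕ) : ⁅x, ⁅pw x b n, c⁆⁆ = kap x b n ⁅x, ⁅x, c⁆⁆ := by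
  cases n with
  | zero => rfl
  | succ n => exact H.lie_pw_succ hx hb (H.killer_induction hx hb n).1 hc

theorem kap_anti_p (H : IsJPair P N) {x b c : M} (hx : x ∈ P) (hb : b ∈ N) (hc : c ∈ N)
    (n : ℕ) : kap x b (n + 1) ⁅x, ⁅x, c⁆⁆ = -⁅x, ⁅x, kap x b (n + 1) c⁆⁆ :=
  H.anti_pw_p hx hb (H.killer_induction hx hb n).1 hc

theorem kap_anti_m (H : IsJPair P N) {x b v : M} (hx : x ∈ P) (hb : b ∈ N) (hv : v ∈ P)
    (n : ℕ) : kap x b (n + 1) ⁅b, ⁅b, v⁆⁆ = -⁅b, ⁅b, kap x b (n + 1) v⁆⁆ :=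
  H.anti_m (H.pw_mem hx hb n) hb hv

theorem kap_W (H : IsJPair P N) {x b v : M} (hx : x ∈ P) (hb : b ∈ N) (hv : v ∈ P) (n : ℕ) :
    kap x b n ⁅x, ⁅x, ⁅b, ⁅b, v⁆⁆⁆⁆ = ⁅x, ⁅x, ⁅b, ⁅b, kap x b n v⁆⁆⁆⁆ := by
  cases n with
  | zero => rfl
  | succ n =>
    rw [H.kap_anti_p hx hb (H.symm.mem2 hb hb hv), H.kap_anti_m hx hb hv, lie_neg, lie_neg, neg_neg]

theorem lie_W (H : IsJPair P N) {x b v : M} (hx : x ∈ P) (hb : b ∈ N) (hv : v ∈ P) :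
    ⁅⁅x, b⁆, ⁅x, ⁅x, ⁅b, ⁅b, v⁆⁆⁆⁆⁆ = ⁅x, ⁅x, ⁅b, ⁅b, ⁅⁅x, b⁆, v⁆⁆⁆⁆⁆ :=
  H.kap_W hx hb hv 1

/-- This is the recursion of `(ℓⁿ + rⁿ)/2` for commuting `ℓ`, `r`, where `ad ⁅x, b⁆` is `(ℓ + r)/2`
and the composite of the two quadratic operators is `ℓr`; in a special pair, `ℓ` and `r` are twice
the left and right multiplications by `xb` and `bx`. In this model `kap2 x b i j` is `(ℓⁱrʲ +
ℓʲrⁱ)/2`, which predicts the identities for `kap` and `kap2` below. -/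
theorem kap_rec (H : IsJPair P N) {x b v : M} (hx : x ∈ P) (hb : b ∈ N) (hv : v ∈ P) (n : ℕ) :
    kap x b (n + 2) v =
      (2 : ℤ) • ⁅⁅x, b⁆, kap x b (n + 1) v⁆ - ⁅x, ⁅x, ⁅b, ⁅b, kap x b n v⁆⁆⁆⁆ := by
  have h1 := H.lie_pw_succ_p hx hb n hv
  rw [H.lie_pw_eq_kap hx hb (H.symm.mem2 hb hb hv), H.kap_W hx hb hv] at h1
  have h2 := H.lie_kap hx hb (n + 1) hv
  simp only [kap] at h1 h2 ⊢
  rw [h1, ← h2]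
  module

theorem W_pw (H : IsJPair P N) {x b : M} (hx : x ∈ P) (hb : b ∈ N) (n : ℕ) :
    ⁅x, ⁅x, ⁅b, ⁅b, pw x b n⁆⁆⁆⁆ = pw x b (n + 2) := by
  induction n with
  | zero =>
    have h1 := (H.killer_induction hx hb 1).1.1 x hx
    rw [sub_lie, sub_eq_zero, H.pw_succ_eq hx hb] at h1
    rw [h1]
    simp only [pw]
    rw [← lie_skew ⁅x, _⁆ x, ← lie_skew ⁅b, x⁆ b, lie_neg, lie_neg, neg_neg]
  | succ n ih =>
    rw [pw, ← H.lie_W hx hb (H.pw_mem hx hb n), ih]; rfl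

theorem kap_pw (H : IsJPair P N) {x b : M} (hx : x ∈ P) (hb : b ∈ N) (m n : ℕ) :
    kap x b m (pw x b n) = pw x b (m + n) := by
  induction m using Nat.twoStepInduction with
  | zero => simp [kap]
  | one => rw [add_comm]; rfl
  | more m ih1 ih2 =>
    rw [H.kap_rec hx hb (H.pw_mem hx hb n), ih1, ih2, H.W_pw hx hb,
      show m + 2 + n = m + n + 2 by ring, show m + 1 + n = m + n + 1 by ring]
    change (2 : ℤ) • pw x b (m + n + 2) - _ = _
    module

theorem kap_comm (H : IsJPair P N) {x b v : M} (hx : x ∈ P) (hb : b ∈ N) (hv : v ∈ P) (m n : ℕ) :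
    kap x b m (kap x b n v) = kap x b n (kap x b m v) := by
  induction m using Nat.twoStepInduction with
  | zero => rfl
  | one => exact H.lie_kap hx hb n hv
  | more m ih1 ih2 =>
    have hm := H.kap_mem hx hb m hv
    have hm' := H.kap_mem hx hb (m + 1) hv
    rw [H.kap_rec hx hb (H.kap_mem hx hb n hv), H.kap_rec hx hb hv, kap_sub, kap_zsmul,
      ← H.lie_kap hx hb n hm', H.kap_W hx hb hm, ih1, ih2]

theorem lie_pw_pw_eq (H : IsJPair P N) {x b c : M} (hx : x ∈ P) (hb : b ∈ N) (hc : c ∈ N)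
    (m n : ℕ) : ⁅pw x b m, ⁅pw x b n, c⁆⁆ = kap2 x b m n ⁅x, ⁅x, c⁆⁆ := by
  have hq := H.mem2 hx hx hc
  cases m with
  | zero =>
    simp only [pw, kap2, H.lie_pw_eq_kap hx hb hc, kap, zero_add]
    module
  | succ m =>
    have h1 := H.lie_pw_eq_kap hx hb hc n
    have h2 := H.lie_pw_eq_kap hx hb hc (m + 1 + n)
    have h3 := H.lie_pw_eq_kap hx hb (H.kap_mem_m hx hb (m + 1) hc) n
    have h4 := H.kap_anti_p hx hb hc m
    have h5 := H.kap_comm hx hb hq (m + 1) n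
    have h6 := H.kap_pw hx hb (m + 1) n
    rw [← neg_eq_iff_eq_neg] at h4
    rw [← h4, kap_neg, ← h5] at h3
    rw [kap2, ← h2, ← h6, ← H.pw_succ_eq hx hb m, lie_lie ⁅pw x b m, b⁆, h1,
      leibniz_lie _ (pw x b n) c, lie_add]
    simp only [kap] at *
    rw [h3]
    module

theorem two_lie_pw_pw (H : IsJPair P N) {x b c : M} (hx : x ∈ P) (hb : b ∈ N) (hc : c ∈ N)
    (m n : ℕ) : (2 : ℤ) • ⁅⁅x, b⁆, ⁅pw x b m, ⁅pw x b n, c⁆⁆⁆ =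
      ⁅pw x b (m + 1), ⁅pw x b n, c⁆⁆ + ⁅pw x b m, ⁅pw x b (n + 1), c⁆⁆ := by
  have hq := H.mem2 hx hx hc
  have h1 : ⁅pw x b m, ⁅pw x b n, ⁅⁅x, b⁆, c⁆⁆⁆ = -⁅⁅x, b⁆, ⁅pw x b m, ⁅pw x b n, c⁆⁆⁆ := by
    rw [H.lie_pw_pw_eq hx hb hc, H.lie_pw_pw_eq hx hb (H.mem_h hx hb hc),
      ← neg_eq_iff_eq_neg.2 (H.anti_p hx hb hc)]
    simp only [kap2, kap_neg, lie_sub, lie_zsmul, H.lie_kap hx hb _ hq,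
      H.lie_kap hx hb _ (H.kap_mem hx hb n hq)]
    module
  have h2 := leibniz_lie ⁅x, b⁆ (pw x b m) ⁅pw x b n, c⁆
  rw [leibniz_lie ⁅x, b⁆ (pw x b n) c, lie_add, h1] at h2
  change _ = ⁅pw x b (m + 1), _⁆ + (⁅_, ⁅pw x b (n + 1), _⁆⁆ + _) at h2
  linear_combination (norm := module) h2

/-- The left side is `kap2 x b 1 1` at `⁅x, ⁅x, c⁆⁆`, and the first case of `kap_rec` turns it into
the right side. So JP3 follows from JP1 in the absence of 2-torsion. -/
theorem jp3 (H : IsJPair P N) {x b c : M} (hx : x ∈ P) (hb : b ∈ N) (hc : c ∈ N) :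
    ⁅⁅x, ⁅x, b⁆⁆, ⁅⁅x, ⁅x, b⁆⁆, c⁆⁆ = ⁅x, ⁅x, ⁅b, ⁅b, ⁅x, ⁅x, c⁆⁆⁆⁆⁆⁆ := by
  have h1 := H.lie_pw_pw_eq hx hb hc 1 1
  have h2 := H.kap_rec hx hb (H.mem2 hx hx hc) 0
  have h3 : pw x b 1 = -⁅x, ⁅x, b⁆⁆ := by rw [lie_skew]; rfl
  rw [h3, neg_lie, neg_lie, lie_neg, neg_neg, kap2, show 1 + 1 = 0 + 2 from rfl, h2] at h1
  rw [h1]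
  simp only [kap, pw]
  module

theorem kap2_zero_left {x b v : M} (n : ℕ) : kap2 x b 0 n v = kap x b n v := by
  simp only [kap2, kap, zero_add]; module

theorem kap2_zero_right {x b v : M} (n : ℕ) : kap2 x b n 0 v = kap x b n v := by
  simp only [kap2, kap, add_zero]; module

theorem kap2_succ_succ (H : IsJPair P N) {x b v : M} (hx : x ∈ P) (hb : b ∈ N) (hv : v ∈ P)
    (i j : ℕ) : kap2 x b (i + 1) (j + 1) v = ⁅x, ⁅x, ⁅b, ⁅b, kap2 x b i j v⁆⁆⁆⁆ := by
  have hk := fun n => H.kap_mem hx hb n hv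
  have hr := H.kap_rec hx hb hv
  have e (n : ℕ) : kap x b 1 (kap x b n v) = ⁅⁅x, b⁆, kap x b n v⁆ := rfl
  induction i using Nat.twoStepInduction with
  | zero =>
    rw [kap2_zero_left, kap2, show 0 + 1 + (j + 1) = j + 2 by ring, zero_add, hr, e]
    module
  | one =>
    have h1 := hr (j + 1)
    have h2 := H.kap_rec hx hb (hk (j + 1)) 0
    have h3 := congrArg (⁅⁅x, b⁆, ·⁆) (hr j)
    simp only [lie_sub, lie_zsmul, H.lie_W hx hb (hk j)] at h3
    simp only [kap2, lie_sub, lie_zsmul]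
    rw [show 1 + 1 + (j + 1) = j + 1 + 2 by ring, show 1 + j = j + 1 by ring, h1, e,
      show 1 + 1 = 0 + 2 by ring, h2]
    simp only [zero_add, e, kap_zero]
    linear_combination (norm := module) -(2 : ℤ) • h3
  | more i ih1 ih2 =>
    have h1 := H.kap_rec hx hb (hk (j + 1)) (i + 1)
    have h2 := H.kap_rec hx hb (hk j) i
    have h3 := hr (i + 1 + (j + 1))
    have h4 := hr (i + j)
    have l1 := congrArg (⁅⁅x, b⁆, ·⁆) ih2
    have l2 := congrArg (⁅x, ⁅x, ⁅b, ⁅b, ·⁆⁆⁆⁆) ih1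
    simp only [lie_sub, lie_zsmul, kap2, H.lie_W hx hb (hk (i + 1 + j)),
      H.lie_W hx hb (H.kap_mem hx hb (i + 1) (hk j))] at l1 l2 ⊢
    rw [show i + 2 + 1 + (j + 1) = i + 1 + (j + 1) + 2 by ring,
      show i + 2 + j = i + j + 2 by ring, h3, h4, h2,
      show i + 2 + 1 = i + 1 + 2 by ring, h1]
    simp only [lie_sub, lie_zsmul, show i + 1 + (j + 1) + 1 = i + 1 + 1 + (j + 1) by ring,
      show i + j + 1 = i + 1 + j by ring]
    linear_combination (norm := module) (2 : ℤ) • l1 - l2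

theorem two_lie_kap2 (H : IsJPair P N) {x b v : M} (hx : x ∈ P) (hb : b ∈ N) (hv : v ∈ P)
    (i j : ℕ) : (2 : ℤ) • ⁅⁅x, b⁆, kap2 x b i j v⁆ = kap2 x b (i + 1) j v + kap2 x b i (j + 1) v := by
  induction i generalizing j with
  | zero =>
    rw [kap2_zero_left, kap2_zero_left, kap2, zero_add, add_comm 1 j]
    simp only [kap, pw]
    module
  | succ i ih =>
    cases j with
    | zero =>
      rw [kap2_zero_right, kap2_zero_right, kap2, zero_add, ← H.kap_comm hx hb hv 1]
      simp only [kap, pw]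
      module
    | succ j =>
      rw [H.kap2_succ_succ hx hb hv, H.kap2_succ_succ hx hb hv, H.kap2_succ_succ hx hb hv,
        H.lie_W hx hb (H.kap2_mem hx hb i j hv)]
      have := ih j
      have := congrArg (⁅x, ⁅x, ⁅b, ⁅b, ·⁆⁆⁆⁆) (ih j)
      simpa only [lie_add, lie_zsmul] using this
end IsJPair

/-- Sums over antidiagonals of an array with `2 h wᵢⱼ = wᵢ₊₁ⱼ + wᵢⱼ₊₁`. -/
theorem lie_sum_antidiagonal {M : Type*} [LieRing M] (two : ∀ m : M, m + m = 0 → m = 0) (h : M)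
    (w : ℕ → ℕ → M) (hw : ∀ i j, (2 : ℤ) • ⁅h, w i j⁆ = w (i + 1) j + w i (j + 1)) (n : ℕ)
    (h0 : w 0 (n + 1) = w (n + 1) 0) :
    ∑ p ∈ Finset.HasAntidiagonal.antidiagonal (n + 1), w p.1 p.2 =
      ⁅h, ∑ p ∈ Finset.HasAntidiagonal.antidiagonal n, w p.1 p.2⁆ + w 0 (n + 1) := by
  rw [← sub_eq_zero]
  apply two
  have h1 := Finset.Nat.sum_antidiagonal_succ (n := n) (f := fun p => w p.1 p.2)
  have h2 := Finset.Nat.sum_antidiagonal_succ' (n := n) (f := fun p => w p.1 p.2)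
  have h3 : (2 : ℤ) • ⁅h, ∑ p ∈ Finset.HasAntidiagonal.antidiagonal n, w p.1 p.2⁆ =
      ∑ p ∈ Finset.HasAntidiagonal.antidiagonal n, w (p.1 + 1) p.2 +
        ∑ p ∈ Finset.HasAntidiagonal.antidiagonal n, w p.1 (p.2 + 1) := by
    rw [lie_sum, Finset.smul_sum, ← Finset.sum_add_distrib]
    exact Finset.sum_congr rfl fun p _ => hw _ _
  simp only at h1 h2
  linear_combination (norm := module) h1 + h2 - h3 - h0

/-! ### Sums of absolute zero divisors are nil of bounded index -/

/-- The absolute zero divisors of the first component. -/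
def zdiv {M : Type*} [LieRing M] (P N : AddSubgroup M) : Set M :=
  {z | z ∈ P ∧ ∀ w ∈ N, ⁅z, ⁅z, w⁆⁆ = 0}

theorem pw_eq_zero_of_le {M : Type*} [LieRing M] {x b : M} {m n : ℕ} (h : pw x b m = 0)
    (hmn : m ≤ n) : pw x b n = 0 := by
  induction n, hmn using Nat.le_induction with
  | base => exact h
  | succ n _ ih => rw [pw, ih, lie_zero]

namespace IsJPair
variable {M : Type*} [LieRing M] {P N : AddSubgroup M}

theorem lie_lie_symm (H : IsJPair P N) {x z : M} (hx : x ∈ P) (hz : z ∈ P) (b : M) :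
    ⁅⁅x, b⁆, z⁆ = ⁅⁅z, b⁆, x⁆ := by
  have e1 := leibniz_lie x z b
  rw [H.comm_p x hx z hz, zero_lie, zero_add] at e1
  rw [← lie_skew ⁅x, b⁆ z, ← e1, lie_skew]

/-- For `k = ⁅pw a b n, b⁆`, expanding `⁅z, ⁅z, ⁅k, b⁆⁆⁆ = 0` gives `2⁅⁅z, k⁆, ⁅z, b⁆⁆ = 0`. -/
theorem zdiv_lie_kap (H : IsJPair P N) {a b z : M} (ha : a ∈ P) (hb : b ∈ N) (hz : z ∈ zdiv P N)
    (n : ℕ) : ⁅⁅z, b⁆, kap a b n z⁆ = 0 := by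
  cases n with
  | zero => rw [kap, ← lie_skew, hz.2 b hb, neg_zero]
  | succ n =>
    have hn := H.pw_mem ha hb n
    have e1 := hz.2 _ (H.mem_h hn hb hb)
    have e2 : ⁅z, ⁅z, ⁅pw a b n, b⁆⁆⁆ = 0 := H.comm_p _ hz.1 _ (H.mem2 hz.1 hn hb)
    have f1 := leibniz_lie z ⁅pw a b n, b⁆ b
    have f2 := leibniz_lie z ⁅z, ⁅pw a b n, b⁆⁆ b
    have f3 := leibniz_lie z ⁅pw a b n, b⁆ ⁅z, b⁆
    rw [e2, zero_lie, zero_add] at f2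
    rw [hz.2 b hb, lie_zero, add_zero] at f3
    rw [f1, lie_add, f2, f3] at e1
    have e3 := H.two _ e1
    rw [kap, ← lie_skew _ z, lie_neg, lie_skew, e3]

/-- This antisymmetry in `z` and `e` is played against the symmetry from `lie_sq_kap`, so that the
common value is its own negative and vanishes. -/
theorem lie_sq_symm (H : IsJPair P N) {b z e : M} (hz : z ∈ P) (he : e ∈ P)
    (h : ⁅⁅z, b⁆, e⁆ = 0) : ⁅z, ⁅b, ⁅b, e⁆⁆⁆ = -⁅e, ⁅b, ⁅b, z⁆⁆⁆ := by
  have h' := H.lie_lie_symm hz he b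
  have e1 : ⁅z, ⁅b, e⁆⁆ = 0 := by rw [leibniz_lie, h, H.comm_p z hz e he, lie_zero, zero_add]
  have e2 : ⁅e, ⁅b, z⁆⁆ = 0 := by rw [leibniz_lie, ← h', h, H.comm_p e he z hz, lie_zero, zero_add]
  rw [leibniz_lie, e1, leibniz_lie e, e2, lie_zero, add_zero, add_zero, ← lie_skew b z,
    ← lie_skew b e, lie_neg, lie_neg, neg_neg, lie_skew]

theorem lie_sq_kap (H : IsJPair P N) {a b z e : M} (ha : a ∈ P) (hb : b ∈ N)
    (he : e ∈ P) (n : ℕ) (h : ⁅z, ⁅b, ⁅b, e⁆⁆⁆ = 0) :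
    ⁅z, ⁅b, ⁅b, kap a b n e⁆⁆⁆ = ⁅kap a b n z, ⁅b, ⁅b, e⁆⁆⁆ := by
  cases n with
  | zero => rfl
  | succ n =>
    rw [← neg_eq_iff_eq_neg.2 (H.kap_anti_m ha hb he n), kap, kap, lie_lie _ z, h, lie_zero, zero_sub,
      lie_neg]

theorem lie_W_of_zdiv (H : IsJPair P N) {a b z e : M} (ha : a ∈ P) (hb : b ∈ N)
    (hz : z ∈ P) (he : e ∈ P) (h : ⁅⁅z, b⁆, e⁆ = 0) (h1 : ⁅z, ⁅b, ⁅b, e⁆⁆⁆ = 0)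
    (h2 : ⁅z, ⁅b, ⁅b, (2 : ℤ) • ⁅⁅a, b⁆, e⁆⁆⁆⁆ = 0) :
    ⁅⁅z, b⁆, ⁅a, ⁅a, ⁅b, ⁅b, e⁆⁆⁆⁆⁆ = 0 := by
  have e1 := H.jp1_lin ha hz hb (H.symm.mem2 hb hb he)
  have e2 := H.anti_m hz hb he
  have e3 := H.anti_m ha hb he
  have e4 := congrArg (⁅a, ·⁆) h2
  rw [e2, e3, h, h1] at e1
  simp only [lie_zsmul, lie_neg, lie_zero] at e1 e4
  linear_combination (norm := module) e1 + e4

/-- In a special pair this only says that `z` times anything times `z` is zero. In general,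
`kap2_succ_succ` lowers both indices, and `lie_W_of_zdiv` carries the vanishing back up, given the
relations `psi2` for the smaller indices. -/
theorem zdiv_lie_kap2 (H : IsJPair P N) {a b z : M} (ha : a ∈ P) (hb : b ∈ N)
    (hz : z ∈ zdiv P N) (i j : ℕ) : ⁅⁅z, b⁆, kap2 a b i j z⁆ = 0 := by
  have hk := fun n => H.kap_mem ha hb n hz.1
  have psi0 : ⁅z, ⁅b, ⁅b, z⁆⁆⁆ = 0 :=
    H.two _ (by nth_rw 1 [H.lie_sq_symm hz.1 hz.1 (H.zdiv_lie_kap ha hb hz 0)]; abel)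
  have psi (n : ℕ) : ⁅z, ⁅b, ⁅b, kap a b n z⁆⁆⁆ = 0 := by
    have h1 := H.lie_sq_kap ha hb hz.1 n psi0
    have h2 := H.lie_sq_symm hz.1 (hk n) (H.zdiv_lie_kap ha hb hz n)
    rw [← h1] at h2
    exact H.two _ (by nth_rw 1 [h2]; abel)
  have psi' (n : ℕ) : ⁅kap a b n z, ⁅b, ⁅b, z⁆⁆⁆ = 0 := by
    rw [← H.lie_sq_kap ha hb hz.1 n psi0, psi]
  have move (i j : ℕ) : ⁅z, ⁅b, ⁅b, kap a b i (kap a b j z)⁆⁆⁆ =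
      ⁅kap a b i (kap a b j z), ⁅b, ⁅b, z⁆⁆⁆ := by
    rw [H.lie_sq_kap ha hb (hk j) i (psi j), H.lie_sq_kap ha hb hz.1 j (psi' i),
      H.kap_comm ha hb hz.1]
  have psi2 (i j : ℕ) (h : ⁅⁅z, b⁆, kap2 a b i j z⁆ = 0) :
      ⁅z, ⁅b, ⁅b, kap2 a b i j z⁆⁆⁆ = 0 := by
    have h1 := H.lie_sq_symm hz.1 (H.kap2_mem ha hb i j hz.1) h
    have h2 := move i j
    have h3 := psi (i + j)
    have h4 := psi' (i + j)
    apply H.two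
    nth_rw 1 [h1]
    simp only [kap2, lie_sub, sub_lie, lie_zsmul, zsmul_lie, h2, h3, h4]
    abel
  induction i generalizing j with
  | zero => rw [kap2_zero_left, H.zdiv_lie_kap ha hb hz]
  | succ i ih =>
    induction j with
    | zero => rw [kap2_zero_right, H.zdiv_lie_kap ha hb hz]
    | succ j ihj =>
      rw [H.kap2_succ_succ ha hb hz.1]
      refine H.lie_W_of_zdiv ha hb hz.1 (H.kap2_mem ha hb i j hz.1) (ih j) (psi2 _ _ (ih j)) ?_
      rw [H.two_lie_kap2 ha hb hz.1, lie_add, lie_add, lie_add, psi2 _ _ ihj,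
        psi2 _ _ (ih (j + 1)), add_zero]

/-- Adding an absolute zero divisor preserves nilpotence in the homotope given by `b`. -/
theorem pw_add_zdiv (H : IsJPair P N) {a b z : M} (ha : a ∈ P) (hb : b ∈ N)
    (hz : z ∈ zdiv P N) (n : ℕ) : pw (a + z) b n =
      pw a b n + ∑ p ∈ Finset.HasAntidiagonal.antidiagonal n, kap2 a b p.1 p.2 z := by
  induction n with
  | zero => simp [pw, kap2, kap]; module
  | succ n ih =>
    have h0 : ⁅⁅z, b⁆, ∑ p ∈ Finset.HasAntidiagonal.antidiagonal n, kap2 a b p.1 p.2 z⁆ = 0 := by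
      rw [lie_sum]
      exact Finset.sum_eq_zero fun p _ => H.zdiv_lie_kap2 ha hb hz p.1 p.2
    rw [pw, ih, lie_sum_antidiagonal H.two ⁅a, b⁆ (fun i j => kap2 a b i j z)
      (fun i j => H.two_lie_kap2 ha hb hz.1 i j) n (by rw [kap2_zero_left, kap2_zero_right]),
      kap2_zero_left, add_lie, lie_add, add_lie ⁅a, b⁆, add_lie ⁅a, b⁆, h0,
      H.lie_lie_symm hz.1 (H.pw_mem ha hb n)]
    simp only [pw, kap]
    abel

theorem pw_add_zdiv_eq_zero (H : IsJPair P N) {a b z : M} (ha : a ∈ P) (hb : b ∈ N)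
    (hz : z ∈ zdiv P N) {m : ℕ} (hm : pw a b m = 0) : pw (a + z) b (2 * m + 1) = 0 := by
  -- `kap a b n` involves `pw a b (n - 1)`, hence the bound `m + 1`. If `i + j = 2 * m + 1`, then
  -- `i` or `j` reaches it, and so does `i + j`.
  have hk : ∀ n, m + 1 ≤ n → ∀ v, kap a b n v = 0 := by
    intro n hn v
    obtain ⟨n, rfl⟩ : ∃ k, n = k + 1 := ⟨n - 1, by omega⟩
    rw [kap, pw_eq_zero_of_le hm (by omega), zero_lie, zero_lie]
  rw [H.pw_add_zdiv ha hb hz, pw_eq_zero_of_le hm (by omega), zero_add]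
  refine Finset.sum_eq_zero fun p hp => ?_
  rw [Finset.HasAntidiagonal.mem_antidiagonal] at hp
  rw [kap2, hk (p.1 + p.2) (by omega)]
  rcases le_or_gt (m + 1) p.1 with h | h
  · rw [hk _ h]; simp
  · rw [hk p.2 (by omega), kap_zero_right]; simp

/-- Sums of absolute zero divisors are nilpotent of bounded index in all homotopes. -/
theorem exists_pw_eq_zero (H : IsJPair P N) {x : M} (hx : x ∈ AddSubgroup.closure (zdiv P N)) :
    ∃ m, ∀ b ∈ N, ∀ n, m ≤ n → pw x b n = 0 := by
  suffices x ∈ P ∧ ∃ m, ∀ b ∈ N, pw x b m = 0 by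
    obtain ⟨-, m, hm⟩ := this
    exact ⟨m, fun b hb n hn => pw_eq_zero_of_le (hm b hb) hn⟩
  induction hx using AddSubgroup.closure_induction_right with
  | zero => exact ⟨P.zero_mem, 0, fun b _ => rfl⟩
  | add_right x z _ hz ih =>
    obtain ⟨hx, m, hm⟩ := ih
    exact ⟨P.add_mem hx hz.1, _, fun b hb => H.pw_add_zdiv_eq_zero hx hb hz (hm b hb)⟩
  | add_neg_cancel x z _ hz ih =>
    obtain ⟨hx, m, hm⟩ := ih
    refine ⟨P.add_mem hx (P.neg_mem hz.1), _, fun b hb => H.pw_add_zdiv_eq_zero hx hb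
      ⟨P.neg_mem hz.1, fun w hw => ?_⟩ (hm b hb)⟩
    rw [neg_lie, neg_lie, lie_neg, neg_neg, hz.2 w hw]
end IsJPair

/-! ### The Lie ring of formal power series -/

/-- Formal power series with coefficients in a Lie ring. -/
def LieSeries (M : Type*) := ℕ → M

namespace LieSeries
open Finset (sum_congr)
open Finset.HasAntidiagonal (antidiagonal)
variable {M : Type*}

@[ext] theorem ext {f g : LieSeries M} (h : ∀ n, f n = g n) : f = g := funext h

variable [LieRing M]

instance : AddCommGroup (LieSeries M) := inferInstanceAs (AddCommGroup (ℕ → M))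

instance : Bracket (LieSeries M) (LieSeries M) :=
  ⟨fun f g n => ∑ p ∈ antidiagonal n, ⁅f p.1, g p.2⁆⟩

theorem lie_apply (f g : LieSeries M) (n : ℕ) :
    ⁅f, g⁆ n = ∑ p ∈ antidiagonal n, ⁅f p.1, g p.2⁆ := rfl

theorem coeff_add (f g : LieSeries M) (n : ℕ) : (f + g) n = f n + g n := rfl
protected theorem add_lie (f g h : LieSeries M) : ⁅f + g, h⁆ = ⁅f, h⁆ + ⁅g, h⁆ := by
  ext n
  simp only [lie_apply, coeff_add, add_lie, Finset.sum_add_distrib]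

protected theorem lie_add (f g h : LieSeries M) : ⁅f, g + h⁆ = ⁅f, g⁆ + ⁅f, h⁆ := by
  ext n
  simp only [lie_apply, coeff_add, lie_add, Finset.sum_add_distrib]

/-- Constant series. -/
def C (x : M) : LieSeries M
  | 0 => x
  | _ + 1 => 0

/-- The series `f`, multiplied by the variable. -/
def shiftFun (f : LieSeries M) : LieSeries M
  | 0 => 0
  | n + 1 => f n

/-- Multiplication by the variable. -/
def shift : LieSeries M →+ LieSeries M where
  toFun := shiftFun
  map_zero' := by ext n; cases n <;> rfl
  map_add' f g := by
    ext n
    rw [coeff_add]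
    cases n with
    | zero => exact (add_zero _).symm
    | succ n => rfl

/-- The series without its constant term, divided by the variable. -/
def tail (f : LieSeries M) : LieSeries M := fun n => f (n + 1)

theorem shift_zero (f : LieSeries M) : shift f 0 = 0 := rfl
theorem shift_succ (f : LieSeries M) (n : ℕ) : shift f (n + 1) = f n := rfl

theorem C_add_shift_tail (f : LieSeries M) : C (f 0) + shift (tail f) = f := by
  ext n
  rw [coeff_add]
  cases n with
  | zero => exact add_zero _
  | succ n => exact zero_add _

theorem C_lie_apply (x : M) (f : LieSeries M) (n : ℕ) : ⁅C x, f⁆ n = ⁅x, f n⁆ := by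
  rw [lie_apply]
  cases n with
  | zero => simp [C]
  | succ n => rw [Finset.Nat.sum_antidiagonal_succ]; simp [C]

theorem lie_C_apply (x : M) (f : LieSeries M) (n : ℕ) : ⁅f, C x⁆ n = ⁅f n, x⁆ := by
  rw [lie_apply]
  cases n with
  | zero => simp [C]
  | succ n => rw [Finset.Nat.sum_antidiagonal_succ']; simp [C]

theorem C_lie_C (x y : M) : ⁅C x, C y⁆ = C ⁅x, y⁆ := by
  ext n; rw [C_lie_apply]; cases n <;> simp [C]

theorem shift_lie (f g : LieSeries M) : ⁅shift f, g⁆ = shift ⁅f, g⁆ := by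
  ext n
  cases n with
  | zero => simp [lie_apply, shift_zero]
  | succ n => rw [shift_succ, lie_apply, Finset.Nat.sum_antidiagonal_succ]; simp [shift_zero,
      shift_succ, lie_apply]

theorem lie_shift (f g : LieSeries M) : ⁅f, shift g⁆ = shift ⁅f, g⁆ := by
  ext n
  cases n with
  | zero => simp [lie_apply, shift_zero]
  | succ n => rw [shift_succ, lie_apply, Finset.Nat.sum_antidiagonal_succ']; simp [shift_zero,
      shift_succ, lie_apply]

/-- Split off the constant term: its cross terms with the tail cancel, and the bracket of the tail
with itself is shifted by two degrees, where induction applies. -/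
theorem lie_self_apply (n : ℕ) : ∀ f : LieSeries M, ⁅f, f⁆ n = 0 := by
  induction n using Nat.strong_induction_on with
  | _ n ih =>
  intro f
  rw [← C_add_shift_tail f]
  simp only [LieSeries.add_lie, LieSeries.lie_add, C_lie_C, shift_lie, lie_shift, lie_self,
    coeff_add]
  rcases n with - | - | n
  · simp [C, shift_zero]
  · simp only [shift_succ, C_lie_apply, lie_C_apply, shift_zero, coeff_add]
    rw [← lie_skew (f 0)]; simp only [C]; abel
  · simp only [shift_succ, C_lie_apply, lie_C_apply, ih n (by omega), coeff_add]
    rw [← lie_skew (f 0)]; simp only [C]; abel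

theorem leibniz_lie_apply (n : ℕ) : ∀ f g h : LieSeries M,
    ⁅f, ⁅g, h⁆⁆ n = (⁅⁅f, g⁆, h⁆ + ⁅g, ⁅f, h⁆⁆) n := by
  have key : ∀ (n : ℕ) (x : M) (g h : LieSeries M),
      ⁅C x, ⁅g, h⁆⁆ n = ⁅⁅C x, g⁆, h⁆ n + ⁅g, ⁅C x, h⁆⁆ n := by
    intro n x g h
    rw [C_lie_apply, lie_apply, lie_sum, lie_apply, lie_apply, ← Finset.sum_add_distrib]
    refine sum_congr rfl fun p _ => ?_
    rw [C_lie_apply, C_lie_apply, leibniz_lie]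
  induction n with
  | zero =>
    intro f g h
    rw [← C_add_shift_tail f]
    simp only [LieSeries.add_lie, LieSeries.lie_add, shift_lie, lie_shift, coeff_add, key,
      shift_zero]
    abel
  | succ n ih =>
    intro f g h
    rw [← C_add_shift_tail f]
    simp only [LieSeries.add_lie, LieSeries.lie_add, shift_lie, lie_shift, coeff_add, key,
      shift_succ]
    rw [ih (tail f), coeff_add]
    abel

instance : LieRing (LieSeries M) where
  add_lie := LieSeries.add_lie
  lie_add := LieSeries.lie_add
  lie_self f := by ext n; exact lie_self_apply n f
  leibniz_lie f g h := by ext n; exact leibniz_lie_apply n f g h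

theorem C_lie_lie_apply (x : M) (y f : LieSeries M) (n : ℕ) :
    ⁅⁅C x, y⁆, f⁆ n = ∑ p ∈ antidiagonal n, ⁅⁅x, y p.1⁆, f p.2⁆ := by
  simp only [lie_apply ⁅C x, y⁆, C_lie_apply]

/-- The series with coefficients in `P`. -/
def coeffIn (P : AddSubgroup M) : AddSubgroup (LieSeries M) where
  carrier := {f | ∀ n, f n ∈ P}
  zero_mem' := fun _ => P.zero_mem
  add_mem' := fun hf hg n => P.add_mem (hf n) (hg n)
  neg_mem' := fun hf n => P.neg_mem (hf n)

theorem C_mem {P : AddSubgroup M} {x : M} (hx : x ∈ P) : C x ∈ coeffIn P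
  | 0 => hx
  | _ + 1 => P.zero_mem

theorem shift_mem {P : AddSubgroup M} {f : LieSeries M} (hf : f ∈ coeffIn P) :
    shift f ∈ coeffIn P
  | 0 => P.zero_mem
  | n + 1 => hf n

theorem tail_mem {P : AddSubgroup M} {f : LieSeries M} (hf : f ∈ coeffIn P) :
    tail f ∈ coeffIn P := fun n => hf (n + 1)

end LieSeries

/-! ### Jordan pair identities over power series -/

section
variable {M : Type*} [LieRing M]

/-- Degree `(2, 1)` part of `[[x, y], [x, [x, w]]] + [x, [x, [[x, y], w]]]` in `x`. -/
def jp21 (x z y w : M) : M :=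
  ⁅⁅z, y⁆, ⁅x, ⁅x, w⁆⁆⁆ + ⁅x, ⁅x, ⁅⁅z, y⁆, w⁆⁆⁆ + (⁅⁅x, y⁆, ⁅x, ⁅z, w⁆⁆⁆ + ⁅x, ⁅z, ⁅⁅x, y⁆, w⁆⁆⁆) +
    (⁅⁅x, y⁆, ⁅z, ⁅x, w⁆⁆⁆ + ⁅z, ⁅x, ⁅⁅x, y⁆, w⁆⁆⁆)

/-- Degree `(1, 1, 1)` part of the same expression. -/
def jp111 (x u z y w : M) : M :=
  ⁅⁅z, y⁆, ⁅x, ⁅u, w⁆⁆⁆ + ⁅x, ⁅u, ⁅⁅z, y⁆, w⁆⁆⁆ + ⁅⁅z, y⁆, ⁅u, ⁅x, w⁆⁆⁆ + ⁅u, ⁅x, ⁅⁅z, y⁆, w⁆⁆⁆ +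
    (⁅⁅x, y⁆, ⁅u, ⁅z, w⁆⁆⁆ + ⁅u, ⁅z, ⁅⁅x, y⁆, w⁆⁆⁆ + ⁅⁅u, y⁆, ⁅x, ⁅z, w⁆⁆⁆ + ⁅x, ⁅z, ⁅⁅u, y⁆, w⁆⁆⁆) +
    (⁅⁅x, y⁆, ⁅z, ⁅u, w⁆⁆⁆ + ⁅z, ⁅u, ⁅⁅x, y⁆, w⁆⁆⁆ + ⁅⁅u, y⁆, ⁅z, ⁅x, w⁆⁆⁆ + ⁅z, ⁅x, ⁅⁅u, y⁆, w⁆⁆⁆)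

end

namespace IsJPair
variable {M : Type*} [LieRing M] {P N : AddSubgroup M}
open LieSeries
open Finset (sum_congr)
open Finset.HasAntidiagonal (antidiagonal)

theorem jp21_eq_zero (H : IsJPair P N) {x z y w : M} (hx : x ∈ P) (hz : z ∈ P) (hy : y ∈ N)
    (hw : w ∈ N) : jp21 x z y w = 0 := by
  have h := H.jp1_lin hx hz hy hw
  rw [jp21, H.swap hz hx, H.swap hz hx]
  linear_combination (norm := module) h

theorem jp111_eq_zero (H : IsJPair P N) {x u z y w : M} (hx : x ∈ P) (hu : u ∈ P) (hz : z ∈ P)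
    (hy : y ∈ N) (hw : w ∈ N) : jp111 x u z y w = 0 := by
  have h := H.jp21_eq_zero (P.add_mem hx hu) hz hy hw
  have h1 := H.jp21_eq_zero hx hz hy hw
  have h2 := H.jp21_eq_zero hu hz hy hw
  simp only [jp21, jp111, add_lie, lie_add] at *
  linear_combination (norm := module) h - h1 - h2

theorem series_mem (H : IsJPair P N) {x y z : LieSeries M} (hx : x ∈ coeffIn P)
    (hy : y ∈ coeffIn N) (hz : z ∈ coeffIn P) : ⁅⁅x, y⁆, z⁆ ∈ coeffIn P := by
  intro n
  rw [lie_apply]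
  refine sum_mem fun p _ => ?_
  rw [lie_apply, sum_lie]
  exact sum_mem fun q _ => H.mem_p _ (hx _) _ (hy _) _ (hz _)

theorem series_comm (H : IsJPair P N) {x z : LieSeries M} (hx : x ∈ coeffIn P)
    (hz : z ∈ coeffIn P) : ⁅x, z⁆ = 0 := by
  ext n
  rw [lie_apply]
  exact Finset.sum_eq_zero fun p _ => H.comm_p _ (hx _) _ (hz _)

theorem series_jp111 (H : IsJPair P N) {y w : LieSeries M} (hy : y ∈ coeffIn N)
    (hw : w ∈ coeffIn N) (n : ℕ) {x u : M} (hx : x ∈ P) (hu : u ∈ P) : ∀ z ∈ coeffIn P,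
    jp111 (C x) (C u) z y w n = 0 := by
  have key : ∀ (n : ℕ), ∀ z ∈ P, jp111 (C x) (C u) (C z) y w n = 0 := by
    intro n z hz
    simp only [jp111, coeff_add, C_lie_apply, C_lie_lie_apply, lie_sum, ← Finset.sum_add_distrib]
    exact Finset.sum_eq_zero fun p _ => H.jp111_eq_zero hx hu hz (hy _) (hw _)
  have dec (z : LieSeries M) : jp111 (C x) (C u) z y w =
      jp111 (C x) (C u) (C (z 0)) y w + shift (jp111 (C x) (C u) (tail z) y w) := by
    nth_rw 1 [← C_add_shift_tail z]
    simp only [jp111, add_lie, lie_add, shift_lie, lie_shift, map_add]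
    abel
  induction n with
  | zero =>
    intro z hz
    rw [dec, coeff_add, key _ _ (hz 0), shift_zero, add_zero]
  | succ n ih =>
    intro z hz
    rw [dec, coeff_add, key _ _ (hz 0), shift_succ, ih _ (tail_mem hz), add_zero]

theorem series_jp21_C (H : IsJPair P N) {y w : LieSeries M} (hy : y ∈ coeffIn N)
    (hw : w ∈ coeffIn N) (n : ℕ) {x : M} (hx : x ∈ P) : ∀ z ∈ coeffIn P,
    jp21 (C x) z y w n = 0 := by
  have key : ∀ (n : ℕ), ∀ z ∈ P, jp21 (C x) (C z) y w n = 0 := by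
    intro n z hz
    simp only [jp21, coeff_add, C_lie_apply, C_lie_lie_apply, lie_sum, ← Finset.sum_add_distrib]
    exact Finset.sum_eq_zero fun p _ => H.jp21_eq_zero hx hz (hy _) (hw _)
  have dec (z : LieSeries M) : jp21 (C x) z y w =
      jp21 (C x) (C (z 0)) y w + shift (jp21 (C x) (tail z) y w) := by
    nth_rw 1 [← C_add_shift_tail z]
    simp only [jp21, add_lie, lie_add, shift_lie, lie_shift, map_add]
    abel
  induction n with
  | zero =>
    intro z hz
    rw [dec, coeff_add, key _ _ (hz 0), shift_zero, add_zero]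
  | succ n ih =>
    intro z hz
    rw [dec, coeff_add, key _ _ (hz 0), shift_succ, ih _ (tail_mem hz), add_zero]

theorem series_jp21_C' (H : IsJPair P N) {y w : LieSeries M} (hy : y ∈ coeffIn N)
    (hw : w ∈ coeffIn N) (n : ℕ) {x : M} (hx : x ∈ P) : ∀ z ∈ coeffIn P,
    jp21 z (C x) y w n = 0 := by
  have dec (z : LieSeries M) : jp21 z (C x) y w =
      jp21 (C (z 0)) (C x) y w + shift (jp111 (C (z 0)) (C x) (tail z) y w) +
        shift (shift (jp21 (tail z) (C x) y w)) := by
    nth_rw 1 [← C_add_shift_tail z]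
    simp only [jp21, jp111, add_lie, lie_add, shift_lie, lie_shift, map_add]
    abel
  induction n using Nat.strong_induction_on with
  | _ n ih =>
  intro z hz
  rw [dec, coeff_add, coeff_add, H.series_jp21_C hy hw _ (hz 0) _ (C_mem hx)]
  rcases n with - | - | n
  · simp [shift_zero]
  · simp [shift_zero, shift_succ, H.series_jp111 hy hw _ (hz 0) hx _ (tail_mem hz)]
  · simp [shift_succ, H.series_jp111 hy hw _ (hz 0) hx _ (tail_mem hz),
      ih n (by omega) _ (tail_mem hz)]

/-- The identity is cubic in `x`. For constant `x` it holds coefficientwise. For `x = C (x 0) +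
shift (tail x)` the mixed terms are the polarizations `jp21`, and the pure tail term is shifted by
three degrees, so strong induction applies. -/
theorem series_jp1 (H : IsJPair P N) {y w : LieSeries M} (hy : y ∈ coeffIn N)
    (hw : w ∈ coeffIn N) (n : ℕ) : ∀ x ∈ coeffIn P,
    (⁅⁅x, y⁆, ⁅x, ⁅x, w⁆⁆⁆ + ⁅x, ⁅x, ⁅⁅x, y⁆, w⁆⁆⁆) n = 0 := by
  have key : ∀ (n : ℕ), ∀ x ∈ P,
      (⁅⁅C x, y⁆, ⁅C x, ⁅C x, w⁆⁆⁆ + ⁅C x, ⁅C x, ⁅⁅C x, y⁆, w⁆⁆⁆) n = 0 := by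
    intro n x hx
    simp only [coeff_add, C_lie_apply, C_lie_lie_apply, lie_sum, ← Finset.sum_add_distrib]
    exact Finset.sum_eq_zero fun p _ => H.jp1_p x hx _ (hy _) _ (hw _)
  have dec (x : LieSeries M) : ⁅⁅x, y⁆, ⁅x, ⁅x, w⁆⁆⁆ + ⁅x, ⁅x, ⁅⁅x, y⁆, w⁆⁆⁆ =
      (⁅⁅C (x 0), y⁆, ⁅C (x 0), ⁅C (x 0), w⁆⁆⁆ + ⁅C (x 0), ⁅C (x 0), ⁅⁅C (x 0), y⁆, w⁆⁆⁆) +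
        shift (jp21 (C (x 0)) (tail x) y w) + shift (shift (jp21 (tail x) (C (x 0)) y w)) +
        shift (shift (shift (⁅⁅tail x, y⁆, ⁅tail x, ⁅tail x, w⁆⁆⁆ +
          ⁅tail x, ⁅tail x, ⁅⁅tail x, y⁆, w⁆⁆⁆))) := by
    nth_rw 1 2 3 4 5 6 [← C_add_shift_tail x]
    simp only [jp21, add_lie, lie_add, shift_lie, lie_shift, map_add]
    abel
  induction n using Nat.strong_induction_on with
  | _ n ih =>
  intro x hx
  rw [dec, coeff_add, coeff_add, coeff_add, key _ _ (hx 0)]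
  have h1 := fun n => H.series_jp21_C hy hw n (hx 0) _ (tail_mem hx)
  have h2 := fun n => H.series_jp21_C' hy hw n (hx 0) _ (tail_mem hx)
  rcases n with - | - | - | n
  · simp [shift_zero]
  · simp only [shift_zero, shift_succ, h1, add_zero]
  · simp only [shift_zero, shift_succ, h1, h2, add_zero]
  · rw [shift_succ, shift_succ, shift_succ, shift_succ, shift_succ, shift_succ,
      ih n (by omega) _ (tail_mem hx), h1, h2]
    simp

/-- The series variable replaces a supply of scalars: it separates the homogeneous components of
polynomial identities even when `Φ` has few elements. -/
theorem series (H : IsJPair P N) : IsJPair (coeffIn P) (coeffIn N) where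
  two f hf := by
    ext n
    exact H.two _ (by rw [← coeff_add, hf]; rfl)
  comm_p _ hx _ hz := H.series_comm hx hz
  comm_m _ hx _ hz := H.symm.series_comm hx hz
  mem_p _ hx _ hy _ hz := H.series_mem hx hy hz
  mem_m _ hx _ hy _ hz := H.symm.series_mem hx hy hz
  jp1_p x hx _ hy _ hw := by ext n; exact H.series_jp1 hy hw n x hx
  jp1_m x hx _ hy _ hw := by ext n; exact H.symm.series_jp1 hy hw n x hx

end IsJPair

/-! ### Bounded nil index without absolute zero divisors -/

/-- The derivative of `pw x b n` in the variable `b` in direction `c`. -/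
def pwDeriv {M : Type*} [LieRing M] (x b c : M) : ℕ → M
  | 0 => 0
  | n + 1 => ⁅⁅x, c⁆, pw x b n⁆ + ⁅⁅x, b⁆, pwDeriv x b c n⁆

/-- A first-order Taylor expansion in the second argument, with `T` in the role of a central scalar,
later a power of the series variable. -/
theorem exists_pw_add {M : Type*} [LieRing M] (T : M →+ M) (hT : ∀ f g : M, ⁅f, T g⁆ = T ⁅f, g⁆)
    (x b c : M) (n : ℕ) :
    ∃ G, pw x (b + T c) n = pw x b n + T (pwDeriv x b c n) + T (T G) := by
  have hT' : ∀ f g : M, ⁅T f, g⁆ = T ⁅f, g⁆ := fun f g => by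
    rw [← lie_skew, hT, ← map_neg, lie_skew]
  induction n with
  | zero => exact ⟨0, by simp [pw, pwDeriv]⟩
  | succ n ih =>
    obtain ⟨G, hG⟩ := ih
    refine ⟨⁅⁅x, b⁆, G⁆ + ⁅⁅x, c⁆, pwDeriv x b c n⁆ + T ⁅⁅x, c⁆, G⁆, ?_⟩
    rw [pw, hG]
    simp only [pw, pwDeriv, lie_add, add_lie, hT, hT', map_add]
    abel

/-- Multiplication by a power of the variable. -/
def LieSeries.shiftN {M : Type*} [LieRing M] : ℕ → LieSeries M →+ LieSeries M
  | 0 => AddMonoidHom.id _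
  | k + 1 => LieSeries.shift.comp (shiftN k)

namespace IsJPair
variable {M : Type*} [LieRing M] {P N : AddSubgroup M}
open LieSeries
open Finset.HasAntidiagonal (antidiagonal)

theorem pwDeriv_succ (H : IsJPair P N) {x b c : M} (hx : x ∈ P) (hb : b ∈ N) (hc : c ∈ N) (n : ℕ) :
    pwDeriv x b c (n + 1) = -∑ p ∈ antidiagonal n, ⁅pw x b p.1, ⁅pw x b p.2, c⁆⁆ := by
  induction n with
  | zero => simp [pwDeriv, pw]
  | succ n ih =>
    rw [pwDeriv, ih, lie_sum_antidiagonal H.two ⁅x, b⁆ (fun i j => ⁅pw x b i, ⁅pw x b j, c⁆⁆)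
      (H.two_lie_pw_pw hx hb hc) n (H.swap (H.pw_mem hx hb _) (H.pw_mem hx hb _) c), lie_neg,
      H.swap (H.pw_mem hx hb _) (H.pw_mem hx hb _) c, ← lie_skew]
    simp only [pw]
    abel

/-- Apply `ad ⁅x, b⁆` repeatedly. Each time `lie_sum_antidiagonal` lengthens the sum by one; the two
end terms contain `pw x b (n + 1) = 0`, so a sum shorter by one remains, with both indices raised.
Finally only the middle term is left. -/
theorem lie_pw_of_sum_eq_zero (H : IsJPair P N) {x b c : M} (hx : x ∈ P) (hb : b ∈ N)
    (hc : c ∈ N) {n : ℕ} (hn : pw x b (n + 1) = 0)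
    (h : ∑ p ∈ antidiagonal n, ⁅pw x b p.1, ⁅pw x b p.2, c⁆⁆ = 0) :
    ⁅pw x b n, ⁅pw x b n, c⁆⁆ = 0 := by
  have key : ∀ k r : ℕ, k + r = n →
      ∑ p ∈ antidiagonal k, ⁅pw x b (p.1 + r), ⁅pw x b (p.2 + r), c⁆⁆ = 0 := by
    intro k r hkr
    induction r generalizing k with
    | zero => simpa [← hkr] using h
    | succ r ih =>
      have h0 := ih (k + 1) (by omega)
      have h1 : ⁅pw x b (0 + r), ⁅pw x b (k + 1 + 1 + r), c⁆⁆ = 0 := by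
        rw [show k + 1 + 1 + r = n + 1 by omega, hn, zero_lie, lie_zero]
      have h1' : ⁅pw x b (k + 1 + 1 + r), ⁅pw x b (0 + r), c⁆⁆ = 0 := by
        rw [show k + 1 + 1 + r = n + 1 by omega, hn, zero_lie]
      have h2 := lie_sum_antidiagonal H.two ⁅x, b⁆
        (fun i j => ⁅pw x b (i + r), ⁅pw x b (j + r), c⁆⁆)
        (fun i j => by
          rw [H.two_lie_pw_pw hx hb hc, show i + 1 + r = i + r + 1 by ring,
            show j + 1 + r = j + r + 1 by ring]) (k + 1) (by rw [h1, h1'])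
      rw [h0, lie_zero, h1, Finset.Nat.sum_antidiagonal_succ, Finset.Nat.sum_antidiagonal_succ'] at h2
      simp only [h1] at h2
      simp only [show ∀ i, i + (r + 1) = i + 1 + r by intro i; ring]
      simp only [zero_add, add_zero] at h1' h2
      rw [h1', zero_add] at h2
      exact h2
  simpa using key 0 n (by omega)

/-- The constant term of an absolute zero divisor is tested on constant series, so it vanishes; the
series may then be divided by the variable. -/
theorem eq_zero_of_zdiv_series (hP : ∀ z ∈ zdiv P N, z = 0) (n : ℕ) :
    ∀ f ∈ zdiv (coeffIn P) (coeffIn N), f n = 0 := by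
  have h0 : ∀ f ∈ zdiv (coeffIn P) (coeffIn N), f 0 = 0 := fun f hf => by
    refine hP _ ⟨hf.1 0, fun w hw => ?_⟩
    have := congrFun (hf.2 _ (C_mem hw)) 0
    rwa [lie_apply, Finset.Nat.antidiagonal_zero, Finset.sum_singleton, lie_C_apply] at this
  induction n with
  | zero => exact h0
  | succ n ih =>
    intro f hf
    refine ih (tail f) ⟨tail_mem hf.1, fun w hw => ?_⟩
    have h1 := hf.2 w hw
    have h2 : shift (tail f) = f := by
      nth_rw 2 [← C_add_shift_tail f]
      rw [h0 f hf]
      have : C (0 : M) = 0 := by ext n; cases n <;> rfl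
      rw [this, zero_add]
    rw [← h2] at h1
    simp only [shift_lie, lie_shift] at h1
    ext n
    exact congrFun h1 (n + 2)

theorem shiftN_add (k n : ℕ) (f : LieSeries M) :
    shiftN k f (k + n) = f n := by
  induction k with
  | zero => rw [zero_add]; rfl
  | succ k ih =>
    rw [show k + 1 + n = k + n + 1 by ring]
    exact ih

theorem shiftN_of_lt {k n : ℕ} (hn : n < k) (f : LieSeries M) :
    shiftN k f n = 0 := by
  induction k generalizing n with
  | zero => omega
  | succ k ih =>
    cases n with
    | zero => rfl
    | succ n => exact ih (by omega)

theorem lie_shiftN (k : ℕ) (f g : LieSeries M) :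
    ⁅f, shiftN k g⁆ =
      shiftN k ⁅f, g⁆ := by
  induction k with
  | zero => rfl
  | succ k ih =>
    change ⁅f, shift (shiftN k g)⁆ = shift (shiftN k ⁅f, g⁆)
    rw [lie_shift, ih]

theorem shiftN_mem (k : ℕ) {f : LieSeries M} (hf : f ∈ coeffIn P) :
    shiftN k f ∈ coeffIn P := by
  induction k with
  | zero => exact hf
  | succ k ih =>
    exact shift_mem ih

/-- In the absence of absolute zero divisors, an element that is nil of bounded index in all
homotopes given by power series is zero. -/
theorem eq_zero_of_pw_series (H : IsJPair P N) (hP : ∀ z ∈ zdiv P N, z = 0) {x : M} (hx : x ∈ P)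
    (n : ℕ) (h : ∀ b ∈ coeffIn N, pw (C x) b n = 0) : x = 0 := by
  induction n with
  | zero => exact congrFun (h 0 (zero_mem _)) 0
  | succ n ih =>
    have hX := C_mem hx
    -- The nil index is lowered by one: the last possibly nonzero power is an absolute zero divisor
    -- of the series pair, because the derivative of the vanishing power is zero.
    refine ih fun b hb => ?_
    ext i
    refine eq_zero_of_zdiv_series hP i _ ⟨H.series.pw_mem hX hb n, fun c hc => ?_⟩
    refine H.series.lie_pw_of_sum_eq_zero hX hb hc (h b hb) ?_
    rw [← neg_eq_zero, ← H.series.pwDeriv_succ hX hb hc]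
    ext k
    obtain ⟨G, hG⟩ := exists_pw_add (shiftN (k + 1))
      (lie_shiftN _) (C x) b c (n + 1)
    rw [h b hb, h _ (add_mem hb (shiftN_mem _ hc)), zero_add] at hG
    -- With `b` perturbed by `c` times the variable to the power `k + 1`, the quadratic remainder
    -- starts in degree `2k + 2`. Degree `2k + 1` thus isolates coefficient `k` of the derivative.
    have := congrFun hG (k + 1 + k)
    rw [coeff_add, shiftN_add, shiftN_add, shiftN_of_lt (by omega), add_zero] at this
    exact this.symm
end IsJPair

/-! ### Polarized fundamental formula; the span of the absolute zero divisors -/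

namespace IsJPair
variable {M : Type*} [LieRing M] {P N : AddSubgroup M}
open LieSeries

/-- Degree `(3, 1)` of `jp3` in the first variable. -/
theorem jp3_lin (H : IsJPair P N) {x z b c : M} (hx : x ∈ P) (hz : z ∈ P) (hb : b ∈ N)
    (hc : c ∈ N) : (2 : ℤ) • ⁅⁅x, ⁅x, b⁆⁆, ⁅⁅x, ⁅z, b⁆⁆, c⁆⁆ =
      ⁅x, ⁅z, ⁅b, ⁅b, ⁅x, ⁅x, c⁆⁆⁆⁆⁆⁆ + ⁅x, ⁅x, ⁅b, ⁅b, ⁅x, ⁅z, c⁆⁆⁆⁆⁆⁆ := by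
  -- The coefficient of the variable `t` in the fundamental formula for `x + tz`.
  have h := congrFun (H.series.jp3 (add_mem (C_mem hx) (shift_mem (C_mem hz))) (C_mem hb)
    (C_mem hc)) (0 + 1)
  simp only [lie_add, add_lie, shift_lie, lie_shift, C_lie_C, coeff_add, shift_succ,
    shift_zero] at h
  simp only [C, H.swap hz hx, H.swap (H.mem2 hx hz hb) (H.mem2 hx hx hb)] at h
  apply H.zsmul_cancel
  linear_combination (norm := module) h

theorem jp3_lin_lin (H : IsJPair P N) {x z b d c : M} (hx : x ∈ P) (hz : z ∈ P) (hb : b ∈ N)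
    (hd : d ∈ N) (hc : c ∈ N) :
    ⁅⁅x, ⁅x, d⁆⁆, ⁅⁅x, ⁅z, b⁆⁆, c⁆⁆ + ⁅⁅x, ⁅x, b⁆⁆, ⁅⁅x, ⁅z, d⁆⁆, c⁆⁆ =
      ⁅x, ⁅z, ⁅b, ⁅d, ⁅x, ⁅x, c⁆⁆⁆⁆⁆⁆ + ⁅x, ⁅x, ⁅b, ⁅d, ⁅x, ⁅z, c⁆⁆⁆⁆⁆⁆ := by
  have h := H.jp3_lin hx hz (add_mem hb hd) hc
  have h1 := H.jp3_lin hx hz hb hc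
  have h2 := H.jp3_lin hx hz hd hc
  simp only [lie_add, add_lie, H.symm.swap hd hb] at h
  apply H.zsmul_cancel
  linear_combination (norm := module) h - h1 - h2

/-- Degree `(2, 2)` of `jp3` in the first variable. -/
theorem jp3_lin2 (H : IsJPair P N) {x z b c : M} (hx : x ∈ P) (hz : z ∈ P) (hb : b ∈ N)
    (hc : c ∈ N) : (4 : ℤ) • ⁅⁅x, ⁅z, b⁆⁆, ⁅⁅x, ⁅z, b⁆⁆, c⁆⁆ +
      (2 : ℤ) • ⁅⁅x, ⁅x, b⁆⁆, ⁅⁅z, ⁅z, b⁆⁆, c⁆⁆ =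
      (4 : ℤ) • ⁅x, ⁅z, ⁅b, ⁅b, ⁅x, ⁅z, c⁆⁆⁆⁆⁆⁆ + ⁅x, ⁅x, ⁅b, ⁅b, ⁅z, ⁅z, c⁆⁆⁆⁆⁆⁆ +
        ⁅z, ⁅z, ⁅b, ⁅b, ⁅x, ⁅x, c⁆⁆⁆⁆⁆⁆ := by
  have h := H.jp3 (add_mem hx hz) hb hc
  have h' := H.jp3 (sub_mem hx hz) hb hc
  have h1 := H.jp3 hx hb hc
  have h2 := H.jp3 hz hb hc
  simp only [lie_add, add_lie, lie_sub, sub_lie, H.swap hz hx,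
    H.swap (H.mem2 hz hz hb) (H.mem2 hx hx hb)] at h h'
  apply H.zsmul_cancel
  linear_combination (norm := module) h + h' - (2 : ℤ) • h1 - (2 : ℤ) • h2

section
variable {x z b c : M}

theorem zdiv_lie_sq (H : IsJPair P N) (hb : b ∈ N) (hz : z ∈ zdiv P N) : ⁅z, ⁅b, ⁅b, z⁆⁆⁆ = 0 :=
  H.two _ (by nth_rw 1 [H.lie_sq_symm hz.1 hz.1 (H.zdiv_lie_kap hz.1 hb hz 0)]; abel)

theorem sq_mem_zdiv_symm (H : IsJPair P N) (hb : b ∈ N) (hz : z ∈ zdiv P N) :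
    ⁅b, ⁅b, z⁆⁆ ∈ zdiv N P :=
  ⟨H.symm.mem2 hb hb hz.1, fun w hw => by
    rw [H.symm.jp3 hb hz.1 hw, hz.2 _ (H.symm.mem2 hb hb hw), lie_zero, lie_zero]⟩

/-- `Z k Z = 0` for `k ∈ [x, b]`. -/
theorem zdiv_lie_lie (H : IsJPair P N) (hx : x ∈ P) (hb : b ∈ N) (hz : z ∈ zdiv P N)
    (hc : c ∈ N) : ⁅z, ⁅⁅x, b⁆, ⁅z, c⁆⁆⁆ = 0 := by
  have h1 := hz.2 c hc
  have h2 := hz.2 _ (H.mem_h hx hb hc)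
  have h3 := H.comm_p _ hz.1 _ (H.mem2 (H.mem_p _ hx _ hb _ hz.1) hz.1 hc)
  have h4 := H.swap (H.mem_p _ hx _ hb _ hz.1) hz.1 c
  rw [lie_lie _ z, lie_lie _ z, h1, lie_zero, zero_sub, lie_sub, h2, sub_zero] at h4
  exact H.two _ (by nth_rw 1 [← h4]; abel)

theorem zdiv_lie_lie' (H : IsJPair P N) (hx : x ∈ P) (hb : b ∈ N) (hz : z ∈ zdiv P N)
    (hc : c ∈ N) : ⁅⁅⁅x, b⁆, z⁆, ⁅z, c⁆⁆ = 0 := by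
  rw [lie_lie, hz.2 c hc, lie_zero, H.zdiv_lie_lie hx hb hz hc, sub_zero]

theorem zdiv_ZBZ (H : IsJPair P N) (hb : b ∈ N) (hz : z ∈ zdiv P N) (hc : c ∈ N) :
    ⁅z, ⁅b, ⁅z, c⁆⁆⁆ = 0 := by
  have h := H.zdiv_lie_lie hz.1 hb hz hc
  have e : ⁅⁅z, b⁆, z⁆ = 0 := by rw [← lie_skew, hz.2 b hb, neg_zero]
  have h2 : ⁅⁅z, b⁆, ⁅z, c⁆⁆ = ⁅z, ⁅⁅z, b⁆, c⁆⁆ := by rw [leibniz_lie, e, zero_lie, zero_add]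
  rw [lie_lie, hz.2 c hc, lie_zero, sub_zero, lie_lie z b c, H.comm_m b hb c hc, lie_zero, zero_sub,
    lie_neg] at h2
  exact H.two _ (by nth_rw 1 [h2]; abel)

theorem zdiv_lie_lie_self (H : IsJPair P N) (hb : b ∈ N) (hz : z ∈ zdiv P N) (hc : c ∈ N) :
    ⁅z, ⁅⁅z, b⁆, c⁆⁆ = 0 := by
  rw [lie_lie z b c, H.comm_m b hb c hc, lie_zero, zero_sub, lie_neg, H.zdiv_ZBZ hb hz hc, neg_zero]

theorem lie_lie_lie_sq (H : IsJPair P N) (hz : z ∈ P) (hb : b ∈ N) (hx : x ∈ P) :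
    ⁅b, ⁅⁅b, ⁅b, z⁆⁆, x⁆⁆ = ⁅⁅z, b⁆, ⁅b, ⁅b, x⁆⁆⁆ := by
  have h := H.anti_m hz hb hx
  simp only [lie_lie, lie_sub, H.comm_p z hz x hx, lie_zero,
    H.comm_m b hb _ (H.symm.mem2 hb hb hx)] at h ⊢
  linear_combination (norm := module) (-2 : ℤ) • h

theorem lie_lie_lie_comm (H : IsJPair P N) (hb : b ∈ N) (hz : z ∈ zdiv P N) (hx : x ∈ P)
    (hc : c ∈ N) : ⁅⁅x, ⁅z, b⁆⁆, ⁅z, c⁆⁆ = 0 := by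
  rw [H.swap hx hz.1, ← lie_skew z, neg_lie, H.zdiv_lie_lie' hx hb hz hc, neg_zero]

theorem lie_sq_lie (H : IsJPair P N) (hb : b ∈ N) (hz : z ∈ zdiv P N) (hx : x ∈ P)
    (hc : c ∈ N) : ⁅z, ⁅b, ⁅b, ⁅z, ⁅x, c⁆⁆⁆⁆⁆ = ⁅z, ⁅⁅b, ⁅b, z⁆⁆, ⁅x, c⁆⁆⁆ := by
  have hn := H.symm.mem2' hb hc hx
  have h1 := H.zdiv_lie_lie_self hb hz hn
  have h2 : ⁅b, ⁅b, ⁅x, c⁆⁆⁆ = 0 := H.comm_m _ hb _ hn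
  have h3 : ⁅b, ⁅b, ⁅z, ⁅x, c⁆⁆⁆⁆ = ⁅⁅b, ⁅b, z⁆⁆, ⁅x, c⁆⁆ -
      (2 : ℤ) • ⁅⁅z, b⁆, ⁅b, ⁅x, c⁆⁆⁆ + ⁅z, ⁅b, ⁅b, ⁅x, c⁆⁆⁆⁆ := by
    rw [lie_lie b ⁅b, z⁆, lie_lie b z, lie_lie b z, lie_lie z b, lie_sub]
    abel
  rw [h3, h2, lie_zero, add_zero, lie_sub, lie_zsmul, h1, smul_zero, sub_zero]

/-- The part of degree two in `x` of the computation in `sum_mem_zdiv`; it comes from the degree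
`(2, 2)` component of the fundamental formula, where the terms containing `⁅z, ⁅z, _⁆⁆` drop out. -/
theorem t_weight2 (H : IsJPair P N) (hb : b ∈ N) (hz : z ∈ zdiv P N) (hx : x ∈ P)
    (hc : c ∈ N) : (2 : ℤ) • ⁅⁅x, ⁅z, b⁆⁆, ⁅⁅x, ⁅z, b⁆⁆, c⁆⁆ +
      ⁅z, ⁅⁅x, ⁅x, ⁅b, ⁅b, z⁆⁆⁆⁆, c⁆⁆ = 0 := by
  have hd := H.symm.mem2 hb hb hz.1
  have h1 := H.jp3_lin2 hx hz.1 hb hc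
  have e1 : ⁅z, ⁅z, b⁆⁆ = 0 := hz.2 b hb
  have e2 : ⁅z, ⁅z, c⁆⁆ = 0 := hz.2 c hc
  have e3 := hz.2 _ (H.symm.mem2 hb hb (H.mem2 hx hx hc))
  have e4 : ⁅z, ⁅b, ⁅b, ⁅x, ⁅z, c⁆⁆⁆⁆⁆ = ⁅z, ⁅⁅b, ⁅b, z⁆⁆, ⁅x, c⁆⁆⁆ := by
    rw [H.swap hx hz.1, H.lie_sq_lie hb hz hx hc]
  have hzd := H.zdiv_lie_sq hb hz
  have e5 : ⁅z, ⁅⁅b, ⁅b, z⁆⁆, ⁅x, ⁅x, c⁆⁆⁆⁆ = 0 := by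
    rw [leibniz_lie, hzd, zero_lie, H.comm_p _ hz.1 _ (H.mem2 hx hx hc), lie_zero, add_zero]
  rw [e1, e2, e3, e4] at h1
  simp only [zero_lie, lie_zero, smul_zero, add_zero] at h1
  generalize ⁅b, ⁅b, z⁆⁆ = d at *
  have e6 : ⁅⁅x, ⁅x, d⁆⁆, c⁆ = ⁅d, ⁅x, ⁅x, c⁆⁆⁆ - (2 : ℤ) • ⁅x, ⁅d, ⁅x, c⁆⁆⁆ := by
    rw [lie_lie, lie_lie, lie_lie, H.comm_m d hd c hc, lie_zero, zero_sub, lie_neg]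
    module
  rw [e6, lie_sub, lie_zsmul, e5, H.swap hz.1 hx]
  apply H.two
  linear_combination (norm := module) h1

theorem t_weight3 (H : IsJPair P N) (hb : b ∈ N) (hz : z ∈ zdiv P N) (hx : x ∈ P)
    (hc : c ∈ N) : ⁅⁅x, ⁅x, ⁅b, ⁅b, z⁆⁆⁆⁆, ⁅⁅x, ⁅z, b⁆⁆, c⁆⁆ = 0 := by
  have hd := H.symm.mem2 hb hb hz.1
  have h := H.jp3_lin_lin hx hz.1 hb hd hc
  have hq := H.mem2 hx hx hc
  have hq' := H.mem2 hx hz.1 hc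
  have hg : ⁅⁅z, b⁆, ⁅x, ⁅z, c⁆⁆⁆ = 0 := by
    rw [leibniz_lie, ← lie_skew ⁅z, b⁆ x, neg_lie, H.lie_lie_lie_comm hb hz hx hc,
      lie_lie z b ⁅z, c⁆, H.zdiv_ZBZ hb hz hc, hz.2 c hc]
    simp
  have h1 := H.zdiv_lie_lie_self hb hz (H.symm.mem2 hb hb hq)
  have h2 := H.anti_m hz.1 hb hq'
  rw [hg, lie_zero, lie_zero, neg_zero] at h2
  rw [H.lie_lie_lie_sq hz.1 hb hq, H.lie_lie_lie_sq hz.1 hb hq', h1, h2, H.zdiv_lie_sq hb hz] at h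
  simpa using h

theorem sq_sq_mem_zdiv (H : IsJPair P N) (hb : b ∈ N) (hz : z ∈ zdiv P N) (hx : x ∈ P) :
    ⁅x, ⁅x, ⁅b, ⁅b, z⁆⁆⁆⁆ ∈ zdiv P N :=
  H.symm.sq_mem_zdiv_symm hx (H.sq_mem_zdiv_symm hb hz)

/-- The element is the image of `z` under the Bergmann operator of `(-2x, b)`. Its quadratic
operator is sorted by degree in `x`, and the parts of degree zero to four vanish separately. -/
theorem sum_mem_zdiv (H : IsJPair P N) (hb : b ∈ N) (hz : z ∈ zdiv P N) (hx : x ∈ P) :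
    z - (2 : ℤ) • ⁅x, ⁅z, b⁆⁆ + ⁅x, ⁅x, ⁅b, ⁅b, z⁆⁆⁆⁆ ∈ zdiv P N := by
  have hw := H.sq_sq_mem_zdiv hb hz hx
  have he := H.mem2 hx hz.1 hb
  refine ⟨add_mem (sub_mem hz.1 (zsmul_mem he _)) hw.1, fun c hc => ?_⟩
  have h1 := H.lie_lie_lie_comm hb hz hx hc
  have h2 := H.t_weight2 hb hz hx hc
  have h3 := H.t_weight3 hb hz hx hc
  simp only [sub_lie, add_lie, lie_add, lie_sub, lie_zsmul, zsmul_lie, hz.2 c hc, hw.2 c hc,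
    H.swap hz.1 he, H.swap hw.1 hz.1 c, h1, h3, H.swap he hw.1]
  linear_combination (norm := module) (2 : ℤ) • h2

/-- The element is what remains of the Bergmann image of `z` after subtracting two further absolute
zero divisors, its terms of degree zero and two in `x`. This makes the span stable under `[P, N]`.
-/
theorem two_lie_zdiv_mem (H : IsJPair P N) (hb : b ∈ N) (hz : z ∈ zdiv P N) (hx : x ∈ P) :
    (2 : ℤ) • ⁅⁅x, b⁆, z⁆ ∈ AddSubgroup.closure (zdiv P N) := by
  have h1 := AddSubgroup.subset_closure (H.sum_mem_zdiv hb hz hx)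
  have h2 := AddSubgroup.subset_closure (H.sq_sq_mem_zdiv hb hz hx)
  have h3 := AddSubgroup.subset_closure hz
  convert sub_mem (sub_mem h1 h2) h3 using 1
  have : ⁅⁅x, b⁆, z⁆ = -⁅x, ⁅z, b⁆⁆ := by
    rw [H.swap hx hz.1, lie_skew]
  rw [this]
  module
end
end IsJPair

/-! ### Jordan 3-gradings in bracket form -/

/-- A Lie algebra graded by the submodules `Vp`, `V0`, `Vm` in degrees `1`, `0`, `-1`, with
`V0 = [Vp, Vm]`, whose outer components form a Jordan pair. -/
structure TKK {Φ : Type*} [CommRing Φ] {L : Type*} [LieRing L] [LieAlgebra Φ L]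
    (Vp V0 Vm : Submodule Φ L) : Prop where
  dec : ∀ x : L, ∃ a ∈ Vp, ∃ b ∈ V0, ∃ c ∈ Vm, a + b + c = x
  indep : ∀ a ∈ Vp, ∀ b ∈ V0, ∀ c ∈ Vm, a + b + c = 0 → a = 0 ∧ b = 0 ∧ c = 0
  lie_pp : ∀ x ∈ Vp, ∀ y ∈ Vp, ⁅x, y⁆ = 0
  lie_mm : ∀ x ∈ Vm, ∀ y ∈ Vm, ⁅x, y⁆ = 0
  lie_pm : ∀ x ∈ Vp, ∀ y ∈ Vm, ⁅x, y⁆ ∈ V0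
  lie_0p : ∀ x ∈ V0, ∀ y ∈ Vp, ⁅x, y⁆ ∈ Vp
  lie_0m : ∀ x ∈ V0, ∀ y ∈ Vm, ⁅x, y⁆ ∈ Vm
  lie_00 : ∀ x ∈ V0, ∀ y ∈ V0, ⁅x, y⁆ ∈ V0
  le_span : ∀ z ∈ V0, z ∈ Submodule.span Φ {z : L | ∃ x ∈ Vp, ∃ y ∈ Vm, ⁅x, y⁆ = z}
  jp1_p : ∀ x ∈ Vp, ∀ y ∈ Vm, ∀ w ∈ Vm,
    ⁅⁅x, y⁆, ⁅x, ⁅x, w⁆⁆⁆ + ⁅x, ⁅x, ⁅⁅x, y⁆, w⁆⁆⁆ = 0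
  jp1_m : ∀ y ∈ Vm, ∀ x ∈ Vp, ∀ z ∈ Vp,
    ⁅⁅y, x⁆, ⁅y, ⁅y, z⁆⁆⁆ + ⁅y, ⁅y, ⁅⁅y, x⁆, z⁆⁆⁆ = 0

namespace TKK
variable {Φ : Type*} [CommRing Φ] {L : Type*} [LieRing L] [LieAlgebra Φ L]
  {Vp V0 Vm : Submodule Φ L}

theorem symm (H : TKK Vp V0 Vm) : TKK Vm V0 Vp where
  dec x := by
    obtain ⟨a, ha, b, hb, c, hc, h⟩ := H.dec x
    exact ⟨c, hc, b, hb, a, ha, by rw [← h]; abel⟩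
  indep a ha b hb c hc h := by
    obtain ⟨h1, h2, h3⟩ := H.indep c hc b hb a ha (by rw [← h]; abel)
    exact ⟨h3, h2, h1⟩
  lie_pp := H.lie_mm
  lie_mm := H.lie_pp
  lie_pm x hx y hy := by rw [← lie_skew]; exact neg_mem (H.lie_pm y hy x hx)
  lie_0p := H.lie_0m
  lie_0m := H.lie_0p
  lie_00 := H.lie_00
  le_span z hz := by
    refine Submodule.span_le.2 ?_ (H.le_span z hz)
    rintro _ ⟨x, hx, y, hy, rfl⟩
    rw [← lie_skew]
    exact neg_mem (Submodule.subset_span ⟨y, hy, x, hx, rfl⟩)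
  jp1_p := H.jp1_m
  jp1_m := H.jp1_p

theorem two_cancel (h2 : IsUnit (2 : Φ)) (m : L) (h : m + m = 0) : m = 0 := by
  rwa [← two_smul Φ, h2.smul_eq_zero] at h

theorem jpair (H : TKK Vp V0 Vm) (h2 : IsUnit (2 : Φ)) :
    IsJPair Vp.toAddSubgroup Vm.toAddSubgroup where
  two := two_cancel h2
  comm_p := H.lie_pp
  comm_m := H.lie_mm
  mem_p x hx y hy z hz := H.lie_0p _ (H.lie_pm x hx y hy) z hz
  mem_m x hx y hy z hz := H.lie_0m _ (H.symm.lie_pm x hx y hy) z hz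
  jp1_p := H.jp1_p
  jp1_m := H.jp1_m

/-- `(x, z, y) ↦ r [[x, y], z]`. -/
def tripleMap (H : TKK Vp V0 Vm) (r : Φ) : Vp →ₗ[Φ] Vp →ₗ[Φ] Vm →ₗ[Φ] Vp :=
  LinearMap.mk₂ Φ
    (fun x z =>
      { toFun := fun y => ⟨r • ⁅⁅(x : L), (y : L)⁆, (z : L)⁆,
          Vp.smul_mem _ (H.lie_0p _ (H.lie_pm _ x.2 _ y.2) _ z.2)⟩
        map_add' := fun y w => Subtype.ext (by simp [lie_add, add_lie])
        map_smul' := fun c y => Subtype.ext (by simp [smul_comm c r]) })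
    (fun x x' z => by ext y; simp [add_lie])
    (fun c x z => by ext y; simp [smul_comm c r])
    (fun x z z' => by ext y; simp [lie_add])
    (fun c x z => by ext y; simp [smul_comm c r])

/-- `Q_x y = r [[x, y], x]`. -/
def quad (H : TKK Vp V0 Vm) (r : Φ) : QuadraticMap Φ Vp (Vm →ₗ[Φ] Vp) :=
  LinearMap.BilinMap.toQuadraticMap (H.tripleMap r)

theorem coe_quad (H : TKK Vp V0 Vm) (r : Φ) (x : Vp) (y : Vm) :
    (H.quad r x y : L) = r • ⁅⁅(x : L), (y : L)⁆, (x : L)⁆ := rfl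

theorem coe_jordanTriple (H : TKK Vp V0 Vm) (h2 : IsUnit (2 : Φ)) {r : Φ} (hr : r + r = 1)
    (x z : Vp) (y : Vm) :
    ((jordanTriple (H.quad r) x y z : Vp) : L) = ⁅⁅(x : L), (y : L)⁆, (z : L)⁆ := by
  have h := (H.jpair h2).lie_lie_symm x.2 z.2 (y : L)
  rw [jordanTriple]
  push_cast
  rw [coe_quad, coe_quad, coe_quad]
  push_cast
  simp only [lie_add, add_lie, smul_add]
  rw [← h]
  have : r • ⁅⁅(x : L), (y : L)⁆, (z : L)⁆ + r • ⁅⁅(x : L), (y : L)⁆, (z : L)⁆ =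
      ⁅⁅(x : L), (y : L)⁆, (z : L)⁆ := by rw [← add_smul, hr, one_smul]
  linear_combination (norm := module) this

/-- With `r = 1/2`, the product is `Q_x y = -r⁅x, ⁅x, y⁆⁆`, and the axioms become the bracket
identities `jp1_p`, `jp1_lin`, `jp2_lin`, `jp3` and `jp3_lin`. -/
theorem identities (H : TKK Vp V0 Vm) (h2 : IsUnit (2 : Φ)) {r : Φ} (hr : r + r = 1) :
    JordanPairIdentities (H.quad r) (H.symm.quad r) := by
  have J := H.jpair h2
  have sk : ∀ x y z : L, ⁅⁅x, y⁆, z⁆ = -⁅z, ⁅x, y⁆⁆ := fun x y z => (lie_skew _ _).symm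
  have sk' : ∀ x y z : L, ⁅⁅x, y⁆, z⁆ = -⁅⁅y, x⁆, z⁆ := fun x y z => by
    rw [← neg_lie, lie_skew]
  have hr' : ∀ m : L, r • m + r • m = m := fun m => by rw [← add_smul, hr, one_smul]
  constructor
  · rintro ⟨x, hx⟩ ⟨y, hy⟩ ⟨w, hw⟩
    have h := J.jp1_p _ hx _ hy _ hw
    ext
    simp only [H.coe_jordanTriple h2 hr, coe_quad, H.symm.coe_jordanTriple h2 hr]
    rw [lie_smul, sk x w x, sk x _ x, sk' y x w, lie_neg, lie_neg, lie_neg]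
    linear_combination (norm := module) -r • h
  · rintro ⟨x, hx⟩ ⟨z, hz⟩ ⟨y, hy⟩ ⟨w, hw⟩
    have h := J.jp1_lin hx hz hy hw
    have h' := hr' (⁅⁅x, y⁆, ⁅x, ⁅z, w⁆⁆⁆ + ⁅x, ⁅z, ⁅⁅x, y⁆, w⁆⁆⁆)
    ext
    push_cast
    simp only [H.coe_jordanTriple h2 hr, coe_quad, H.symm.coe_jordanTriple h2 hr]
    rw [lie_smul, sk x w x, sk x w z, sk x _ x, sk x _ z, sk' y x w, sk' y z w]
    simp only [lie_neg]
    rw [J.swap hz hx, J.swap hz hx]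
    linear_combination (norm := module) h' - r • h
  · rintro ⟨x, hx⟩ ⟨z, hz⟩ ⟨y, hy⟩
    have h := J.jp2_lin (x := x) hy hy
    rw [← two_smul ℤ] at h
    ext
    simp only [H.coe_jordanTriple h2 hr, coe_quad]
    rw [smul_lie, J.zsmul_cancel h, lie_smul]
  · rintro ⟨x, hx⟩ ⟨y, hy⟩ ⟨w, hw⟩
    have h := J.jp3 hx hy hw
    ext
    simp only [coe_quad]
    rw [sk x w x, sk x y x, sk x _ x, sk y _ y]
    simp only [lie_neg, neg_lie, neg_neg, lie_smul, smul_lie, smul_neg]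
    rw [← h, sk ⁅x, ⁅x, y⁆⁆ w]
    simp only [smul_neg]
  · rintro ⟨x, hx⟩ ⟨z, hz⟩ ⟨y, hy⟩ ⟨w, hw⟩
    have h := J.jp3_lin hx hz hy hw
    have h' := hr' ⁅⁅x, ⁅x, y⁆⁆, ⁅⁅x, ⁅z, y⁆⁆, w⁆⁆
    ext
    push_cast
    simp only [H.coe_jordanTriple h2 hr, coe_quad]
    rw [sk x w x, sk x w z, sk x y x, sk x y z, sk x _ x, sk x _ z, sk y _ y, sk y _ y]
    simp only [lie_neg, neg_lie, neg_neg, lie_smul, smul_lie, smul_neg]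
    rw [sk ⁅x, ⁅x, y⁆⁆ w, J.swap hz hx, J.swap hz hx, J.swap hz hx,
      J.swap (J.mem2 hx hz hy) (J.mem2 hx hx hy)]
    linear_combination (norm := module) r • h' - (r * r) • h

theorem exists_half (h2 : IsUnit (2 : Φ)) : ∃ r : Φ, r + r = 1 := by
  obtain ⟨r, hr⟩ := h2.exists_right_inv
  exact ⟨r, by rw [← two_mul, hr]⟩

end TKK

/-! ### Translation between the two forms of the grading -/

section conversion
variable {Φ : Type*} [CommRing Φ] {L : Type*} [LieRing L] [LieAlgebra Φ L]

theorem coeLinearMap_eq {𝓛 : ℤ → Submodule Φ L}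
    (hbot : ∀ i : ℤ, i ≠ 1 → i ≠ 0 → i ≠ -1 → 𝓛 i = ⊥) (f : DirectSum ℤ fun i => 𝓛 i) :
    DirectSum.coeLinearMap 𝓛 f = f 1 + f 0 + f (-1) := by
  induction f using DirectSum.induction_on with
  | zero => simp
  | of i x =>
    rw [DirectSum.coeLinearMap_of]
    by_cases h1 : i = 1
    · subst h1; simp [DirectSum.of_apply]
    by_cases h0 : i = 0
    · subst h0; simp [DirectSum.of_apply]
    by_cases hm : i = -1
    · subst hm; simp [DirectSum.of_apply]
    have hx : x = 0 := Subtype.ext ((Submodule.mem_bot Φ).1 ((hbot i h1 h0 hm).le x.2))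
    simp [hx]
  | add f g hf hg =>
    rw [map_add, hf, hg]
    simp only [DirectSum.add_apply]
    push_cast
    abel

/-- Of the Jordan pair axioms only JP1 is kept. Written with brackets it passes to homomorphic
images, and the full quadratic structure is rebuilt from it by `TKK.isJordanThreeGrading`. -/
theorem IsJordanThreeGrading.tkk {𝓛 : ℤ → Submodule Φ L} (h2 : IsUnit (2 : Φ))
    (h : IsJordanThreeGrading 𝓛) : TKK (𝓛 1) (𝓛 0) (𝓛 (-1)) := by
  obtain ⟨r, hr⟩ := TKK.exists_half h2
  obtain ⟨J, hJp, hJm⟩ := h.exists_jordanPair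
  have hbot : ∀ i : ℤ, i ≠ 1 → i ≠ 0 → i ≠ -1 → ∀ x ∈ 𝓛 i, x = 0 := fun i h1 h0 hm x hx => by
    rwa [h.eq_bot i h1 h0 hm, Submodule.mem_bot] at hx
  have sk : ∀ x y z : L, ⁅⁅x, y⁆, z⁆ = -⁅z, ⁅x, y⁆⁆ := fun x y z => (lie_skew _ _).symm
  have sk' : ∀ x y z : L, ⁅⁅x, y⁆, z⁆ = -⁅⁅y, x⁆, z⁆ := fun x y z => by
    rw [← neg_lie, lie_skew]
  have quad {V W : Submodule Φ L} (Q : QuadraticMap Φ V (W →ₗ[Φ] V)) (x : V) (y : W) :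
      jordanTriple Q x y x = (2 : Φ) • Q x y := by
    rw [jordanTriple, ← two_smul Φ x, QuadraticMap.map_smul, LinearMap.smul_apply]
    module
  have jp {V W : Submodule Φ L} (Q : QuadraticMap Φ V (W →ₗ[Φ] V))
      (R : QuadraticMap Φ W (V →ₗ[Φ] W)) (hQR : JordanPairIdentities Q R)
      (hQ : ∀ (x z : V) (y : W), ((jordanTriple Q x y z : V) : L) = ⁅⁅(x : L), (y : L)⁆, (z : L)⁆)
      (hR : ∀ (y w : W) (x : V), ((jordanTriple R y x w : W) : L) = ⁅⁅(y : L), (x : L)⁆, (w : L)⁆) :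
      ∀ x ∈ V, ∀ y ∈ W, ∀ w ∈ W,
        ⁅⁅x, y⁆, ⁅x, ⁅x, w⁆⁆⁆ + ⁅x, ⁅x, ⁅⁅x, y⁆, w⁆⁆⁆ = 0 := by
    intro x hx y hy w hw
    have hq : ∀ w : W, ((Q ⟨x, hx⟩ w : V) : L) = -(r • ⁅x, ⁅x, (w : L)⁆⁆) := fun w => by
      have h1 := hQ ⟨x, hx⟩ ⟨x, hx⟩ w
      rw [quad, sk] at h1
      rw [← smul_neg, ← h1, Submodule.coe_smul, smul_smul, mul_two, hr, one_smul]
    have h3 := congrArg (Subtype.val) (hQR.jp1 ⟨x, hx⟩ ⟨y, hy⟩ ⟨w, hw⟩)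
    rw [hQ, hq, hq, hR, lie_neg, neg_inj] at h3
    simp only [lie_smul] at h3
    rw [sk' y x w, lie_neg, lie_neg] at h3
    have h4 := congrArg ((2 : Φ) • ·) h3
    simp only [smul_smul, two_mul, hr, one_smul] at h4
    rw [h4, neg_add_cancel]
  exact {
    dec := fun x => by
      obtain ⟨f, rfl⟩ := h.isInternal.2 x
      exact ⟨_, (f 1).2, _, (f 0).2, _, (f (-1)).2, (coeLinearMap_eq h.eq_bot f).symm⟩
    indep := fun a ha b hb c hc habc => by
      let f : DirectSum ℤ fun i => 𝓛 i := DirectSum.of (fun i => 𝓛 i) 1 ⟨a, ha⟩ +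
        DirectSum.of (fun i => 𝓛 i) 0 ⟨b, hb⟩ + DirectSum.of (fun i => 𝓛 i) (-1) ⟨c, hc⟩
      have hf : f = 0 := h.isInternal.1 (by
        change DirectSum.coeLinearMap 𝓛 f = DirectSum.coeLinearMap 𝓛 0
        rw [map_zero, map_add, map_add, DirectSum.coeLinearMap_of, DirectSum.coeLinearMap_of,
          DirectSum.coeLinearMap_of, habc])
      have e1 : (f 1 : L) = a := by simp [f, DirectSum.of_apply]
      have e0 : (f 0 : L) = b := by simp [f, DirectSum.of_apply]
      have em : (f (-1) : L) = c := by simp [f, DirectSum.of_apply]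
      rw [hf] at e1 e0 em
      exact ⟨e1.symm, e0.symm, em.symm⟩
    lie_pp := fun x hx y hy => hbot 2 (by decide) (by decide) (by decide) _ (h.lie_mem 1 1 x y hx hy)
    lie_mm := fun x hx y hy =>
      hbot (-2) (by decide) (by decide) (by decide) _ (h.lie_mem (-1) (-1) x y hx hy)
    lie_pm := fun x hx y hy => h.lie_mem 1 (-1) x y hx hy
    lie_0p := fun x hx y hy => h.lie_mem 0 1 x y hx hy
    lie_0m := fun x hx y hy => h.lie_mem 0 (-1) x y hx hy
    lie_00 := fun x hx y hy => h.lie_mem 0 0 x y hx hy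
    le_span := fun z hz => by rwa [h.zero_eq] at hz
    jp1_p := jp J.Qp J.Qm J.identities_plus hJp hJm
    jp1_m := jp J.Qm J.Qp J.identities_minus hJm hJp }

theorem TKK.isJordanThreeGrading {𝓛 : ℤ → Submodule Φ L} (h2 : IsUnit (2 : Φ))
    (hbot : ∀ i : ℤ, i ≠ 1 → i ≠ 0 → i ≠ -1 → 𝓛 i = ⊥) (H : TKK (𝓛 1) (𝓛 0) (𝓛 (-1))) :
    IsJordanThreeGrading 𝓛 where
  isInternal := by
    constructor
    · refine (injective_iff_map_eq_zero (DirectSum.coeLinearMap 𝓛)).2 fun f hf => ?_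
      rw [coeLinearMap_eq hbot] at hf
      obtain ⟨e1, e0, em⟩ := H.indep _ (f 1).2 _ (f 0).2 _ (f (-1)).2 hf
      ext i
      by_cases h1 : i = 1
      · subst h1; exact e1
      by_cases h0 : i = 0
      · subst h0; exact e0
      by_cases hm : i = -1
      · subst hm; exact em
      exact (Submodule.mem_bot Φ).1 ((hbot i h1 h0 hm).le (f i).2)
    · intro x
      obtain ⟨a, ha, b, hb, c, hc, rfl⟩ := H.dec x
      refine ⟨DirectSum.of (fun i => 𝓛 i) 1 ⟨a, ha⟩ + DirectSum.of (fun i => 𝓛 i) 0 ⟨b, hb⟩ +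
        DirectSum.of (fun i => 𝓛 i) (-1) ⟨c, hc⟩, ?_⟩
      rw [map_add, map_add, DirectSum.coeAddMonoidHom_of, DirectSum.coeAddMonoidHom_of,
        DirectSum.coeAddMonoidHom_of]
  lie_mem i j x y hx hy := by
    have key : ∀ i : ℤ, (i = 1 ∨ i = 0 ∨ i = -1) ∨ 𝓛 i = ⊥ := fun i => by
      by_cases h1 : i = 1
      · exact Or.inl (Or.inl h1)
      by_cases h0 : i = 0
      · exact Or.inl (Or.inr (Or.inl h0))
      by_cases hm : i = -1
      · exact Or.inl (Or.inr (Or.inr hm))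
      exact Or.inr (hbot i h1 h0 hm)
    have sk : ∀ {V : Submodule Φ L} {x y : L}, ⁅y, x⁆ ∈ V → ⁅x, y⁆ ∈ V := fun h => by
      rw [← lie_skew]; exact neg_mem h
    rcases key i with (rfl | rfl | rfl) | hi
    · rcases key j with (rfl | rfl | rfl) | hj
      · rw [H.lie_pp x hx y hy]; exact zero_mem _
      · exact sk (H.lie_0p y hy x hx)
      · exact H.lie_pm x hx y hy
      · rw [hj, Submodule.mem_bot] at hy; rw [hy, lie_zero]; exact zero_mem _
    · rw [zero_add]
      rcases key j with (rfl | rfl | rfl) | hj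
      · exact H.lie_0p x hx y hy
      · exact H.lie_00 x hx y hy
      · exact H.lie_0m x hx y hy
      · rw [hj, Submodule.mem_bot] at hy; rw [hy, lie_zero]; exact zero_mem _
    · rcases key j with (rfl | rfl | rfl) | hj
      · exact sk (H.lie_pm y hy x hx)
      · exact sk (H.lie_0m y hy x hx)
      · rw [H.lie_mm x hx y hy]; exact zero_mem _
      · rw [hj, Submodule.mem_bot] at hy; rw [hy, lie_zero]; exact zero_mem _
    · rw [hi, Submodule.mem_bot] at hx; rw [hx, zero_lie]; exact zero_mem _
  eq_bot := hbot
  zero_eq := by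
    refine le_antisymm H.le_span (Submodule.span_le.2 ?_)
    rintro _ ⟨x, hx, y, hy, rfl⟩
    exact H.lie_pm x hx y hy
  exists_jordanPair := by
    obtain ⟨r, hr⟩ := TKK.exists_half h2
    exact ⟨⟨H.quad r, H.symm.quad r, H.identities h2 hr, H.symm.identities h2 hr⟩,
      H.coe_jordanTriple h2 hr, fun y w x => H.symm.coe_jordanTriple h2 hr y w x⟩
end conversion

/-! ### Graded ideals, graded quotients, and the Kostrikin radical -/

/-- `I` contains the homogeneous components of its elements. -/
def IsGradedIdeal {Φ : Type*} [CommRing Φ] {L : Type*} [LieRing L] [LieAlgebra Φ L]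
    (Vp V0 Vm : Submodule Φ L) (I : LieIdeal Φ L) : Prop :=
  ∀ a ∈ Vp, ∀ b ∈ V0, ∀ c ∈ Vm, a + b + c ∈ I → a ∈ I ∧ b ∈ I ∧ c ∈ I

/-- `s` lies in the graded ideal generated by `c`. -/
def GradedGen {Φ : Type*} [CommRing Φ] {L : Type*} [LieRing L] [LieAlgebra Φ L]
    (Vp V0 Vm : Submodule Φ L) (c s : L) : Prop :=
  ∀ I : LieIdeal Φ L, IsGradedIdeal Vp V0 Vm I → c ∈ I → s ∈ I

namespace TKK
variable {Φ : Type*} [CommRing Φ] {L : Type*} [LieRing L] [LieAlgebra Φ L]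
  {Vp V0 Vm : Submodule Φ L}

theorem map (H : TKK Vp V0 Vm) {L' : Type*} [LieRing L'] [LieAlgebra Φ L'] (f : L →ₗ⁅Φ⁆ L')
    (hf : Function.Surjective f)
    (hker : ∀ a ∈ Vp, ∀ b ∈ V0, ∀ c ∈ Vm, f (a + b + c) = 0 → f a = 0 ∧ f b = 0 ∧ f c = 0) :
    TKK (Vp.map (f : L →ₗ[Φ] L')) (V0.map (f : L →ₗ[Φ] L')) (Vm.map (f : L →ₗ[Φ] L')) where
  dec x := by
    obtain ⟨x, rfl⟩ := hf x
    obtain ⟨a, ha, b, hb, c, hc, rfl⟩ := H.dec x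
    exact ⟨_, ⟨a, ha, rfl⟩, _, ⟨b, hb, rfl⟩, _, ⟨c, hc, rfl⟩, by simp⟩
  indep := by
    rintro _ ⟨a, ha, rfl⟩ _ ⟨b, hb, rfl⟩ _ ⟨c, hc, rfl⟩ h
    exact hker a ha b hb c hc (by simpa using h)
  lie_pp := by
    rintro _ ⟨x, hx, rfl⟩ _ ⟨y, hy, rfl⟩
    simp [← LieHom.map_lie, H.lie_pp x hx y hy]
  lie_mm := by
    rintro _ ⟨x, hx, rfl⟩ _ ⟨y, hy, rfl⟩
    simp [← LieHom.map_lie, H.lie_mm x hx y hy]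
  lie_pm := by
    rintro _ ⟨x, hx, rfl⟩ _ ⟨y, hy, rfl⟩
    exact ⟨_, H.lie_pm x hx y hy, by simp⟩
  lie_0p := by
    rintro _ ⟨x, hx, rfl⟩ _ ⟨y, hy, rfl⟩
    exact ⟨_, H.lie_0p x hx y hy, by simp⟩
  lie_0m := by
    rintro _ ⟨x, hx, rfl⟩ _ ⟨y, hy, rfl⟩
    exact ⟨_, H.lie_0m x hx y hy, by simp⟩
  lie_00 := by
    rintro _ ⟨x, hx, rfl⟩ _ ⟨y, hy, rfl⟩
    exact ⟨_, H.lie_00 x hx y hy, by simp⟩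
  le_span := by
    rintro _ ⟨z, hz, rfl⟩
    have h := Submodule.mem_map_of_mem (f := (f : L →ₗ[Φ] L')) (H.le_span z hz)
    rw [Submodule.map_span] at h
    refine Submodule.span_mono ?_ h
    rintro _ ⟨_, ⟨x, hx, y, hy, rfl⟩, rfl⟩
    exact ⟨_, ⟨x, hx, rfl⟩, _, ⟨y, hy, rfl⟩, by simp⟩
  jp1_p := by
    rintro _ ⟨x, hx, rfl⟩ _ ⟨y, hy, rfl⟩ _ ⟨w, hw, rfl⟩
    simpa using congrArg f (H.jp1_p x hx y hy w hw)
  jp1_m := by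
    rintro _ ⟨x, hx, rfl⟩ _ ⟨y, hy, rfl⟩ _ ⟨w, hw, rfl⟩
    simpa using congrArg f (H.jp1_m x hx y hy w hw)

end TKK

/-- The quotient map as a homomorphism of Lie algebras. -/
def LieIdeal.quotHom {Φ : Type*} [CommRing Φ] {L : Type*} [LieRing L] [LieAlgebra Φ L]
    (I : LieIdeal Φ L) : L →ₗ⁅Φ⁆ L ⧸ I :=
  { (LieSubmodule.Quotient.mk' I : L →ₗ[Φ] L ⧸ I) with
    map_lie' := fun {x y} => LieSubmodule.Quotient.mk_bracket I x y }

theorem LieIdeal.quotHom_surjective {Φ : Type*} [CommRing Φ] {L : Type*} [LieRing L]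
    [LieAlgebra Φ L] (I : LieIdeal Φ L) : Function.Surjective I.quotHom :=
  LieSubmodule.Quotient.surjective_mk' I

theorem LieIdeal.quotHom_eq_zero {Φ : Type*} [CommRing Φ] {L : Type*} [LieRing L]
    [LieAlgebra Φ L] (I : LieIdeal Φ L) (x : L) : I.quotHom x = 0 ↔ x ∈ I :=
  LieSubmodule.Quotient.mk_eq_zero' (N := I)

namespace TKK
variable {Φ : Type*} [CommRing Φ] {L : Type*} [LieRing L] [LieAlgebra Φ L]
  {Vp V0 Vm : Submodule Φ L}

theorem quotient (H : TKK Vp V0 Vm) {I : LieIdeal Φ L} (hI : IsGradedIdeal Vp V0 Vm I) :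
    TKK (Vp.map (I.quotHom : L →ₗ[Φ] L ⧸ I)) (V0.map (I.quotHom : L →ₗ[Φ] L ⧸ I))
      (Vm.map (I.quotHom : L →ₗ[Φ] L ⧸ I)) :=
  H.map I.quotHom I.quotHom_surjective fun a ha b hb c hc h => by
    simp only [LieIdeal.quotHom_eq_zero] at h ⊢
    exact hI a ha b hb c hc h

theorem quotientGrading (h2 : IsUnit (2 : Φ)) {𝓛 : ℤ → Submodule Φ L}
    (h : IsJordanThreeGrading 𝓛) {I : LieIdeal Φ L}
    (hI : IsGradedIdeal (𝓛 1) (𝓛 0) (𝓛 (-1)) I) : IsJordanThreeGrading (quotientGrading 𝓛 I) := by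
  refine TKK.isJordanThreeGrading h2 (fun i h1 h0 hm => ?_) ((h.tkk h2).quotient hI)
  rw [_root_.quotientGrading, h.eq_bot i h1 h0 hm, Submodule.map_bot]

theorem _root_.IsGradedIdeal.symm {I : LieIdeal Φ L} (hI : IsGradedIdeal Vp V0 Vm I) :
    IsGradedIdeal Vm V0 Vp I := fun a ha b hb c hc h => by
  obtain ⟨h1, h2, h3⟩ := hI c hc b hb a ha (by rwa [show c + b + a = a + b + c by abel])
  exact ⟨h3, h2, h1⟩

theorem _root_.IsGradedIdeal.inf {I J : LieIdeal Φ L} (hI : IsGradedIdeal Vp V0 Vm I)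
    (hJ : IsGradedIdeal Vp V0 Vm J) : IsGradedIdeal Vp V0 Vm (I ⊓ J) := fun a ha b hb c hc h => by
  rw [LieSubmodule.mem_inf] at h
  obtain ⟨h1, h2, h3⟩ := hI a ha b hb c hc h.1
  obtain ⟨k1, k2, k3⟩ := hJ a ha b hb c hc h.2
  simp only [LieSubmodule.mem_inf]
  exact ⟨⟨h1, k1⟩, ⟨h2, k2⟩, h3, k3⟩

theorem _root_.GradedGen.trans {x y z : L} (h : GradedGen Vp V0 Vm x y)
    (h' : GradedGen Vp V0 Vm y z) : GradedGen Vp V0 Vm x z := fun I hI hx => h' I hI (h I hI hx)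

theorem isGradedIdeal_bot (H : TKK Vp V0 Vm) : IsGradedIdeal Vp V0 Vm (⊥ : LieIdeal Φ L) :=
  fun a ha b hb c hc h => by
    simp only [LieSubmodule.mem_bot] at *
    exact H.indep a ha b hb c hc h

theorem isGradedIdeal_comap {L' : Type*} [LieRing L'] [LieAlgebra Φ L']
    (f : L →ₗ⁅Φ⁆ L') {J : LieIdeal Φ L'}
    (hJ : IsGradedIdeal (Vp.map (f : L →ₗ[Φ] L')) (V0.map (f : L →ₗ[Φ] L'))
      (Vm.map (f : L →ₗ[Φ] L')) J) : IsGradedIdeal Vp V0 Vm (J.comap f) := by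
  intro a ha b hb c hc h
  simp only [LieIdeal.mem_comap, map_add] at h ⊢
  exact hJ _ ⟨a, ha, rfl⟩ _ ⟨b, hb, rfl⟩ _ ⟨c, hc, rfl⟩ h

/-- The graded ideal generated by an element. -/
def gen (Vp V0 Vm : Submodule Φ L) (c : L) : LieIdeal Φ L :=
  sInf {I | IsGradedIdeal Vp V0 Vm I ∧ c ∈ I}

theorem mem_gen {c s : L} : s ∈ gen Vp V0 Vm c ↔ GradedGen Vp V0 Vm c s := by
  rw [gen, ← SetLike.mem_coe, LieSubmodule.coe_sInf]
  simp [GradedGen]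

theorem gen_graded (c : L) : IsGradedIdeal Vp V0 Vm (gen Vp V0 Vm c) := by
  intro a ha b hb d hd h
  simp only [mem_gen, GradedGen] at *
  exact ⟨fun I hI hc => (hI a ha b hb d hd (h I hI hc)).1,
    fun I hI hc => (hI a ha b hb d hd (h I hI hc)).2.1,
    fun I hI hc => (hI a ha b hb d hd (h I hI hc)).2.2⟩

/-- The homogeneous components of a bracket. -/
theorem lie_dec (H : TKK Vp V0 Vm) {a b c a' b' c' : L} (ha : a ∈ Vp) (hb : b ∈ V0) (hc : c ∈ Vm)
    (ha' : a' ∈ Vp) (hb' : b' ∈ V0) (hc' : c' ∈ Vm) :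
    ⁅a, b'⁆ + ⁅b, a'⁆ ∈ Vp ∧ ⁅a, c'⁆ + ⁅b, b'⁆ + ⁅c, a'⁆ ∈ V0 ∧ ⁅b, c'⁆ + ⁅c, b'⁆ ∈ Vm ∧
    ⁅a + b + c, a' + b' + c'⁆ =
      (⁅a, b'⁆ + ⁅b, a'⁆) + (⁅a, c'⁆ + ⁅b, b'⁆ + ⁅c, a'⁆) + (⁅b, c'⁆ + ⁅c, b'⁆) := by
  refine ⟨add_mem ?_ (H.lie_0p b hb a' ha'), add_mem (add_mem (H.lie_pm a ha c' hc')
    (H.lie_00 b hb b' hb')) (H.symm.lie_pm c hc a' ha'), add_mem (H.lie_0m b hb c' hc') ?_, ?_⟩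
  · rw [← lie_skew]; exact neg_mem (H.lie_0p b' hb' a ha)
  · rw [← lie_skew]; exact neg_mem (H.lie_0m b' hb' c hc)
  · simp only [lie_add, add_lie, H.lie_pp a ha a' ha', H.lie_mm c hc c' hc']
    abel

/-- The sum of the homogeneous parts of an ideal. -/
def homCore (H : TKK Vp V0 Vm) (I : LieIdeal Φ L) : LieIdeal Φ L where
  carrier := {x | ∃ a ∈ Vp, ∃ b ∈ V0, ∃ c ∈ Vm, a ∈ I ∧ b ∈ I ∧ c ∈ I ∧ a + b + c = x}
  zero_mem' := ⟨0, zero_mem _, 0, zero_mem _, 0, zero_mem _, zero_mem _, zero_mem _, zero_mem _,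
    by simp⟩
  add_mem' := by
    rintro _ _ ⟨a, ha, b, hb, c, hc, h1, h2, h3, rfl⟩ ⟨a', ha', b', hb', c', hc', k1, k2, k3, rfl⟩
    exact ⟨_, add_mem ha ha', _, add_mem hb hb', _, add_mem hc hc', add_mem h1 k1, add_mem h2 k2,
      add_mem h3 k3, by abel⟩
  smul_mem' := by
    rintro r _ ⟨a, ha, b, hb, c, hc, h1, h2, h3, rfl⟩
    exact ⟨_, Vp.smul_mem r ha, _, V0.smul_mem r hb, _, Vm.smul_mem r hc, I.smul_mem r h1,
      I.smul_mem r h2, I.smul_mem r h3, by simp⟩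
  lie_mem := by
    rintro x _ ⟨a', ha', b', hb', c', hc', h1, h2, h3, rfl⟩
    obtain ⟨a, ha, b, hb, c, hc, rfl⟩ := H.dec x
    obtain ⟨k1, k2, k3, k4⟩ := H.lie_dec ha hb hc ha' hb' hc'
    exact ⟨_, k1, _, k2, _, k3, add_mem (lie_mem_right Φ L I _ _ h2) (lie_mem_right Φ L I _ _ h1),
      add_mem (add_mem (lie_mem_right Φ L I _ _ h3) (lie_mem_right Φ L I _ _ h2))
        (lie_mem_right Φ L I _ _ h1),
      add_mem (lie_mem_right Φ L I _ _ h3) (lie_mem_right Φ L I _ _ h2), k4.symm⟩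

theorem homCore_le (H : TKK Vp V0 Vm) (I : LieIdeal Φ L) : H.homCore I ≤ I := by
  rintro _ ⟨a, ha, b, hb, c, hc, h1, h2, h3, rfl⟩
  exact add_mem (add_mem h1 h2) h3

theorem mem_homCore (H : TKK Vp V0 Vm) {I : LieIdeal Φ L} {a b c : L} (ha : a ∈ Vp) (hb : b ∈ V0)
    (hc : c ∈ Vm) (h1 : a ∈ I) (h2 : b ∈ I) (h3 : c ∈ I) : a + b + c ∈ H.homCore I :=
  ⟨a, ha, b, hb, c, hc, h1, h2, h3, rfl⟩

theorem mem_homCore_p (H : TKK Vp V0 Vm) {I : LieIdeal Φ L} {a : L} (ha : a ∈ Vp) (h : a ∈ I) :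
    a ∈ H.homCore I := by
  simpa using H.mem_homCore ha (zero_mem _) (zero_mem _) h (zero_mem _) (zero_mem _)

theorem mem_homCore_0 (H : TKK Vp V0 Vm) {I : LieIdeal Φ L} {a : L} (ha : a ∈ V0) (h : a ∈ I) :
    a ∈ H.homCore I := by
  simpa using H.mem_homCore (zero_mem _) ha (zero_mem _) (zero_mem _) h (zero_mem _)

theorem mem_homCore_m (H : TKK Vp V0 Vm) {I : LieIdeal Φ L} {a : L} (ha : a ∈ Vm) (h : a ∈ I) :
    a ∈ H.homCore I := by
  simpa using H.mem_homCore (zero_mem _) (zero_mem _) ha (zero_mem _) (zero_mem _) h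

theorem homCore_graded (H : TKK Vp V0 Vm) (I : LieIdeal Φ L) :
    IsGradedIdeal Vp V0 Vm (H.homCore I) := by
  rintro a ha b hb c hc ⟨a', ha', b', hb', c', hc', h1, h2, h3, e⟩
  obtain ⟨e1, e2, e3⟩ := H.indep _ (sub_mem ha' ha) _ (sub_mem hb' hb) _ (sub_mem hc' hc) (by
    rw [← sub_eq_zero] at e; rw [← e]; abel)
  rw [sub_eq_zero] at e1 e2 e3
  subst e1 e2 e3
  exact ⟨H.mem_homCore_p ha h1, H.mem_homCore_0 hb h2, H.mem_homCore_m hc h3⟩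

theorem lie_lie_top_mem (H : TKK Vp V0 Vm) {I : LieIdeal Φ L} (hI : IsGradedIdeal Vp V0 Vm I)
    {z1 z0 zm c : L} (h1 : z1 ∈ Vp) (h0 : z0 ∈ V0) (hm : zm ∈ Vm) (hc : c ∈ Vm)
    (h : ⁅z1 + z0 + zm, ⁅z1 + z0 + zm, c⁆⁆ ∈ I) : ⁅z1, ⁅z1, c⁆⁆ ∈ I := by
  have e1 := (H.lie_dec h1 h0 hm (zero_mem _) (zero_mem _) hc).2.2.2
  simp only [lie_zero, add_zero, zero_add] at e1
  obtain ⟨k1, k2, k3, k4⟩ := H.lie_dec h1 h0 hm (zero_mem _) (H.lie_pm _ h1 _ hc)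
    (H.lie_0m _ h0 _ hc)
  simp only [lie_zero, add_zero, zero_add] at k1 k2 k3 k4
  rw [e1, k4] at h
  exact (hI _ k1 _ k2 _ k3 h).1

theorem lie_lie_eq (H : TKK Vp V0 Vm) {z a b c : L} (hz : z ∈ Vp) (ha : a ∈ Vp) (hb : b ∈ V0) :
    ⁅z, ⁅z, a + b + c⁆⁆ = ⁅z, ⁅z, c⁆⁆ := by
  have h : ⁅z, ⁅z, b⁆⁆ = 0 := H.lie_pp z hz _ (by rw [← lie_skew]; exact neg_mem (H.lie_0p b hb z hz))
  rw [lie_add, lie_add, lie_add, lie_add, H.lie_pp z hz a ha, lie_zero, h]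
  simp

/-- By minimality it suffices that the quotient by the homogeneous core of `K` is nondegenerate. If
`z` has square zero modulo the core, then so do its outer components by degree, and they lie in `K`;
modulo `K` the degree-zero component then has the same square as `z`. -/
theorem kostrikinRadical_graded (H : TKK Vp V0 Vm) :
    IsGradedIdeal Vp V0 Vm (kostrikinRadical Φ L) := by
  obtain ⟨hK, hmin⟩ := kostrikinRadical_isLeast Φ L
  generalize kostrikinRadical Φ L = K at *
  replace hK := (isNondegenerateLie_quotient_iff K).1 hK
  have hg := H.homCore_graded K
  have hle := H.homCore_le K
  suffices K ≤ H.homCore K by rwa [le_antisymm this hle]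
  refine hmin ((isNondegenerateLie_quotient_iff _).2 fun z hz => ?_)
  obtain ⟨z1, h1, z0, h0, zm, hm, rfl⟩ := H.dec z
  have k1 : z1 ∈ H.homCore K := by
    refine H.mem_homCore_p h1 (hK _ fun x => ?_)
    obtain ⟨a, ha, b, hb, c, hc, rfl⟩ := H.dec x
    rw [H.lie_lie_eq h1 ha hb]
    exact hle (H.lie_lie_top_mem hg h1 h0 hm hc (hz c))
  have km : zm ∈ H.homCore K := by
    refine H.mem_homCore_m hm (hK _ fun x => ?_)
    obtain ⟨a, ha, b, hb, c, hc, rfl⟩ := H.symm.dec x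
    rw [H.symm.lie_lie_eq hm ha hb]
    refine hle (H.symm.lie_lie_top_mem hg.symm hm h0 h1 hc ?_)
    rw [show zm + z0 + z1 = z1 + z0 + zm by abel]
    exact hz c
  refine add_mem (add_mem k1 (H.mem_homCore_0 h0 (hK _ fun x => ?_))) km
  have e : ⁅z0, ⁅z0, x⁆⁆ = ⁅z1 + z0 + zm, ⁅z1 + z0 + zm, x⁆⁆ - ⁅z1 + zm, ⁅z1 + z0 + zm, x⁆⁆ -
      ⁅z0, ⁅z1 + zm, x⁆⁆ := by simp only [add_lie, lie_add]; abel
  have hs := add_mem k1 km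
  rw [e]
  exact hle (sub_mem (sub_mem (hz x) (lie_mem_left Φ L _ _ _ hs))
    (lie_mem_right Φ L _ _ _ (lie_mem_left Φ L _ _ _ hs)))

end TKK

/-! ### Nondegeneracy and the ideal of absolute zero divisors -/

namespace IsJPair
variable {M : Type*} [LieRing M] {P N : AddSubgroup M}

/-- The hypothesis and the fundamental formula make every `⁅x, ⁅x, b⁆⁆` an absolute zero divisor,
hence zero; then `x` is one itself. -/
theorem eq_zero_of_lie_lie (H : IsJPair P N) (hP : ∀ z ∈ zdiv P N, z = 0) {x : M} (hx : x ∈ P)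
    (h : ∀ b ∈ N, ∀ c ∈ N, ⁅⁅x, b⁆, c⁆ = 0) : x = 0 := by
  refine hP x ⟨hx, fun b hb => hP _ ⟨H.mem2 hx hx hb, fun w hw => ?_⟩⟩
  have he := H.mem2 hx hx hw
  have h1 := H.anti_p hx hb hw
  rw [h b hb w hw, lie_zero, lie_zero, neg_zero] at h1
  have h0 := H.comm_p x hx _ he
  rw [H.jp3 hx hb hw]
  generalize ⁅x, ⁅x, w⁆⁆ = e at *
  have h2 : ⁅x, ⁅b, e⁆⁆ = 0 := by rw [leibniz_lie, h1, h0, lie_zero, zero_add]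
  rw [leibniz_lie x b, h2, lie_zero, add_zero, leibniz_lie _ b, h b hb b hb, h1, zero_lie, lie_zero,
    add_zero, lie_zero]
end IsJPair

namespace TKK
variable {Φ : Type*} [CommRing Φ] {L : Type*} [LieRing L] [LieAlgebra Φ L]
  {Vp V0 Vm : Submodule Φ L}

theorem zdiv_eq_zero (H : TKK Vp V0 Vm) (hL : IsNondegenerateLie L) :
    ∀ z ∈ zdiv Vp.toAddSubgroup Vm.toAddSubgroup, z = 0 := fun z hz => hL z fun x => by
  obtain ⟨a, ha, b, hb, c, hc, rfl⟩ := H.dec x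
  rw [H.lie_lie_eq hz.1 ha hb, hz.2 c hc]

theorem lie_eq_zero (H : TKK Vp V0 Vm) {u : L} (hp : ∀ x ∈ Vp, ⁅u, x⁆ = 0)
    (hm : ∀ x ∈ Vm, ⁅u, x⁆ = 0) (x : L) : ⁅u, x⁆ = 0 := by
  obtain ⟨a, ha, b, hb, c, hc, rfl⟩ := H.dec x
  have h0 : ∀ b ∈ Submodule.span Φ {z : L | ∃ x ∈ Vp, ∃ y ∈ Vm, ⁅x, y⁆ = z}, ⁅u, b⁆ = 0 := by
    intro b hb
    induction hb using Submodule.span_induction with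
    | mem x h =>
      obtain ⟨y, hy, w, hw, rfl⟩ := h
      rw [leibniz_lie, hp y hy, hm w hw, lie_zero, zero_lie, add_zero]
    | zero => simp
    | add x y _ _ hx hy => rw [lie_add, hx, hy, add_zero]
    | smul r x _ hx => rw [lie_smul, hx, smul_zero]
  rw [lie_add, lie_add, hp a ha, h0 b (H.le_span b hb), hm c hc]; simp

/-- The span of the absolute zero divisors of `Vp`. -/
def zspan (Vp Vm : Submodule Φ L) : Submodule Φ L :=
  Submodule.span Φ (zdiv Vp.toAddSubgroup Vm.toAddSubgroup)

theorem zspan_le : zspan Vp Vm ≤ Vp := Submodule.span_le.2 fun _ hz => hz.1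

/-- Scalar multiples of absolute zero divisors are absolute zero divisors, so the `Φ`-span is the
additive span, to which the nilpotence bound applies. -/
theorem mem_closure_of_mem_zspan {x : L} (hx : x ∈ zspan Vp Vm) :
    x ∈ AddSubgroup.closure (zdiv Vp.toAddSubgroup Vm.toAddSubgroup) := by
  induction hx using Submodule.span_induction with
  | mem x h => exact AddSubgroup.subset_closure h
  | zero => exact zero_mem _
  | add x y _ _ hx hy => exact add_mem hx hy
  | smul r x h hx =>
    clear h
    induction hx using AddSubgroup.closure_induction with
    | mem z hz => exact AddSubgroup.subset_closure ⟨Vp.smul_mem r hz.1, fun w hw => by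
        rw [smul_lie, smul_lie, lie_smul, hz.2 w hw, smul_zero, smul_zero]⟩
    | zero => simp
    | add x y _ _ hx hy => rw [smul_add]; exact add_mem hx hy
    | neg x _ hx => rw [smul_neg]; exact neg_mem hx

theorem mem_of_two_smul_mem (h2 : IsUnit (2 : Φ)) {V : Submodule Φ L} {x : L}
    (h : (2 : ℤ) • x ∈ V) : x ∈ V := by
  obtain ⟨r, hr⟩ := exists_half h2
  have := V.smul_mem r h
  rwa [two_smul, smul_add, ← add_smul, hr, one_smul] at this

theorem lie_zspan (H : TKK Vp V0 Vm) (h2 : IsUnit (2 : Φ)) {k z : L} (hk : k ∈ V0)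
    (hz : z ∈ zspan Vp Vm) : ⁅k, z⁆ ∈ zspan Vp Vm := by
  induction hz using Submodule.span_induction with
  | mem z hz =>
    suffices ∀ b ∈ Submodule.span Φ {z : L | ∃ x ∈ Vp, ∃ y ∈ Vm, ⁅x, y⁆ = z},
        ⁅b, z⁆ ∈ zspan Vp Vm from this k (H.le_span k hk)
    intro b hb
    induction hb using Submodule.span_induction with
    | mem x h =>
      obtain ⟨y, hy, w, hw, rfl⟩ := h
      have h3 := (H.jpair h2).two_lie_zdiv_mem hw hz hy
      refine mem_of_two_smul_mem h2 ?_
      exact (AddSubgroup.closure_le (K := (zspan Vp Vm).toAddSubgroup)).2 Submodule.subset_span h3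
    | zero => rw [zero_lie]; exact zero_mem _
    | add x y _ _ hx hy => rw [add_lie]; exact add_mem hx hy
    | smul r x _ hx => rw [smul_lie]; exact Submodule.smul_mem _ r hx
  | zero => rw [lie_zero]; exact zero_mem _
  | add x y _ _ hx hy => rw [lie_add]; exact add_mem hx hy
  | smul r x _ hx => rw [lie_smul]; exact Submodule.smul_mem _ r hx

theorem lie_lie_zspan (H : TKK Vp V0 Vm) (h2 : IsUnit (2 : Φ)) {w w' z : L} (hw : w ∈ Vm)
    (hw' : w' ∈ Vm) (hz : z ∈ zspan Vp Vm) : ⁅w, ⁅w', z⁆⁆ ∈ zspan Vm Vp := by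
  have J := H.jpair h2
  induction hz using Submodule.span_induction with
  | mem z hz =>
    have h1 := Submodule.subset_span (R := Φ) (J.sq_mem_zdiv_symm (add_mem hw hw') hz)
    have h3 := Submodule.subset_span (R := Φ) (J.sq_mem_zdiv_symm hw hz)
    have h4 := Submodule.subset_span (R := Φ) (J.sq_mem_zdiv_symm hw' hz)
    refine mem_of_two_smul_mem h2 ?_
    have e : (2 : ℤ) • ⁅w, ⁅w', z⁆⁆ =
        ⁅w + w', ⁅w + w', z⁆⁆ - ⁅w, ⁅w, z⁆⁆ - ⁅w', ⁅w', z⁆⁆ := by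
      simp only [lie_add, add_lie, J.symm.swap hw' hw]
      module
    rw [e]
    exact sub_mem (sub_mem h1 h3) h4
  | zero => rw [lie_zero, lie_zero]; exact zero_mem _
  | add x y _ _ hx hy => rw [lie_add, lie_add]; exact add_mem hx hy
  | smul r x _ hx => rw [lie_smul, lie_smul]; exact Submodule.smul_mem _ r hx

/-- The degree zero part of the ideal spanned by the absolute zero divisors. -/
def zzero (Vp V0 Vm : Submodule Φ L) : Submodule Φ L where
  carrier := {k | k ∈ V0 ∧ (∀ x ∈ Vp, ⁅k, x⁆ ∈ zspan Vp Vm) ∧ ∀ x ∈ Vm, ⁅k, x⁆ ∈ zspan Vm Vp}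
  zero_mem' := ⟨zero_mem _, fun x _ => by rw [zero_lie]; exact zero_mem _, fun x _ => by
    rw [zero_lie]; exact zero_mem _⟩
  add_mem' := fun ha hb => ⟨add_mem ha.1 hb.1,
    fun x hx => by rw [add_lie]; exact add_mem (ha.2.1 x hx) (hb.2.1 x hx),
    fun x hx => by rw [add_lie]; exact add_mem (ha.2.2 x hx) (hb.2.2 x hx)⟩
  smul_mem' := fun r a ha => ⟨V0.smul_mem r ha.1,
    fun x hx => by rw [smul_lie]; exact Submodule.smul_mem _ r (ha.2.1 x hx),
    fun x hx => by rw [smul_lie]; exact Submodule.smul_mem _ r (ha.2.2 x hx)⟩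

theorem lie_mem_zzero (H : TKK Vp V0 Vm) (h2 : IsUnit (2 : Φ)) {w z : L} (hw : w ∈ Vm)
    (hz : z ∈ zspan Vp Vm) : ⁅w, z⁆ ∈ zzero Vp V0 Vm := by
  have hzp := zspan_le hz
  refine ⟨H.symm.lie_pm w hw z hzp, fun x hx => ?_, fun x hx => ?_⟩
  · rw [← lie_skew w z, neg_lie, (H.jpair h2).lie_lie_symm hzp hx w]
    exact neg_mem (H.lie_zspan h2 (H.lie_pm x hx w hw) hz)
  · rw [← lie_skew]
    exact neg_mem (H.lie_lie_zspan h2 hx hw hz)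

theorem lie_zzero (H : TKK Vp V0 Vm) (h2 : IsUnit (2 : Φ)) {k m : L} (hk : k ∈ V0)
    (hm : m ∈ zzero Vp V0 Vm) : ⁅k, m⁆ ∈ zzero Vp V0 Vm := by
  refine ⟨H.lie_00 k hk m hm.1, fun x hx => ?_, fun x hx => ?_⟩
  · rw [lie_lie]
    exact sub_mem (H.lie_zspan h2 hk (hm.2.1 x hx)) (hm.2.1 _ (H.lie_0p k hk x hx))
  · rw [lie_lie]
    exact sub_mem (H.symm.lie_zspan h2 hk (hm.2.2 x hx)) (hm.2.2 _ (H.lie_0m k hk x hx))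

/-- The absolute zero divisors span the outer components of a graded ideal. -/
def zideal (H : TKK Vp V0 Vm) (h2 : IsUnit (2 : Φ)) : LieIdeal Φ L where
  toSubmodule := zspan Vp Vm ⊔ zzero Vp V0 Vm ⊔ zspan Vm Vp
  lie_mem := by
    intro x m hm
    simp only [AddSubsemigroup.mem_carrier, AddSubmonoid.mem_toSubsemigroup,
      Submodule.mem_toAddSubmonoid] at hm ⊢
    rw [Submodule.mem_sup] at hm
    obtain ⟨_, hm, c', hc', rfl⟩ := hm
    rw [Submodule.mem_sup] at hm
    obtain ⟨a', ha', b', hb', rfl⟩ := hm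
    obtain ⟨a, ha, b, hb, c, hc, rfl⟩ := H.dec x
    rw [(H.lie_dec ha hb hc (zspan_le ha') hb'.1 (zspan_le hc')).2.2.2]
    refine Submodule.add_mem_sup (Submodule.add_mem_sup (add_mem ?_ (H.lie_zspan h2 hb ha'))
      (add_mem (add_mem ?_ (H.lie_zzero h2 hb hb')) (H.lie_mem_zzero h2 hc ha')))
      (add_mem (H.symm.lie_zspan h2 hb hc') ?_)
    · rw [← lie_skew]; exact neg_mem (hb'.2.1 a ha)
    · obtain ⟨h1, h3, h4⟩ := H.symm.lie_mem_zzero h2 ha hc'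
      exact ⟨h1, h4, h3⟩
    · rw [← lie_skew]; exact neg_mem (hb'.2.2 c hc)

theorem mem_zideal (H : TKK Vp V0 Vm) (h2 : IsUnit (2 : Φ)) {a b c : L} (ha : a ∈ Vp) (hb : b ∈ V0)
    (hc : c ∈ Vm) (h : a + b + c ∈ H.zideal h2) :
    a ∈ zspan Vp Vm ∧ b ∈ zzero Vp V0 Vm ∧ c ∈ zspan Vm Vp := by
  change _ ∈ zspan Vp Vm ⊔ zzero Vp V0 Vm ⊔ zspan Vm Vp at h
  rw [Submodule.mem_sup] at h
  obtain ⟨_, hm, c', hc', e⟩ := h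
  rw [Submodule.mem_sup] at hm
  obtain ⟨a', ha', b', hb', rfl⟩ := hm
  obtain ⟨e1, e2, e3⟩ := H.indep _ (sub_mem (zspan_le ha') ha) _ (sub_mem hb'.1 hb) _
    (sub_mem (zspan_le hc') hc) (by rw [← sub_eq_zero] at e; rw [← e]; abel)
  rw [sub_eq_zero] at e1 e2 e3
  subst e1 e2 e3
  exact ⟨ha', hb', hc'⟩

theorem zspan_le_zideal (H : TKK Vp V0 Vm) (h2 : IsUnit (2 : Φ)) {a : L} (ha : a ∈ zspan Vp Vm) :
    a ∈ H.zideal h2 :=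
  (le_sup_left.trans le_sup_left : zspan Vp Vm ≤ zspan Vp Vm ⊔ zzero Vp V0 Vm ⊔ zspan Vm Vp) ha

theorem zspan_le_zideal' (H : TKK Vp V0 Vm) (h2 : IsUnit (2 : Φ)) {a : L} (ha : a ∈ zspan Vm Vp) :
    a ∈ H.zideal h2 :=
  (le_sup_right : zspan Vm Vp ≤ zspan Vp Vm ⊔ zzero Vp V0 Vm ⊔ zspan Vm Vp) ha

theorem zideal_graded (H : TKK Vp V0 Vm) (h2 : IsUnit (2 : Φ)) :
    IsGradedIdeal Vp V0 Vm (H.zideal h2) := fun a ha b hb c hc h => by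
  obtain ⟨h1, h3, h4⟩ := H.mem_zideal h2 ha hb hc h
  exact ⟨H.zspan_le_zideal h2 h1, (le_sup_right.trans le_sup_left :
    zzero Vp V0 Vm ≤ zspan Vp Vm ⊔ zzero Vp V0 Vm ⊔ zspan Vm Vp) h3, H.zspan_le_zideal' h2 h4⟩

theorem mem_closure_of_mem_zideal (H : TKK Vp V0 Vm) (h2 : IsUnit (2 : Φ)) {a : L} (ha : a ∈ Vp)
    (h : a ∈ H.zideal h2) : a ∈ AddSubgroup.closure (zdiv Vp.toAddSubgroup Vm.toAddSubgroup) :=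
  mem_closure_of_mem_zspan
    (H.mem_zideal h2 ha (zero_mem _) (zero_mem _) (by rwa [add_zero, add_zero])).1

/-- Nonzero graded ideals of a nondegenerate algebra meet `Vp`. -/
theorem exists_ne_zero_mem (H : TKK Vp V0 Vm) (h2 : IsUnit (2 : Φ)) (hL : IsNondegenerateLie L)
    {I : LieIdeal Φ L} (hI : IsGradedIdeal Vp V0 Vm I) (h : I ≠ ⊥) : ∃ x ∈ Vp, x ∈ I ∧ x ≠ 0 := by
  by_contra! hc
  refine h ((LieSubmodule.eq_bot_iff _).2 fun x hx => ?_)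
  obtain ⟨a, ha, b, hb, c, hc', rfl⟩ := H.dec x
  obtain ⟨h1, h3, h4⟩ := hI a ha b hb c hc' hx
  have J := H.jpair h2
  have hm : ∀ c ∈ Vm, c ∈ I → c = 0 := fun c hcm hcI =>
    J.symm.eq_zero_of_lie_lie (H.symm.zdiv_eq_zero hL) hcm fun y hy w hw =>
      hc _ (J.symm.mem_h hcm hy hw) (lie_mem_left Φ L _ _ _ (lie_mem_left Φ L _ _ _ hcI))
  have hb0 : b = 0 := hL b fun x => by
    rw [H.lie_eq_zero (fun x hx => hc _ (H.lie_0p b hb x hx) (lie_mem_left Φ L _ _ _ h3))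
      (fun x hx => hm _ (H.lie_0m b hb x hx) (lie_mem_left Φ L _ _ _ h3))]
  rw [hc a ha h1, hm c hc' h4, hb0]; simp

end TKK

/-! ### Annihilators of graded ideals -/

namespace TKK
variable {Φ : Type*} [CommRing Φ] {L : Type*} [LieRing L] [LieAlgebra Φ L]
  {Vp V0 Vm : Submodule Φ L}

/-- The annihilator of an ideal. -/
def ann (I : LieIdeal Φ L) : LieIdeal Φ L where
  carrier := {z | ∀ i ∈ I, ⁅z, i⁆ = 0}
  zero_mem' := fun i _ => zero_lie i
  add_mem' := fun ha hb i hi => by rw [add_lie, ha i hi, hb i hi, add_zero]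
  smul_mem' := fun r a ha i hi => by rw [smul_lie, ha i hi, smul_zero]
  lie_mem := fun {x m} hm i hi => by
    rw [lie_lie, hm i hi, hm _ (lie_mem_right Φ L I x i hi), lie_zero, sub_zero]

theorem ann_graded (H : TKK Vp V0 Vm) {I : LieIdeal Φ L} (hI : IsGradedIdeal Vp V0 Vm I) :
    IsGradedIdeal Vp V0 Vm (ann I) := by
  intro a ha b hb c hc h
  have key : ∀ i ∈ I, ⁅a, i⁆ = 0 ∧ ⁅b, i⁆ = 0 ∧ ⁅c, i⁆ = 0 := by
    intro i hi
    obtain ⟨i1, h1, i0, h0, im, hm, rfl⟩ := H.dec i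
    obtain ⟨k1, k0, km⟩ := hI i1 h1 i0 h0 im hm hi
    obtain ⟨p1, p2, p3, p4⟩ := H.lie_dec ha hb hc h1 (zero_mem _) (zero_mem _)
    obtain ⟨q1, q2, q3, q4⟩ := H.lie_dec ha hb hc (zero_mem _) h0 (zero_mem _)
    obtain ⟨r1, r2, r3, r4⟩ := H.lie_dec ha hb hc (zero_mem _) (zero_mem _) hm
    simp only [lie_zero, add_zero, zero_add] at *
    rw [h _ k1] at p4
    rw [h _ k0] at q4
    rw [h _ km] at r4
    have e1 := H.indep _ p1 _ p2 0 (zero_mem _) (by rw [add_zero]; exact p4.symm)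
    have e2 := H.indep _ q1 _ q2 _ q3 q4.symm
    have e3 := H.indep 0 (zero_mem _) _ r2 _ r3 (by rw [zero_add]; exact r4.symm)
    simp only [lie_add, e1, e2, e3, H.lie_pp a ha i1 h1, H.lie_mm c hc im hm, add_zero, and_self]
  exact ⟨fun i hi => (key i hi).1, fun i hi => (key i hi).2.1, fun i hi => (key i hi).2.2⟩

theorem eq_zero_of_mem_ann (hL : IsNondegenerateLie L) {I : LieIdeal Φ L} {z : L} (hz : z ∈ I)
    (h : z ∈ ann I) : z = 0 :=
  hL z fun x => h _ (lie_mem_left Φ L I z x hz)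

/-- The annihilator of a graded ideal is semiprime in degree one. -/
theorem mem_ann_of_sq (H : TKK Vp V0 Vm) (h2 : IsUnit (2 : Φ)) (hL : IsNondegenerateLie L)
    {I : LieIdeal Φ L} (hI : IsGradedIdeal Vp V0 Vm I) {z : L} (hz : z ∈ Vp)
    (h : ∀ w ∈ Vm, ⁅z, ⁅z, w⁆⁆ ∈ ann I) : z ∈ ann I := by
  have J := H.jpair h2
  have hp := H.zdiv_eq_zero hL
  have hm := H.symm.zdiv_eq_zero hL
  have mr : ∀ {x y : L}, y ∈ I → ⁅x, y⁆ ∈ I := fun hy => lie_mem_right Φ L I _ _ hy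
  have ml : ∀ {x y : L}, x ∈ I → ⁅x, y⁆ ∈ I := fun hy => lie_mem_left Φ L I _ _ hy
  have s1 : ∀ w ∈ Vm, w ∈ I → ⁅z, ⁅z, w⁆⁆ = 0 := fun w hw hwI =>
    eq_zero_of_mem_ann hL (mr (mr hwI)) (h w hw)
  have s2 : ∀ w ∈ Vm, w ∈ I → ⁅w, ⁅w, z⁆⁆ = 0 := fun w hw hwI =>
    hm _ ⟨J.symm.mem2 hw hw hz, fun v hv => by
      rw [J.symm.jp3 hw hz hv, s1 _ (J.symm.mem2 hw hw hv) (ml hwI), lie_zero, lie_zero]⟩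
  -- In the degree `(2, 2)` component of the fundamental formula every other term vanishes by `s1`,
  -- `s2` and the hypothesis on `z`, so `⁅b, ⁅w, z⁆⁆` is an absolute zero divisor.
  have s3 : ∀ w ∈ Vm, w ∈ I → ∀ b ∈ Vm, ⁅b, ⁅w, z⁆⁆ = 0 := fun w hw hwI b hb =>
    hm _ ⟨J.symm.mem2 hb hw hz, fun v hv => by
      have e := J.symm.jp3_lin2 hb hw hz hv
      have e1 : ⁅w, ⁅w, ⁅z, ⁅z, ⁅b, ⁅b, v⁆⁆⁆⁆⁆⁆ = 0 := by
        have hA := h _ (J.symm.mem2 hb hb hv)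
        rw [← lie_skew w ⁅z, _⁆, hA w hwI, neg_zero, lie_zero]
      rw [s2 w hw hwI, zero_lie, lie_zero, s1 _ (J.symm.mem2 hb hw hv) (mr (ml hwI)),
        s1 _ (J.symm.mem2 hw hw hv) (ml hwI), e1] at e
      simp only [lie_zero, smul_zero, add_zero] at e
      have e2 : (2 : ℤ) • (2 : ℤ) • ⁅⁅b, ⁅w, z⁆⁆, ⁅⁅b, ⁅w, z⁆⁆, v⁆⁆ = 0 := by
        rw [← e]; module
      rw [two_smul] at e2
      have e3 := J.two _ e2
      rw [two_smul] at e3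
      exact J.two _ e3⟩
  have s3' : ∀ w ∈ Vm, w ∈ I → ∀ b ∈ Vm, ⁅⁅w, z⁆, b⁆ = 0 := fun w hw hwI b hb => by
    rw [← lie_skew, s3 w hw hwI b hb, neg_zero]
  have s4 : ∀ k ∈ V0, k ∈ I → ⁅z, k⁆ = 0 := by
    intro k hk hkI
    have hq : ⁅z, k⁆ ∈ Vp := by rw [← lie_skew]; exact neg_mem (H.lie_0p k hk z hz)
    have hqI : ⁅z, k⁆ ∈ I := mr hkI
    have t1 : ∀ w ∈ Vm, w ∈ I → ∀ b ∈ Vm, ⁅⁅w, ⁅z, k⁆⁆, b⁆ = 0 := by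
      intro w hw hwI b hb
      have hwk : ⁅w, k⁆ ∈ Vm := by rw [← lie_skew]; exact neg_mem (H.lie_0m k hk w hw)
      rw [leibniz_lie, add_lie, lie_lie ⁅w, z⁆, s3' w hw hwI b hb,
        s3' w hw hwI _ (H.lie_0m k hk b hb), ← lie_skew z, neg_lie, s3' _ hwk (ml hwI) b hb]
      simp
    generalize ⁅z, k⁆ = q at *
    -- By `t1`, `⁅w, q⁆` acts as zero on `Vm`, so both `κ₁` and `κ₂` vanish there and `kap_rec`
    -- leaves only the product of quadratic operators.
    have t2 : ∀ w ∈ Vm, w ∈ I → ∀ c ∈ Vm, ⁅w, ⁅w, ⁅q, ⁅q, c⁆⁆⁆⁆ = 0 := by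
      intro w hw hwI c hc
      have e := J.symm.kap_rec hw hq hc 0
      simp only [kap, pw] at e
      rw [t1 w hw hwI w hw, zero_lie, zero_lie, t1 w hw hwI c hc, lie_zero, smul_zero, zero_sub,
        zero_eq_neg] at e
      exact e
    have t3 : ∀ w ∈ Vm, w ∈ I → ⁅q, ⁅q, w⁆⁆ = 0 := fun w hw hwI =>
      hp _ ⟨J.mem2 hq hq hw, fun c hc => by
        rw [J.jp3 hq hw hc, t2 w hw hwI c hc, lie_zero, lie_zero]⟩
    refine hp _ ⟨hq, fun b hb => hp _ ⟨J.mem2 hq hq hb, fun c hc => ?_⟩⟩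
    rw [J.jp3 hq hb hc, t3 _ (J.symm.mem2 hb hb (J.mem2 hq hq hc)) (mr (mr (ml hqI)))]
  have s5 : ∀ w ∈ Vm, w ∈ I → ⁅z, w⁆ = 0 := fun w hw hwI => by
    have e : ⁅w, z⁆ = 0 := hL _ fun x => by
      rw [H.lie_eq_zero (u := ⁅w, z⁆) (fun v hv => ?_) (s3' w hw hwI)]
      rw [lie_lie, H.lie_pp z hz v hv, lie_zero, zero_sub, neg_eq_zero]
      exact s4 _ (H.symm.lie_pm w hw v hv) (ml hwI)
    rw [← lie_skew, e, neg_zero]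
  intro i hi
  obtain ⟨a, ha, b, hb, c, hc, rfl⟩ := H.dec i
  obtain ⟨h1, h3, h4⟩ := hI a ha b hb c hc hi
  rw [lie_add, lie_add, H.lie_pp z hz a ha, s4 b hb h3, s5 c hc h4]
  simp

end TKK

/-! ### Homotope powers and m-sequences -/

namespace LieSeries
variable {M M' : Type*} [LieRing M] [LieRing M']

/-- Coefficientwise application of a map. -/
def map (f : M → M') (g : LieSeries M) : LieSeries M' := fun n => f (g n)

theorem map_lie (f : M →+ M') (hf : ∀ x y, f ⁅x, y⁆ = ⁅f x, f y⁆) (g h : LieSeries M) :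
    map f ⁅g, h⁆ = ⁅map f g, map f h⁆ := by
  ext n
  simp only [map, lie_apply, map_sum, hf]

theorem map_C (f : M →+ M') (x : M) : map f (C x) = C (f x) := by
  ext n
  cases n with
  | zero => rfl
  | succ n => exact f.map_zero

theorem map_pw (f : M →+ M') (hf : ∀ x y, f ⁅x, y⁆ = ⁅f x, f y⁆) (x b : LieSeries M) (n : ℕ) :
    map f (pw x b n) = pw (map f x) (map f b) n := by
  induction n with
  | zero => rfl
  | succ n ih => rw [pw, map_lie f hf, map_lie f hf, ih, pw]

theorem C_mem_closure_zdiv {P N : AddSubgroup M} {x : M} (hx : x ∈ AddSubgroup.closure (zdiv P N)) :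
    C x ∈ AddSubgroup.closure (zdiv (coeffIn P) (coeffIn N)) := by
  have e : ∀ x y : M, C (x + y) = C x + C y := fun x y => by
    ext n
    cases n with
    | zero => rfl
    | succ n => exact (add_zero 0).symm
  have e0 : C (0 : M) = 0 := by ext n; cases n <;> rfl
  induction hx using AddSubgroup.closure_induction with
  | mem z hz =>
    refine AddSubgroup.subset_closure ⟨C_mem hz.1, fun w hw => ?_⟩
    ext n
    rw [C_lie_apply, C_lie_apply, hz.2 _ (hw n)]; rfl
  | zero => rw [e0]; exact zero_mem _
  | add x y _ _ hx hy => rw [e]; exact add_mem hx hy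
  | neg x _ hx =>
    have h : C (-x) = -C x := eq_neg_of_add_eq_zero_left (by rw [← e, neg_add_cancel, e0])
    rw [h]; exact neg_mem hx

end LieSeries

/-- The coefficients of the `n`-th powers of `y` in the homotopes given by power series. -/
def homotopePowers {M : Type*} [LieRing M] (N : AddSubgroup M) (n : ℕ) (y : M) : Set M :=
  {c | ∃ b ∈ LieSeries.coeffIn N, ∃ k, pw (LieSeries.C y) b n k = c}

namespace TKK
variable {Φ : Type*} [CommRing Φ] {L : Type*} [LieRing L] [LieAlgebra Φ L]
  {Vp V0 Vm : Submodule Φ L}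

theorem homotopePowers_map {L' : Type*} [LieRing L'] [LieAlgebra Φ L'] (f : L →ₗ⁅Φ⁆ L') (n : ℕ)
    {y c : L} (h : c ∈ homotopePowers Vm.toAddSubgroup n y) :
    f c ∈ homotopePowers (Vm.map (f : L →ₗ[Φ] L')).toAddSubgroup n (f y) := by
  obtain ⟨b, hb, k, rfl⟩ := h
  refine ⟨LieSeries.map f b, fun i => ⟨_, hb i, rfl⟩, k, ?_⟩
  have := LieSeries.map_pw ((f : L →ₗ[Φ] L').toAddMonoidHom) (fun x y => f.map_lie x y)
    (LieSeries.C y) b n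
  rw [LieSeries.map_C] at this
  exact (congrFun this k).symm

theorem exists_of_homotopePowers_map {L' : Type*} [LieRing L'] [LieAlgebra Φ L'] (f : L →ₗ⁅Φ⁆ L')
    (n : ℕ) {y : L} {c : L'}
    (h : c ∈ homotopePowers (Vm.map (f : L →ₗ[Φ] L')).toAddSubgroup n (f y)) :
    ∃ d ∈ homotopePowers Vm.toAddSubgroup n y, f d = c := by
  obtain ⟨b, hb, k, rfl⟩ := h
  choose b' hb' hbb' using hb
  obtain rfl : LieSeries.map f b' = b := funext hbb'
  refine ⟨_, ⟨b', hb', k, rfl⟩, ?_⟩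
  have := LieSeries.map_pw ((f : L →ₗ[Φ] L').toAddMonoidHom) (fun x y => f.map_lie x y)
    (LieSeries.C y) b' n
  rw [LieSeries.map_C] at this
  exact congrFun this k

theorem gradedGen_map {L' : Type*} [LieRing L'] [LieAlgebra Φ L'] (f : L →ₗ⁅Φ⁆ L') {c s : L}
    (h : GradedGen Vp V0 Vm c s) : GradedGen (Vp.map (f : L →ₗ[Φ] L')) (V0.map (f : L →ₗ[Φ] L'))
      (Vm.map (f : L →ₗ[Φ] L')) (f c) (f s) := fun J hJ hc => by
  have := h _ (isGradedIdeal_comap f hJ) (by simpa using hc)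
  simpa using this

/-- Otherwise the graded ideal of each coefficient `c` meets that of `s` trivially, by
`exists_ne_zero_mem`, so all `c` lie in the annihilator `A` of the latter. Modulo `A` the element
`y` is nil of bounded index and degree one has no absolute zero divisors, so `y ∈ A`. Then `s` is in
`A` and in the ideal annihilated by `A`, and vanishes. -/
theorem exists_gen_homotopePowers (H : TKK Vp V0 Vm) (h2 : IsUnit (2 : Φ))
    (hL : IsNondegenerateLie L) {s y : L} (hs0 : s ≠ 0) (hy : y ∈ Vp)
    (hys : GradedGen Vp V0 Vm y s) (n : ℕ) : ∃ s' ∈ Vp, s' ≠ 0 ∧ GradedGen Vp V0 Vm s s' ∧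
      ∃ c ∈ homotopePowers Vm.toAddSubgroup n y, GradedGen Vp V0 Vm c s' := by
  by_contra! hcon
  have hA := H.ann_graded (gen_graded (Vp := Vp) (V0 := V0) (Vm := Vm) s)
  have hss : s ∈ gen Vp V0 Vm s := mem_gen.2 fun I _ h => h
  have hc : ∀ c ∈ homotopePowers Vm.toAddSubgroup n y, c ∈ ann (gen Vp V0 Vm s) := by
    intro c hc i hi
    have hbot : gen Vp V0 Vm c ⊓ gen Vp V0 Vm s = ⊥ := by
      by_contra hne
      obtain ⟨s', hs', hI, hs'0⟩ :=
        H.exists_ne_zero_mem h2 hL ((gen_graded c).inf (gen_graded s)) hne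
      rw [LieSubmodule.mem_inf] at hI
      exact hcon s' hs' hs'0 (mem_gen.1 hI.2) c hc (mem_gen.1 hI.1)
    have hcc : c ∈ gen Vp V0 Vm c := mem_gen.2 fun I _ h => h
    have : ⁅c, i⁆ ∈ gen Vp V0 Vm c ⊓ gen Vp V0 Vm s :=
      (LieSubmodule.mem_inf _ _ _).2 ⟨lie_mem_left Φ L _ _ _ hcc, lie_mem_right Φ L _ _ _ hi⟩
    rwa [hbot, LieSubmodule.mem_bot] at this
  have hm := fun z hz h => H.mem_ann_of_sq h2 hL (gen_graded (Vp := Vp) (V0 := V0) (Vm := Vm) s)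
    (z := z) hz h
  have hyA : y ∈ ann (gen Vp V0 Vm s) := by
    generalize ann (gen Vp V0 Vm s) = A at *
    have J := (H.quotient hA).jpair h2
    rw [← LieIdeal.quotHom_eq_zero]
    refine J.eq_zero_of_pw_series ?_ ⟨y, hy, rfl⟩ n fun b hb => ?_
    · rintro _ ⟨⟨z, hz, rfl⟩, hzz⟩
      refine (LieIdeal.quotHom_eq_zero _ _).2 (hm z hz fun w hw => ?_)
      rw [← LieIdeal.quotHom_eq_zero, LieHom.map_lie, LieHom.map_lie]
      exact hzz _ ⟨w, hw, rfl⟩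
    · ext k
      obtain ⟨d, hd, hdk⟩ := exists_of_homotopePowers_map A.quotHom n (y := y) ⟨b, hb, k, rfl⟩
      exact hdk.symm.trans ((LieIdeal.quotHom_eq_zero _ _).2 (hc d hd))
  exact hs0 (eq_zero_of_mem_ann hL hss (hys _ hA hyA))

theorem exists_gen_homotopePowers_list (H : TKK Vp V0 Vm) (h2 : IsUnit (2 : Φ))
    (hL : IsNondegenerateLie L) (n : ℕ) (l : List L) : ∀ s ∈ Vp, s ≠ 0 →
    (∀ y ∈ l, y ∈ Vp ∧ GradedGen Vp V0 Vm y s) → ∃ s' ∈ Vp, s' ≠ 0 ∧ GradedGen Vp V0 Vm s s' ∧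
      ∀ y ∈ l, ∃ c ∈ homotopePowers Vm.toAddSubgroup n y, GradedGen Vp V0 Vm c s' := by
  induction l with
  | nil => exact fun s hs hs0 _ => ⟨s, hs, hs0, fun I _ h => h, by simp⟩
  | cons y l ih =>
    intro s hs hs0 hl
    have hy := hl y (by simp)
    obtain ⟨s1, hs1, hs10, hg1, c, hc, hcs⟩ := H.exists_gen_homotopePowers h2 hL hs0 hy.1 hy.2 n
    obtain ⟨s2, hs2, hs20, hg2, hl2⟩ := ih s1 hs1 hs10 fun y' hy' =>
      ⟨(hl y' (by simp [hy'])).1, (hl y' (by simp [hy'])).2.trans hg1⟩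
    refine ⟨s2, hs2, hs20, hg1.trans hg2, fun y' hy' => ?_⟩
    rcases List.mem_cons.1 hy' with rfl | hy'
    · exact ⟨c, hc, hcs.trans hg2⟩
    · exact hl2 y' hy'

/-- Sequences of nonzero elements whose tails generate smaller and smaller ideals, also those of
the powers in homotopes. -/
structure IsMSequence (Vp V0 Vm : Submodule Φ L) (s : ℕ → L) : Prop where
  mem : ∀ k, s k ∈ Vp
  ne_zero : ∀ k, s k ≠ 0
  succ : ∀ k, ∃ u ∈ Vp, ∃ b ∈ Vm, GradedGen Vp V0 Vm (s k) u ∧ s (k + 1) = ⁅⁅u, b⁆, u⁆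
  powers : ∀ k, ∀ j ≤ k, ∃ c ∈ homotopePowers Vm.toAddSubgroup k (s j),
    GradedGen Vp V0 Vm c (s (k + 1))

theorem exists_isMSequence (H : TKK Vp V0 Vm) (h2 : IsUnit (2 : Φ)) (hL : IsNondegenerateLie L)
    {x : L} (hx : x ∈ Vp) (hx0 : x ≠ 0) : ∃ s, IsMSequence Vp V0 Vm s ∧ s 0 = x := by
  -- A state holds the current term and a list of terms constructed so far, itself included; each
  -- listed term must generate a graded ideal containing the current one.
  let State := {p : L × List L // p.1 ∈ Vp ∧ p.1 ≠ 0 ∧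
    ∀ y ∈ p.2, y ∈ Vp ∧ GradedGen Vp V0 Vm y p.1}
  have step : ∀ (n : ℕ) (p : State), ∃ q : State, q.1.2 = q.1.1 :: p.1.2 ∧
      (∃ u ∈ Vp, ∃ b ∈ Vm, GradedGen Vp V0 Vm p.1.1 u ∧ q.1.1 = ⁅⁅u, b⁆, u⁆) ∧
      ∀ y ∈ p.1.2, ∃ c ∈ homotopePowers Vm.toAddSubgroup n y, GradedGen Vp V0 Vm c q.1.1 := by
    rintro n ⟨⟨s, l⟩, hs, hs0, hl⟩
    obtain ⟨u, hu, hu0, hg, hl'⟩ := H.exists_gen_homotopePowers_list h2 hL n l s hs hs0 hl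
    obtain ⟨b, hb, hub⟩ : ∃ b ∈ Vm, ⁅u, ⁅u, b⁆⁆ ≠ 0 := by
      by_contra! hcon
      exact hu0 (H.zdiv_eq_zero hL u ⟨hu, hcon⟩)
    have hgu : GradedGen Vp V0 Vm u ⁅⁅u, b⁆, u⁆ := fun I _ hI => lie_mem_right Φ L _ _ _ hI
    have hmem : ⁅⁅u, b⁆, u⁆ ∈ Vp := H.lie_0p _ (H.lie_pm u hu b hb) u hu
    refine ⟨⟨(⁅⁅u, b⁆, u⁆, ⁅⁅u, b⁆, u⁆ :: l), hmem, ?_, ?_⟩, rfl, ⟨u, hu, b, hb, hg, rfl⟩, ?_⟩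
    · rw [← lie_skew]; exact neg_ne_zero.2 hub
    · intro y hy
      rcases List.mem_cons.1 hy with rfl | hy
      · exact ⟨hmem, fun I _ h => h⟩
      · exact ⟨(hl y hy).1, ((hl y hy).2.trans hg).trans hgu⟩
    · intro y hy
      obtain ⟨c, hc, hcu⟩ := hl' y hy
      exact ⟨c, hc, hcu.trans hgu⟩
  choose F hF1 hF2 hF3 using step
  let st : ℕ → State := fun k => Nat.rec ⟨(x, [x]), hx, hx0, fun y hy => by
    rw [List.mem_singleton] at hy; subst hy; exact ⟨hx, fun I _ h => h⟩⟩ (fun n p => F n p) k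
  have hst : ∀ k, st (k + 1) = F k (st k) := fun k => rfl
  have hmem : ∀ k, ∀ j ≤ k, (st j).1.1 ∈ (st k).1.2 := by
    intro k
    induction k with
    | zero =>
      intro j hj
      obtain rfl : j = 0 := by omega
      exact List.mem_singleton_self x
    | succ k ih =>
      intro j hj
      rw [hst k, hF1]
      rcases Nat.lt_or_ge k j with h | h
      · obtain rfl : j = k + 1 := by omega
        rw [hst k]; exact List.mem_cons_self
      · exact List.mem_cons_of_mem _ (ih j h)
  refine ⟨fun k => (st k).1.1, ⟨fun k => (st k).2.1, fun k => (st k).2.2.1, fun k => ?_,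
    fun k j hj => ?_⟩, rfl⟩
  · exact hF2 k (st k)
  · exact hF3 k (st k) _ (hmem k j hj)

namespace IsMSequence
variable {s : ℕ → L}

theorem gen_le (hs : IsMSequence Vp V0 Vm s) {j k : ℕ} (h : j ≤ k) :
    GradedGen Vp V0 Vm (s j) (s k) := by
  induction k, h using Nat.le_induction with
  | base => exact fun I _ h => h
  | succ k _ ih =>
    obtain ⟨u, -, b, -, hu, e⟩ := hs.succ k
    refine (ih.trans hu).trans fun I _ hI => ?_
    rw [e]
    exact lie_mem_right Φ L _ _ _ hI

/-- A term `s k` in this ideal is nil of bounded index in all series homotopes, so some later term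
lies in the ideal generated by zero. -/
theorem zideal_eq_bot (hs : IsMSequence Vp V0 Vm s)
    (hI : ∀ I : LieIdeal Φ L, IsGradedIdeal Vp V0 Vm I → I ≠ ⊥ → ∃ k, s k ∈ I)
    (H : TKK Vp V0 Vm) (h2 : IsUnit (2 : Φ)) : H.zideal h2 = ⊥ := by
  by_contra hne
  obtain ⟨k, hk⟩ := hI _ (H.zideal_graded h2) hne
  have hcl := LieSeries.C_mem_closure_zdiv (H.mem_closure_of_mem_zideal h2 (hs.mem k) hk)
  obtain ⟨m, hm⟩ := (H.jpair h2).series.exists_pw_eq_zero hcl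
  -- The index must be at least `m` for the power to vanish, and at least `k` for `powers` to speak
  -- about `s k`.
  obtain ⟨c, ⟨b, hb, i, rfl⟩, hc⟩ := hs.powers (max m k) k (le_max_right _ _)
  rw [hm b hb _ (le_max_left _ _)] at hc
  have := hc ⊥ H.isGradedIdeal_bot (by rw [LieSubmodule.mem_bot]; rfl)
  rw [LieSubmodule.mem_bot] at this
  exact hs.ne_zero _ this

end IsMSequence
end TKK

/-! ### Strong primeness of the quotient by a maximal graded ideal -/

namespace TKK
variable {Φ : Type*} [CommRing Φ] {L : Type*} [LieRing L] [LieAlgebra Φ L]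
  {Vp V0 Vm : Submodule Φ L}

/-- Elements of degree zero with square zero annihilate `Vp` if `Vp` has no absolute zero
divisors. -/
theorem lie_eq_zero_of_sq (H : TKK Vp V0 Vm) (h2 : IsUnit (2 : Φ))
    (hz : ∀ z ∈ zdiv Vp.toAddSubgroup Vm.toAddSubgroup, z = 0) {u : L} (hu : u ∈ V0)
    (h : ∀ x : L, ⁅u, ⁅u, x⁆⁆ = 0) {x : L} (hx : x ∈ Vp) : ⁅u, x⁆ = 0 := by
  have hv := H.lie_0p u hu x hx
  have h1 : ∀ m : L, ⁅⁅u, x⁆, ⁅u, m⁆⁆ = 0 := fun m => by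
    have e := h ⁅x, m⁆
    rw [leibniz_lie u x, lie_add, leibniz_lie u ⁅u, x⁆, leibniz_lie u x, h, h, zero_lie, lie_zero,
      zero_add, add_zero] at e
    exact two_cancel h2 _ e
  refine hz _ ⟨hv, fun b hb => ?_⟩
  rw [lie_lie u x b, lie_sub, h1, (H.jpair h2).swap hv hx, h1, lie_zero, sub_zero]

/-- Bracketing an element of `I` twice with `Vm` isolates its degree-one component, in degree minus
one, and dually. So primeness and nonvanishing can be tested on graded ideals. -/
theorem eq_bot_of_homCore_eq_bot (H : TKK Vp V0 Vm) (h2 : IsUnit (2 : Φ))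
    (hz : ∀ z ∈ zdiv Vp.toAddSubgroup Vm.toAddSubgroup, z = 0)
    (hz' : ∀ z ∈ zdiv Vm.toAddSubgroup Vp.toAddSubgroup, z = 0) {I : LieIdeal Φ L}
    (h : H.homCore I = ⊥) : I = ⊥ := by
  have J := H.jpair h2
  have bot : ∀ x ∈ H.homCore I, x = 0 := fun x hx => by rwa [h, LieSubmodule.mem_bot] at hx
  refine (LieSubmodule.eq_bot_iff _).2 fun x hx => ?_
  obtain ⟨a, ha, b, hb, c, hc, rfl⟩ := H.dec x
  have ha0 : a = 0 := J.eq_zero_of_lie_lie hz ha fun y hy w hw => by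
    refine bot _ (H.mem_homCore_m (J.mem_h ha hy hw) ?_)
    have e : ⁅⁅a + b + c, y⁆, w⁆ = ⁅⁅a, y⁆, w⁆ := by
      simp only [add_lie, H.lie_mm c hc y hy, H.lie_mm _ (H.lie_0m b hb y hy) w hw, add_zero]
    rw [← e]
    exact lie_mem_left Φ L _ _ _ (lie_mem_left Φ L _ _ _ hx)
  have hc0 : c = 0 := J.symm.eq_zero_of_lie_lie hz' hc fun y hy w hw => by
    refine bot _ (H.mem_homCore_p (J.symm.mem_h hc hy hw) ?_)
    have e : ⁅⁅a + b + c, y⁆, w⁆ = ⁅⁅c, y⁆, w⁆ := by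
      simp only [add_lie, H.lie_pp a ha y hy, H.lie_pp _ (H.lie_0p b hb y hy) w hw, zero_add]
    rw [← e]
    exact lie_mem_left Φ L _ _ _ (lie_mem_left Φ L _ _ _ hx)
  subst ha0 hc0
  rw [zero_add, add_zero] at hx ⊢
  exact bot _ (H.mem_homCore_0 hb hx)

/-- The ideal spanned by a central element. -/
def centralSpan {u : L} (hu : ∀ x : L, ⁅u, x⁆ = 0) : LieIdeal Φ L where
  toSubmodule := Submodule.span Φ {u}
  lie_mem := by
    intro x m hm
    obtain ⟨r, rfl⟩ := Submodule.mem_span_singleton.1 hm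
    rw [lie_smul, ← lie_skew, hu, neg_zero, smul_zero]
    exact (Submodule.span Φ {u}).zero_mem

theorem mem_centralSpan {u : L} (hu : ∀ x : L, ⁅u, x⁆ = 0) {x : L} :
    x ∈ centralSpan (Φ := Φ) hu ↔ ∃ r : Φ, r • u = x := Submodule.mem_span_singleton

namespace IsMSequence
variable {s : ℕ → L}

/-- The outer components of an element of square zero are absolute zero divisors and vanish. The
remaining degree-zero element is central, and its span is a graded ideal; if nonzero it would
contain some `s k`, which has degree one. -/
theorem isNondegenerateLie (hs : IsMSequence Vp V0 Vm s)
    (hI : ∀ I : LieIdeal Φ L, IsGradedIdeal Vp V0 Vm I → I ≠ ⊥ → ∃ k, s k ∈ I)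
    (H : TKK Vp V0 Vm) (h2 : IsUnit (2 : Φ))
    (hp : ∀ z ∈ zdiv Vp.toAddSubgroup Vm.toAddSubgroup, z = 0)
    (hm : ∀ z ∈ zdiv Vm.toAddSubgroup Vp.toAddSubgroup, z = 0) : IsNondegenerateLie L := by
  intro z hz
  obtain ⟨a, ha, u, hu, c, hc, rfl⟩ := H.dec z
  obtain rfl : a = 0 := hp a ⟨ha, fun w hw => (LieSubmodule.mem_bot (R := Φ) (L := L) _).1
    (H.lie_lie_top_mem H.isGradedIdeal_bot ha hu hc hw ((LieSubmodule.mem_bot _).2 (hz w)))⟩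
  obtain rfl : c = 0 := hm c ⟨hc, fun w hw => (LieSubmodule.mem_bot (R := Φ) (L := L) _).1
    (H.symm.lie_lie_top_mem H.symm.isGradedIdeal_bot hc hu ha hw
      ((LieSubmodule.mem_bot _).2 (by rw [show c + u + 0 = 0 + u + c by abel]; exact hz w)))⟩
  rw [zero_add, add_zero] at hz ⊢
  have hcen := H.lie_eq_zero (fun x hx => H.lie_eq_zero_of_sq h2 hp hu hz hx)
    (fun x hx => H.symm.lie_eq_zero_of_sq h2 hm hu hz hx)
  by_contra hu0
  obtain ⟨k, hk⟩ := hI (centralSpan hcen) (fun a ha b hb c hc h => by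
    obtain ⟨r, hr⟩ := (mem_centralSpan hcen).1 h
    obtain ⟨e1, e2, e3⟩ := H.indep a ha (b - r • u) (sub_mem hb (V0.smul_mem r hu)) c hc (by
      rw [hr]; abel)
    rw [e1, e3, sub_eq_zero.1 e2]
    exact ⟨zero_mem _, (mem_centralSpan hcen).2 ⟨r, rfl⟩, zero_mem _⟩) (fun h => hu0 (by
      have := (mem_centralSpan (Φ := Φ) hcen).2 ⟨1, one_smul _ u⟩
      rwa [h, LieSubmodule.mem_bot] at this))
  obtain ⟨r, hr⟩ := (mem_centralSpan hcen).1 hk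
  refine hs.ne_zero k (H.indep _ (hs.mem k) (-(r • u)) (neg_mem (V0.smul_mem r hu)) 0
    (zero_mem _) ?_).1
  rw [hr]; simp

theorem isStronglyPrimeLie (hs : IsMSequence Vp V0 Vm s)
    (hI : ∀ I : LieIdeal Φ L, IsGradedIdeal Vp V0 Vm I → I ≠ ⊥ → ∃ k, s k ∈ I)
    (H : TKK Vp V0 Vm) (h2 : IsUnit (2 : Φ)) : IsStronglyPrimeLie Φ L := by
  have hbot := hs.zideal_eq_bot hI H h2
  have hp : ∀ z ∈ zdiv Vp.toAddSubgroup Vm.toAddSubgroup, z = 0 := fun z hz => by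
    have := H.zspan_le_zideal h2 (Submodule.subset_span hz)
    rwa [hbot, LieSubmodule.mem_bot] at this
  have hm : ∀ z ∈ zdiv Vm.toAddSubgroup Vp.toAddSubgroup, z = 0 := fun z hz => by
    have := H.zspan_le_zideal' h2 (Submodule.subset_span hz)
    rwa [hbot, LieSubmodule.mem_bot] at this
  refine ⟨⟨s 0, 0, hs.ne_zero 0⟩, fun I J hIJ => ?_, hs.isNondegenerateLie hI H h2 hp hm⟩
  by_contra! hne
  obtain ⟨k, hk⟩ := hI _ (H.homCore_graded I) fun h => hne.1 (H.eq_bot_of_homCore_eq_bot h2 hp hm h)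
  obtain ⟨l, hl⟩ := hI _ (H.homCore_graded J) fun h => hne.2 (H.eq_bot_of_homCore_eq_bot h2 hp hm h)
  obtain ⟨u, -, b, -, hu, e⟩ := hs.succ (max k l)
  have hkI := (hs.gen_le (le_max_left k l)).trans hu _ (H.homCore_graded I) hk
  have hlJ := (hs.gen_le (le_max_right k l)).trans hu _ (H.homCore_graded J) hl
  have := LieSubmodule.lie_mem_lie (lie_mem_left Φ L I u b (H.homCore_le I hkI))
    (H.homCore_le J hlJ)
  rw [hIJ, LieSubmodule.mem_bot, ← e] at this
  exact hs.ne_zero _ this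

theorem map (hs : IsMSequence Vp V0 Vm s) {L' : Type*} [LieRing L'] [LieAlgebra Φ L']
    (f : L →ₗ⁅Φ⁆ L') (hf : ∀ k, f (s k) ≠ 0) : IsMSequence (Vp.map (f : L →ₗ[Φ] L'))
      (V0.map (f : L →ₗ[Φ] L')) (Vm.map (f : L →ₗ[Φ] L')) fun k => f (s k) where
  mem k := ⟨_, hs.mem k, rfl⟩
  ne_zero := hf
  succ k := by
    obtain ⟨u, hu, b, hb, hg, e⟩ := hs.succ k
    exact ⟨_, ⟨u, hu, rfl⟩, _, ⟨b, hb, rfl⟩, gradedGen_map f hg, by simp [e]⟩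
  powers k j hj := by
    obtain ⟨c, hc, hg⟩ := hs.powers k j hj
    exact ⟨_, homotopePowers_map f k hc, gradedGen_map f hg⟩

theorem exists_maximal (hs : IsMSequence Vp V0 Vm s) (H : TKK Vp V0 Vm) :
    ∃ P : LieIdeal Φ L, Maximal (fun I => IsGradedIdeal Vp V0 Vm I ∧ ∀ k, s k ∉ I) P := by
  obtain ⟨P, -, hP⟩ := zorn_le_nonempty₀ {I : LieIdeal Φ L | IsGradedIdeal Vp V0 Vm I ∧ ∀ k, s k ∉ I}
    (fun c hc hch I0 hI0 => by
      have hmem : ∀ x : L, x ∈ sSup c ↔ ∃ I ∈ c, x ∈ I := fun x => by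
        have hne : {p : Submodule Φ L | ∃ I ∈ c, LieSubmodule.toSubmodule I = p}.Nonempty :=
          ⟨_, I0, hI0, rfl⟩
        rw [← LieSubmodule.mem_toSubmodule, LieSubmodule.sSup_toSubmodule,
          Submodule.mem_sSup_of_directed hne]
        · simp
        · rintro _ ⟨I, hI, rfl⟩ _ ⟨J, hJ, rfl⟩
          rcases hch.total hI hJ with h | h
          · exact ⟨J, ⟨J, hJ, rfl⟩, h, le_rfl⟩
          · exact ⟨I, ⟨I, hI, rfl⟩, le_rfl, h⟩
      refine ⟨sSup c, ⟨fun a ha b hb d hd h => ?_, fun k hk => ?_⟩, fun I hI => le_sSup hI⟩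
      · obtain ⟨I, hI, h⟩ := (hmem _).1 h
        obtain ⟨h1, h2, h3⟩ := (hc hI).1 a ha b hb d hd h
        exact ⟨(hmem _).2 ⟨I, hI, h1⟩, (hmem _).2 ⟨I, hI, h2⟩, (hmem _).2 ⟨I, hI, h3⟩⟩
      · obtain ⟨I, hI, h⟩ := (hmem _).1 hk
        exact (hc hI).2 k h) ⊥
    ⟨H.isGradedIdeal_bot, fun k hk => hs.ne_zero k ((LieSubmodule.mem_bot _).1 hk)⟩
  exact ⟨P, hP⟩

end IsMSequence

/-- Maximality of `P` passes to the quotient by preimages: each nonzero graded ideal of `L ⧸ P`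
contains the image of some `s k`. -/
theorem exists_stronglyPrime_of_mem (H : TKK Vp V0 Vm) (h2 : IsUnit (2 : Φ))
    (hL : IsNondegenerateLie L) {x : L} (hx : x ∈ Vp) (hx0 : x ≠ 0) :
    ∃ P : LieIdeal Φ L, IsGradedIdeal Vp V0 Vm P ∧ x ∉ P ∧ IsStronglyPrimeLie Φ (L ⧸ P) := by
  obtain ⟨s, hs, rfl⟩ := H.exists_isMSequence h2 hL hx hx0
  obtain ⟨P, ⟨hPg, hPs⟩, hPmax⟩ := hs.exists_maximal H
  refine ⟨P, hPg, hPs 0, (hs.map P.quotHom fun k => ?_).isStronglyPrimeLie (fun I hI hne => ?_)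
    (H.quotient hPg) h2⟩
  · rw [Ne, LieIdeal.quotHom_eq_zero]; exact hPs k
  · by_contra! hcon
    have hle : P ≤ I.comap P.quotHom := fun x hx => by
      rw [LieIdeal.mem_comap, (P.quotHom_eq_zero x).2 hx]; exact zero_mem _
    have hge := hPmax (y := I.comap P.quotHom)
      ⟨isGradedIdeal_comap _ hI, fun k hk => hcon k (by rwa [LieIdeal.mem_comap] at hk)⟩ hle
    refine hne ((LieSubmodule.eq_bot_iff _).2 fun y hy => ?_)
    obtain ⟨y, rfl⟩ := P.quotHom_surjective y
    exact (P.quotHom_eq_zero y).2 (hge (by rwa [LieIdeal.mem_comap]))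

theorem exists_stronglyPrime (H : TKK Vp V0 Vm) (h2 : IsUnit (2 : Φ))
    (hL : IsNondegenerateLie L) {x : L} (hx0 : x ≠ 0) :
    ∃ P : LieIdeal Φ L, IsGradedIdeal Vp V0 Vm P ∧ x ∉ P ∧ IsStronglyPrimeLie Φ (L ⧸ P) := by
  obtain ⟨a, ha, b, hb, c, hc, rfl⟩ := H.dec x
  have sym : ∀ x ∈ Vm, x ≠ 0 →
      ∃ P : LieIdeal Φ L, IsGradedIdeal Vp V0 Vm P ∧ x ∉ P ∧ IsStronglyPrimeLie Φ (L ⧸ P) := by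
    intro x hx hx0
    obtain ⟨P, h1, h3, h4⟩ := H.symm.exists_stronglyPrime_of_mem h2 hL hx hx0
    exact ⟨P, h1.symm, h3, h4⟩
  by_cases ha0 : a = 0
  · by_cases hc0 : c = 0
    · subst ha0 hc0
      rw [zero_add, add_zero] at *
      -- A nonzero degree-zero element is not central, so an ideal avoiding one of its brackets with
      -- an outer element avoids it too.
      have : (∃ y ∈ Vp, ⁅b, y⁆ ≠ 0) ∨ ∃ y ∈ Vm, ⁅b, y⁆ ≠ 0 := by
        by_contra! hcon
        exact hx0 (hL b fun x => by rw [H.lie_eq_zero hcon.1 hcon.2])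
      rcases this with ⟨y, hy, h⟩ | ⟨y, hy, h⟩
      · obtain ⟨P, h1, h3, h4⟩ := H.exists_stronglyPrime_of_mem h2 hL (H.lie_0p b hb y hy) h
        exact ⟨P, h1, fun hbP => h3 (lie_mem_left Φ L P b y hbP), h4⟩
      · obtain ⟨P, h1, h3, h4⟩ := sym _ (H.lie_0m b hb y hy) h
        exact ⟨P, h1, fun hbP => h3 (lie_mem_left Φ L P b y hbP), h4⟩
    · obtain ⟨P, h1, h3, h4⟩ := sym c hc hc0
      exact ⟨P, h1, fun h => h3 (h1 a ha b hb c hc h).2.2, h4⟩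
  · obtain ⟨P, h1, h3, h4⟩ := H.exists_stronglyPrime_of_mem h2 hL ha ha0
    exact ⟨P, h1, fun h => h3 (h1 a ha b hb c hc h).1, h4⟩

end TKK

/-! ### The subdirect decomposition -/

theorem mainTheorem8 {Φ : Type u} [CommRing Φ] (h2 : IsUnit (2 : Φ)) {L : Type v} [LieRing L]
    [LieAlgebra Φ L] (𝓛 : ℤ → Submodule Φ L) (h𝓛 : IsJordanThreeGrading 𝓛) :
    IsJordanThreeGrading (quotientGrading 𝓛 (kostrikinRadical Φ L)) ∧
    ∃ (ι : Type v) (S : ι → Type v) (_ : ∀ i, LieRing (S i)) (_ : ∀ i, LieAlgebra Φ (S i))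
      (𝓢 : ∀ i, ℤ → Submodule Φ (S i))
      (f : ∀ i, (L ⧸ kostrikinRadical Φ L) →ₗ⁅Φ⁆ S i),
      (∀ i, IsJordanThreeGrading (𝓢 i) ∧ IsStronglyPrimeLie Φ (S i)) ∧
      IsGradedSubdirectProduct (quotientGrading 𝓛 (kostrikinRadical Φ L)) 𝓢 f := by
  have hq := TKK.quotientGrading h2 h𝓛 (h𝓛.tkk h2).kostrikinRadical_graded
  have hK : IsNondegenerateLie (L ⧸ kostrikinRadical Φ L) := (kostrikinRadical_isLeast Φ L).1
  refine ⟨hq, ?_⟩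
  generalize quotientGrading 𝓛 (kostrikinRadical Φ L) = 𝓐 at *
  -- One factor for each nonzero element `y`, with kernel missing `y`; injectivity is read off at `y
  -- = x - y'` for distinct `x`, `y'`.
  choose P hPg hPm hPs using fun y : {y : L ⧸ kostrikinRadical Φ L // y ≠ 0} =>
    (hq.tkk h2).exists_stronglyPrime h2 hK y.2
  refine ⟨{y : L ⧸ kostrikinRadical Φ L // y ≠ 0}, fun i => _ ⧸ P i, fun i => inferInstance,
    fun i => inferInstance, fun i => quotientGrading 𝓐 (P i), fun i => (P i).quotHom,
    fun i => ⟨TKK.quotientGrading h2 hq (hPg i), hPs i⟩, fun x y hxy => ?_,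
    fun i => (P i).quotHom_surjective, fun i n x hx => ⟨x, hx, rfl⟩⟩
  by_contra hne
  have h : (P ⟨x - y, sub_ne_zero.2 hne⟩).quotHom (x - y) = 0 := by
    rw [map_sub, sub_eq_zero]; exact congrFun hxy ⟨x - y, sub_ne_zero.2 hne⟩
  exact hPm _ ((LieIdeal.quotHom_eq_zero _ _).1 h)
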